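/- **Setting.** All bit lengths below are polynomially bounded functions of the security parameter $n$. A *pair of trapdoor permutations* $(\mathcal F_1,\mathcal F_2)$ consists of a key generator $G(1^n)\to(\mathsf{sk},\mathsf{pk})$ and functions $f_1,f_2,f_1^{-1},f_2^{-1}$ such that for every generated key pair $f_1(\mathsf{pk},\cdot)$ and $f_2(\mathsf{pk},\cdot)$ are permutations of the same set $D_{\mathsf{pk}}$ of strings of length $\ell(n)$, with inverses $f_1^{-1}(\mathsf{sk},\cdot)$ and $f_2^{-1}(\mathsf{sk},\cdot)$ on $D_{\mathsf{pk}}$; $f_1$, $f_2$ are efficiently computable, membership in $D_{\mathsf{pk}}$ is efficiently decidable, and a uniform element of $D_{\mathsf{pk}}$ can be computed efficiently from uniform coins $\rho$, as $\mathrm{samp}(\mathsf{pk},\rho)$. A *claw* for $\mathsf{pk}$ is a pair $(x_1,x_2)\in D_{\mathsf{pk}}^2$ with $f_1(\mathsf{pk},x_1)=f_2(\mathsf{pk},x_2)$. In the claw-finding problem one is given $\mathsf{pk}$, generated by $G$, and has to output a claw; the pair is *claw-free* if every polynomial-time quantum algorithm succeeds with negligible probability. Quantum algorithms are families of quantum circuits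 of polynomial size (efficient classical ones: families of Boolean circuits of polynomial size). *Katz–Wang scheme.* Messages have length $\mu(n)$, the random oracle $O$ maps $\{0,1\}\times\{0,1\}^{\mu(n)}$ to $D_{\mathsf{pk}}$. $S^O(\mathsf{sk},m)=f_1^{-1}(\mathsf{sk},O(b,m))$ for a random bit $b$; $\sigma\in D_{\mathsf{pk}}$ is a valid signature of $m$ iff $f_1(\mathsf{pk},\sigma)=O(0,m)$ or $f_1(\mathsf{pk},\sigma)=O(1,m)$. In the forgery game a quantum adversary $A$ gets $\mathsf{pk}$, quantum access to $O$ and classical access to a signing oracle, and wins if it outputs a valid signature on a message it did not have signed. Let $\mathrm{Adv}(A)$ be its winning probability if $b$ is fresh for every query, $\mathrm{Adv}_{\ne}(A)$ the probability that it wins this game and never asked twice for a signature on the same message, and $\mathrm{Adv}_{=}(A)$ its winning probability if $b$ is drawn once for each message. *History-free reduction.* A history-free reduction to a problem $P$ consists of efficient algorithms $\mathrm{START}(x)=(\mathsf{pk},z)$, $\mathrm{RAND}^{O_c}(r,z)$, $\mathrm{SIGN}^{O_c}(m,z)$, $\mathrm{FINISH}^{O_c}(m,\sigma,z)$, $\mathrm{INSTANCE}(\mathsf{pk})$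 with a private random oracle $O_c$. On an instance $x$ the reduction runs $A$ on $\mathsf{pk}$, answers its random oracle and signing queries with $\mathrm{RAND}^{O_c}(\cdot,z)$ and $\mathrm{SIGN}^{O_c}(\cdot,z)$, and answers the challenger of $P$ with $\mathrm{FINISH}^{O_c}(m,\sigma,z)$, where $(m,\sigma)$ is the output of $A$. It is required that - $\mathrm{START}(\mathrm{INSTANCE}(\mathsf{pk}))=(\mathsf{pk},\cdot)$, and for generated $\mathsf{pk}$ the distribution of $\mathrm{INSTANCE}(\mathsf{pk})$ is negligibly close to that of the instances of $P$; - for each fixed $z$, $\mathrm{RAND}^{O_c}(\cdot,z)$ is indistinguishable from a random oracle by polynomial-time quantum algorithms with quantum oracle access; - $\mathrm{SIGN}$ aborts or outputs a valid signature relative to the simulated oracle; given no abort, its signatures on polynomially many distinct messages are, jointly with the oracle, negligibly close in distribution to correct ones; for every polynomial-time quantum $A$ the probability that no signing query aborts is non-negligible. It *succeeds with probability at least $\delta$* ($\delta$ non-negligible) if for every polynomial-time quantum $A$, given that $A$ outputs a valid forgery relative to the simulated oracle, the challenger of $P$ accepts with probability at least $\delta$. **Theorem.** Let $(\mathcal F_1,\mathcal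 F_2)$ be a pair of trapdoor permutations. 1. The following is a history-free reduction from forging Katz–Wang signatures to claw-finding that succeeds with probability at least $1/2$: $\mathrm{INSTANCE}(\mathsf{pk})=\mathsf{pk}$ and $\mathrm{START}(\mathsf{pk})=(\mathsf{pk},\mathsf{pk})$; $O_c(m)$ consists of a random bit $b$ and independent coins for two elements $a,a'$ of $D_{\mathsf{pk}}$ (computed with $\mathrm{samp}$); $\mathrm{RAND}$ returns $f_1(\mathsf{pk},a)$ at $(b,m)$ and $f_2(\mathsf{pk},a')$ at $(1-b,m)$; $\mathrm{SIGN}$ returns $a$; $\mathrm{FINISH}$ returns $(\sigma,a')$. 2. If $\varepsilon$ is the probability that this reduction, with a truly random $O_c$ and the quantum adversary $A$, finds a claw, then $\mathrm{Adv}_{=}(A)\le 2\varepsilon$ and $\mathrm{Adv}_{\ne}(A)\le 2\varepsilon$ for each $n$. 3. Assume that quantum-accessible pseudorandom functions exist (for all polynomially bounded input and output lengths, with keys of length $n$). Then for every polynomial-time quantum adversary $A$ there are a polynomial-time quantum algorithm $B$ and a negligible $\nu$ such that, if $\varepsilon_B(n)$ is the probability that $B$ finds a claw, $\mathrm{Adv}_{=}(A)\le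 2\varepsilon_B+\nu$ and $\mathrm{Adv}_{\ne}(A)\le 2\varepsilon_B+\nu$. 4. If moreover the pair is claw-free, then the Katz–Wang scheme is secure in the quantum-accessible random oracle model: $\mathrm{Adv}(A)$ and $\mathrm{Adv}_{=}(A)$ are negligible for every polynomial-time quantum adversary $A$. -/

import Mathlib

open scoped BigOperators

noncomputable section

namespace QROM

/-! ## Bit strings, asymptotics -/

/-- Bit strings of length `k`. -/
abbrev Bits (k : ℕ) : Type := Fin k → Bool

/-- The first `a` bits of a string of length `a + b`. -/
def left {a b : ℕ} (w : Bits (a + b)) : Bits a := fun i => w (Fin.castAdd b i)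

/-- The last `b` bits of a string of length `a + b`. -/
def right {a b : ℕ} (w : Bits (a + b)) : Bits b := fun i => w (Fin.natAdd a i)

/-- A one-bit string. -/
def bit (b : Bool) : Bits 1 := fun _ => b

/-- Encoding of an optional string; the leading bit says whether there is one. -/
def optBits {k : ℕ} : Option (Bits k) → Bits (k + 1)
  | none => fun _ => false
  | some v => Fin.cons true v

def PolyBounded (f : ℕ → ℕ) : Prop :=
  ∃ p : Polynomial ℕ, ∀ n, f n ≤ p.eval n

/-- `ε` is negligible in the security parameter. -/
def Negligible (ε : ℕ → ℝ) : Prop :=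
  Asymptotics.SuperpolynomialDecay Filter.atTop (fun n : ℕ => (n : ℝ)) ε

/-! ## Efficient classical algorithms: polynomial-size Boolean circuits with oracle gates -/

/-- A gate of a straight-line program. Wires are numbered in the order in which they are created
(the input wires first). A `nand` gate creates one wire, an `oracle` gate applies an oracle
`Bits a → Bits b` to the values of `a` wires and creates `b` wires. -/
inductive CGate (a : ℕ) : Type
  | nand (i j : ℕ)
  | oracle (x : Fin a → ℕ)

/-- The values of all wires after one more gate (a wire that does not exist reads `false`). -/
def CGate.step {a b : ℕ} (O : Bits a → Bits b) (w : List Bool) : CGate a → List Bool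
  | .nand i j => w ++ [!(w.getD i false && w.getD j false)]
  | .oracle x => w ++ List.ofFn (O fun k => w.getD (x k) false)

/-- A Boolean circuit with `i` inputs, `o` outputs and oracle gates for `Bits a → Bits b`.
For `a = b = 0` an oracle gate does nothing: this is the case of a circuit without oracle. -/
structure CCircuit (a b i o : ℕ) : Type where
  gates : List (CGate a)
  out : Fin o → ℕ

def CCircuit.eval {a b i o : ℕ} (C : CCircuit a b i o) (O : Bits a → Bits b) (x : Bits i) :
    Bits o :=
  fun k => (C.gates.foldl (CGate.step O) (List.ofFn x)).getD (C.out k) false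

/-- The function family `F`, relative to an oracle, is computed by a family of oracle circuits of
polynomial size. -/
def EfficientRel (a b i o : ℕ → ℕ)
    (F : ∀ n, (Bits (a n) → Bits (b n)) → Bits (i n) → Bits (o n)) : Prop :=
  ∃ C : ∀ n, CCircuit (a n) (b n) (i n) (o n),
    PolyBounded (fun n => (C n).gates.length) ∧ ∀ n O x, (C n).eval O x = F n O x

/-- The function family `F` is computed by a family of circuits of polynomial size. -/
def Efficient (i o : ℕ → ℕ) (F : ∀ n, Bits (i n) → Bits (o n)) : Prop :=
  EfficientRel (fun _ => 0) (fun _ => 0) i o fun n _ x => F n x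

/-! ## Quantum circuits with a quantum-accessible oracle and a classical signing oracle -/

/-- Gates on `N` qubits: Hadamard, phase, pi/8 and CNOT, together with NOT and Toffoli, which are
fixed products of these. -/
inductive QGate (N : ℕ) : Type
  | hadamard (q : Fin N)
  | phase (q : Fin N)
  | pi8 (q : Fin N)
  | not (q : Fin N)
  | cnot (c t : Fin N) (h : c ≠ t)
  | toffoli (c d t : Fin N) (hcd : c ≠ d) (hc : c ≠ t) (hd : d ≠ t)

/-- Vectors of the `N`-qubit system, in coordinates with respect to the computational basis. -/
abbrev QState (N : ℕ) : Type := Bits N → ℂ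

def QGate.apply {N : ℕ} (ψ : QState N) : QGate N → QState N
  | .hadamard q => fun s =>
      (ψ (Function.update s q false) +
        (if s q then -1 else 1) * ψ (Function.update s q true)) / (Real.sqrt 2 : ℂ)
  | .phase q => fun s => (if s q then Complex.I else 1) * ψ s
  | .pi8 q => fun s => (if s q then Complex.exp (Complex.I * Real.pi / 4) else 1) * ψ s
  | .not q => fun s => ψ (Function.update s q (!(s q)))
  | .cnot c t _ => fun s => ψ (Function.update s t (xor (s t) (s c)))
  | .toffoli c d t _ _ _ => fun s => ψ (Function.update s t (xor (s t) (s c && s d)))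

/-- The basis string `s` with the string `v` added modulo 2 on the wires `y`. -/
def xorAt {N b : ℕ} (y : Fin b ↪ Fin N) (v : Bits b) (s : Bits N) : Bits N :=
  fun w => xor (s w) (decide (∃ j, y j = w ∧ v j = true))

/-- One step of a quantum algorithm: a gate, a query in superposition to an oracle
`Bits a → Bits b`, or a classical signing query (messages of `μ` bits, signatures of `s` bits).
Queries read the wires `x` and add the answer modulo 2 on the wires `y`. -/
inductive QInstr (N a b μ s : ℕ) : Type
  | gate (g : QGate N)
  | query (x : Fin a ↪ Fin N) (y : Fin b ↪ Fin N) (h : ∀ i j, x i ≠ y j)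
  | sign (x : Fin μ ↪ Fin N) (y : Fin s ↪ Fin N) (h : ∀ i j, x i ≠ y j)

/-- Total weight of the event `E` (a predicate on the list of messages sent to the signing oracle
and on the final measured basis string) when the instructions are run on the subnormalised state
`ψ`. A signing query first measures the message wires, with unnormalised post-measurement states,
so that the weights of the branches are their probabilities. The signing oracle `sgn` uses `c`
fresh uniform coins for each query; `none` means that the experiment is aborted. -/
def weight {N a b μ s c : ℕ} (O : Bits a → Bits b)
    (sgn : Bits c → Bits μ → Option (Bits s)) (E : List (Bits μ) → Bits N → Bool) :
    List (QInstr N a b μ s) → List (Bits μ) → QState N → ℝ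
  | [], log, ψ => ∑ t : Bits N, if E log t then ‖ψ t‖ ^ 2 else 0
  | .gate g :: rest, log, ψ => weight O sgn E rest log (g.apply ψ)
  | .query x y _ :: rest, log, ψ =>
      weight O sgn E rest log (fun t => ψ (xorAt y (O (t ∘ x)) t))
  | .sign x y _ :: rest, log, ψ =>
      ∑ m : Bits μ, 𝔼 ρ : Bits c,
        match sgn ρ m with
        | none => 0
        | some σ => weight O sgn E rest (m :: log)
            (fun t => if t ∘ x = m then ψ (xorAt y σ t) else 0)

/-- A quantum algorithm with `i` input bits and `o` output bits. The input is written on the wires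
`inp`, all other wires start in the state 0, and at the end all wires are measured and the output
is read from the wires `out`. A query to an oracle with 0 input and 0 output bits does nothing, so
`a = b = 0` means "no oracle" and `μ = s = 0` means "no signing oracle". -/
structure QCircuit (a b μ s i o : ℕ) : Type where
  wires : ℕ
  instrs : List (QInstr wires a b μ s)
  inp : Fin i ↪ Fin wires
  out : Fin o → Fin wires

/-- Number of qubits plus number of gates and queries. -/
def QCircuit.size {a b μ s i o : ℕ} (C : QCircuit a b μ s i o) : ℕ :=
  C.wires + C.instrs.length

/-- Probability that the event `E` (on the list of signed messages and the output) occurs when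
`C` is run on input `x` with random oracle `O` and signing oracle `sgn`. -/
def QCircuit.prob {a b μ s i o c : ℕ} (C : QCircuit a b μ s i o) (O : Bits a → Bits b)
    (sgn : Bits c → Bits μ → Option (Bits s)) (x : Bits i)
    (E : List (Bits μ) → Bits o → Bool) : ℝ :=
  weight O sgn (fun log t => E log (t ∘ C.out)) C.instrs []
    (Pi.single (xorAt C.inp x fun _ => false) 1)

/-- The trivial oracle on 0 bits. -/
def noOracle : Bits 0 → Bits 0 := id

/-- The trivial signing oracle on 0 bits. -/
def noSign : Bits 0 → Bits 0 → Option (Bits 0) := fun _ => some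

/-- Polynomial-time quantum algorithms: families of circuits of polynomial size. -/
def PolySize {a b μ s i o : ℕ → ℕ}
    (A : ∀ n, QCircuit (a n) (b n) (μ n) (s n) (i n) (o n)) : Prop :=
  PolyBounded fun n => (A n).size

/-! ## Oracle indistinguishability and pseudorandom functions -/

/-- Quantum algorithms with oracle access that output one bit. -/
abbrev Distinguisher (a b : ℕ → ℕ) : Type := ∀ n, QCircuit (a n) (b n) 0 0 0 1

/-- Probability that `D` outputs 1 with oracle `O`. -/
def Distinguisher.accProb {a b : ℕ → ℕ} (D : Distinguisher a b) (n : ℕ)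
    (O : Bits (a n) → Bits (b n)) : ℝ :=
  (D n).prob O noSign Fin.elim0 fun _ t => t 0

/-- Keys of length `n`; secure against distinguishers with quantum access to the function. -/
def IsQuantumPRF (a b : ℕ → ℕ) (F : ∀ n, Bits n → Bits (a n) → Bits (b n)) : Prop :=
  Efficient (fun n => n + a n) b (fun n w => F n (left w) (right w)) ∧
  ∀ D : Distinguisher a b, PolySize D →
    Negligible fun n =>
      |(𝔼 k : Bits n, D.accProb n (F n k)) - 𝔼 O : Bits (a n) → Bits (b n), D.accProb n O|

/-- Quantum-accessible pseudorandom functions exist (for all polynomially bounded input and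
output lengths). -/
def QuantumPRFsExist : Prop :=
  ∀ a b : ℕ → ℕ, PolyBounded a → PolyBounded b → ∃ F, IsQuantumPRF a b F

/-! ## Problems with a noninteractive challenger, with threshold 0 -/

/-- The challenger samples an instance `x`, sends it to the adversary, receives an answer `y` and
outputs `accept x y`. -/
structure Problem : Type where
  instLen : ℕ → ℕ
  ansLen : ℕ → ℕ
  gen : ∀ n, PMF (Bits (instLen n))
  accept : ∀ n, Bits (instLen n) → Bits (ansLen n) → Bool

abbrev Problem.Solver (P : Problem) : Type := ∀ n, QCircuit 0 0 0 0 (P.instLen n) (P.ansLen n)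

/-- The advantage of `B` in the problem `P`. -/
def Problem.adv (P : Problem) (B : P.Solver) (n : ℕ) : ℝ :=
  ∑ x, (P.gen n x).toReal * (B n).prob noOracle noSign x fun _ y => P.accept n x y

/-- `P` is hard for quantum computers. -/
def Problem.Hard (P : Problem) : Prop :=
  ∀ B : P.Solver, PolySize B → Negligible (P.adv B)

/-! ## Signature schemes in the random oracle model -/

/-- A signature scheme in the random oracle model. For the public key `pk` the random oracle takes
values in `rng n pk`. Signing is randomised, with `coinLen n` coins. -/
structure SigScheme : Type where
  pkLen : ℕ → ℕ
  skLen : ℕ → ℕ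
  msgLen : ℕ → ℕ
  sigLen : ℕ → ℕ
  coinLen : ℕ → ℕ
  roIn : ℕ → ℕ
  roOut : ℕ → ℕ
  /-- Pairs of a secret and a public key. -/
  keyGen : ∀ n, PMF (Bits (skLen n) × Bits (pkLen n))
  rng : ∀ n, Bits (pkLen n) → Finset (Bits (roOut n))
  sign : ∀ n, (Bits (roIn n) → Bits (roOut n)) → Bits (skLen n) → Bits (msgLen n) →
    Bits (coinLen n) → Bits (sigLen n)
  verify : ∀ n, (Bits (roIn n) → Bits (roOut n)) → Bits (pkLen n) → Bits (msgLen n) →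
    Bits (sigLen n) → Bool
  correct : ∀ n, ∀ k ∈ (keyGen n).support, ∀ O, (∀ r, O r ∈ rng n k.2) →
    ∀ m ρ, verify n O k.2 m (sign n O k.1 m ρ) = true

namespace SigScheme

variable (S : SigScheme)

/-- All oracles with values in the prescribed range. -/
def oracles (n : ℕ) (pk : Bits (S.pkLen n)) : Finset (Bits (S.roIn n) → Bits (S.roOut n)) :=
  Fintype.piFinset fun _ => S.rng n pk

/-- Adversaries: input a public key, quantum access to the random oracle, classical access to the
signing oracle, output a message and a signature. -/
abbrev Forger : Type :=
  ∀ n, QCircuit (S.roIn n) (S.roOut n) (S.msgLen n) (S.sigLen n) (S.pkLen n)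
    (S.msgLen n + S.sigLen n)

/-- The output `y` is a valid signature on a message that was not signed before. -/
def isForgery (n : ℕ) (O : Bits (S.roIn n) → Bits (S.roOut n)) (pk : Bits (S.pkLen n))
    (log : List (Bits (S.msgLen n))) (y : Bits (S.msgLen n + S.sigLen n)) : Bool :=
  decide (left y ∉ log) && S.verify n O pk (left y) (right y)

/-- Existential forgery under a chosen message attack. Each signing query uses fresh coins. -/
def adv (A : S.Forger) (n : ℕ) : ℝ :=
  ∑ k, (S.keyGen n k).toReal * 𝔼 O ∈ S.oracles n k.2,
    (A n).prob O (fun (ρ : Bits (S.coinLen n)) m => some (S.sign n O k.1 m ρ)) k.2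
      (S.isForgery n O k.2)

/-- The probability that the adversary wins the same game and moreover has not asked twice for a
signature on the same message. -/
def advDistinct (A : S.Forger) (n : ℕ) : ℝ :=
  ∑ k, (S.keyGen n k).toReal * 𝔼 O ∈ S.oracles n k.2,
    (A n).prob O (fun (ρ : Bits (S.coinLen n)) m => some (S.sign n O k.1 m ρ)) k.2
      (fun log y => decide log.Nodup && S.isForgery n O k.2 log y)

/-- The same game where the coins are drawn once for each message, so that the signer repeats its
signature when it is asked again for the same message. -/
def advRepeat (A : S.Forger) (n : ℕ) : ℝ :=
  ∑ k, (S.keyGen n k).toReal * 𝔼 O ∈ S.oracles n k.2,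
    𝔼 β : Bits (S.msgLen n) → Bits (S.coinLen n),
      (A n).prob O (fun (_ : Bits 0) m => some (S.sign n O k.1 m (β m))) k.2
        (S.isForgery n O k.2)

/-- Security in the quantum-accessible random oracle model. -/
def Secure : Prop := ∀ A : S.Forger, PolySize A → Negligible (S.adv A)

/-- Security if signatures on the same message are repeated. -/
def SecureRepeat : Prop := ∀ A : S.Forger, PolySize A → Negligible (S.advRepeat A)

end SigScheme

/-! ## History-free reductions -/

/-- The algorithms of a history-free reduction from forging signatures of `S` to the problem `P`;
`zLen` is the length of the private state, and the private random oracle maps `Bits cIn` to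
`Bits cOut`. The output `none` of `sign` and `finish` means that the reduction aborts. -/
structure Reduction (S : SigScheme) (P : Problem) : Type where
  zLen : ℕ → ℕ
  cIn : ℕ → ℕ
  cOut : ℕ → ℕ
  start : ∀ n, Bits (P.instLen n) → Bits (S.pkLen n) × Bits (zLen n)
  rand : ∀ n, (Bits (cIn n) → Bits (cOut n)) → Bits (S.roIn n) → Bits (zLen n) →
    Bits (S.roOut n)
  sign : ∀ n, (Bits (cIn n) → Bits (cOut n)) → Bits (S.msgLen n) → Bits (zLen n) →
    Option (Bits (S.sigLen n))
  finish : ∀ n, (Bits (cIn n) → Bits (cOut n)) → Bits (S.msgLen n) → Bits (S.sigLen n) →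
    Bits (zLen n) → Option (Bits (P.ansLen n))
  inst : ∀ n, Bits (S.pkLen n) → Bits (P.instLen n)

namespace Reduction

variable {S : SigScheme} {P : Problem} (R : Reduction S P)

/-- All algorithms of the reduction are efficient. -/
def IsEfficient : Prop :=
  PolyBounded R.zLen ∧ PolyBounded R.cIn ∧ PolyBounded R.cOut ∧
  Efficient P.instLen (fun n => S.pkLen n + R.zLen n)
    (fun n x => Fin.append (R.start n x).1 (R.start n x).2) ∧
  EfficientRel R.cIn R.cOut (fun n => S.roIn n + R.zLen n) S.roOut
    (fun n Oc w => R.rand n Oc (left w) (right w)) ∧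
  EfficientRel R.cIn R.cOut (fun n => S.msgLen n + R.zLen n) (fun n => S.sigLen n + 1)
    (fun n Oc w => optBits (R.sign n Oc (left w) (right w))) ∧
  EfficientRel R.cIn R.cOut (fun n => S.msgLen n + S.sigLen n + R.zLen n)
    (fun n => P.ansLen n + 1)
    (fun n Oc w => optBits (R.finish n Oc (left (left w)) (right (left w)) (right w))) ∧
  Efficient S.pkLen P.instLen R.inst

/-- The experiment in which the reduction, with a truly random private oracle `Oc`, receives an
instance `x` from the challenger of `P` and runs the adversary `A`: the probability that there is
no abort before the end of the run of `A` and that the event `E` occurs, which may depend on `Oc`,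
on `x`, on the list of signed messages and on the output of `A`. -/
def simProb (A : S.Forger) (n : ℕ)
    (E : (Bits (R.cIn n) → Bits (R.cOut n)) → Bits (P.instLen n) → List (Bits (S.msgLen n)) →
      Bits (S.msgLen n + S.sigLen n) → Bool) : ℝ :=
  ∑ x, (P.gen n x).toReal * 𝔼 Oc : Bits (R.cIn n) → Bits (R.cOut n),
    (A n).prob (fun r => R.rand n Oc r (R.start n x).2)
      (fun (_ : Bits 0) m => R.sign n Oc m (R.start n x).2) (R.start n x).1 (E Oc x)

/-- The output of `A` is a forgery relative to the simulated random oracle. -/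
def forged (n : ℕ) (Oc : Bits (R.cIn n) → Bits (R.cOut n)) (x : Bits (P.instLen n))
    (log : List (Bits (S.msgLen n))) (y : Bits (S.msgLen n + S.sigLen n)) : Bool :=
  S.isForgery n (fun r => R.rand n Oc r (R.start n x).2) (R.start n x).1 log y

/-- The challenger of `P` accepts the final output of the reduction. -/
def solved (n : ℕ) (Oc : Bits (R.cIn n) → Bits (R.cOut n)) (x : Bits (P.instLen n))
    (_log : List (Bits (S.msgLen n))) (y : Bits (S.msgLen n + S.sigLen n)) : Bool :=
  (R.finish n Oc (left y) (right y) (R.start n x).2).elim false (P.accept n x)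

/-- The probability that the reduction, run with the adversary `A`, solves `P`. -/
def simAdv (A : S.Forger) (n : ℕ) : ℝ := R.simProb A n (R.solved n)

/-- `INSTANCE` inverts `START` and produces instances that are distributed as in the game. -/
def InstanceOK : Prop :=
  (∀ n pk, (R.start n (R.inst n pk)).1 = pk) ∧
  Negligible fun n => ∑ x, |(((S.keyGen n).map fun k => R.inst n k.2) x).toReal -
    (P.gen n x).toReal|

/-- For every fixed private state the simulated random oracle is quantum computationally
indistinguishable from a random oracle. -/
def RandOK : Prop :=
  ∀ x : ∀ n, Bits (P.instLen n), (∀ n, x n ∈ (P.gen n).support) →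
    ∀ D : Distinguisher S.roIn S.roOut, PolySize D →
      Negligible fun n =>
        |(𝔼 Oc : Bits (R.cIn n) → Bits (R.cOut n),
            D.accProb n fun r => R.rand n Oc r (R.start n (x n)).2) -
          𝔼 O ∈ S.oracles n (R.start n (x n)).1, D.accProb n O|

/-- The variational distance, for the key pair `k` and the messages `ms`, between the joint
distribution of the random oracle with signatures on `ms` made by the signing algorithm, and the
joint distribution of the simulated oracle with simulated signatures on `ms`, the latter
conditioned on no abort and the whole multiplied with the probability of no abort. -/
def signDist (n : ℕ) (k : Bits (S.skLen n) × Bits (S.pkLen n)) {q : ℕ}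
    (ms : Fin q → Bits (S.msgLen n)) : ℝ :=
  let z := (R.start n (R.inst n k.2)).2
  ∑ O : Bits (S.roIn n) → Bits (S.roOut n), ∑ σ : Fin q → Bits (S.sigLen n),
    |(𝔼 Oc : Bits (R.cIn n) → Bits (R.cOut n),
        if (fun r => R.rand n Oc r z) = O ∧ ∀ j, R.sign n Oc (ms j) z = some (σ j)
          then (1 : ℝ) else 0) -
      (𝔼 Oc : Bits (R.cIn n) → Bits (R.cOut n),
        if ∀ j, (R.sign n Oc (ms j) z).isSome then (1 : ℝ) else 0) *
      (𝔼 O₁ ∈ S.oracles n k.2, 𝔼 ρ : Fin q → Bits (S.coinLen n),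
        if O₁ = O ∧ ∀ j, S.sign n O₁ k.1 (ms j) (ρ j) = σ j then (1 : ℝ) else 0)|

/-- `SIGN` either aborts or outputs a valid signature relative to the simulated oracle. Given that
it does not abort, its signatures on (polynomially many, distinct) messages are distributed
negligibly close to correct ones, jointly with the oracle. The probability that no signing query
of an adversary makes it abort is not negligible. -/
def SignOK : Prop :=
  (∀ n, ∀ k ∈ (S.keyGen n).support, ∀ Oc m σ,
    R.sign n Oc m (R.start n (R.inst n k.2)).2 = some σ →
      S.verify n (fun r => R.rand n Oc r (R.start n (R.inst n k.2)).2) k.2 m σ = true) ∧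
  (∀ k : ∀ n, Bits (S.skLen n) × Bits (S.pkLen n), (∀ n, k n ∈ (S.keyGen n).support) →
    ∀ q : ℕ → ℕ, PolyBounded q → ∀ ms : ∀ n, Fin (q n) → Bits (S.msgLen n),
      (∀ n, Function.Injective (ms n)) → Negligible fun n => R.signDist n (k n) (ms n)) ∧
  (∀ A : S.Forger, PolySize A → ¬ Negligible fun n => R.simProb A n fun _ _ _ _ => true)

/-- If the adversary outputs a forgery relative to the simulated oracle, then `FINISH` makes the
challenger of `P` accept with (conditional) probability at least `δ`, which is not negligible. -/
def FinishOK (δ : ℕ → ℝ) : Prop :=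
  ¬ Negligible δ ∧
  ∀ A : S.Forger, PolySize A → ∀ n,
    δ n * R.simProb A n (R.forged n) ≤
      R.simProb A n fun Oc x log y => R.forged n Oc x log y && R.solved n Oc x log y

/-- The reduction is in history-free form and succeeds with probability at least `δ`. -/
def IsHistoryFree (δ : ℕ → ℝ) : Prop :=
  R.IsEfficient ∧ R.InstanceOK ∧ R.RandOK ∧ R.SignOK ∧ R.FinishOK δ

end Reduction

/-! ## Pairs of trapdoor permutations and claws -/

/-- A pair of trapdoor permutations with a common key generator. For every generated public key,
`f₁` and `f₂` are permutations of the same set `dom n pk` of strings, whose elements can be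
recognised efficiently, and sampled uniformly and efficiently from uniform coins. (Nothing is
required about the running time of key generation and of the inversion with the secret key.) -/
structure TrapdoorPair : Type where
  pkLen : ℕ → ℕ
  skLen : ℕ → ℕ
  domLen : ℕ → ℕ
  coinLen : ℕ → ℕ
  keyGen : ∀ n, PMF (Bits (skLen n) × Bits (pkLen n))
  dom : ∀ n, Bits (pkLen n) → Finset (Bits (domLen n))
  sample : ∀ n, Bits (pkLen n) → Bits (coinLen n) → Bits (domLen n)
  f₁ : ∀ n, Bits (pkLen n) → Bits (domLen n) → Bits (domLen n)
  f₂ : ∀ n, Bits (pkLen n) → Bits (domLen n) → Bits (domLen n)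
  inv₁ : ∀ n, Bits (skLen n) → Bits (domLen n) → Bits (domLen n)
  inv₂ : ∀ n, Bits (skLen n) → Bits (domLen n) → Bits (domLen n)
  bijOn₁ : ∀ n, ∀ k ∈ (keyGen n).support, Set.BijOn (f₁ n k.2) (dom n k.2) (dom n k.2)
  bijOn₂ : ∀ n, ∀ k ∈ (keyGen n).support, Set.BijOn (f₂ n k.2) (dom n k.2) (dom n k.2)
  invOn₁ : ∀ n, ∀ k ∈ (keyGen n).support,
    Set.InvOn (inv₁ n k.1) (f₁ n k.2) (dom n k.2) (dom n k.2)
  invOn₂ : ∀ n, ∀ k ∈ (keyGen n).support,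
    Set.InvOn (inv₂ n k.1) (f₂ n k.2) (dom n k.2) (dom n k.2)
  sample_mem : ∀ n, ∀ k ∈ (keyGen n).support, ∀ ρ, sample n k.2 ρ ∈ dom n k.2
  sample_uniform : ∀ n, ∀ k ∈ (keyGen n).support, ∀ x ∈ dom n k.2, ∀ y ∈ dom n k.2,
    (Finset.univ.filter fun ρ => sample n k.2 ρ = x).card =
      (Finset.univ.filter fun ρ => sample n k.2 ρ = y).card
  pkLen_poly : PolyBounded pkLen
  domLen_poly : PolyBounded domLen
  coinLen_poly : PolyBounded coinLen
  f₁_eff : Efficient (fun n => pkLen n + domLen n) domLen fun n w => f₁ n (left w) (right w)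
  f₂_eff : Efficient (fun n => pkLen n + domLen n) domLen fun n w => f₂ n (left w) (right w)
  sample_eff : Efficient (fun n => pkLen n + coinLen n) domLen
    fun n w => sample n (left w) (right w)
  dom_eff : Efficient (fun n => pkLen n + domLen n) (fun _ => 1)
    fun n w => bit (decide (right w ∈ dom n (left w)))

namespace TrapdoorPair

variable (F : TrapdoorPair)

/-- Given a public key, find `(x₁, x₂)` with `f₁ x₁ = f₂ x₂`. -/
def clawProblem : Problem where
  instLen := F.pkLen
  ansLen := fun n => F.domLen n + F.domLen n
  gen := fun n => (F.keyGen n).map Prod.snd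
  accept := fun n pk y => decide
    (left y ∈ F.dom n pk ∧ right y ∈ F.dom n pk ∧ F.f₁ n pk (left y) = F.f₂ n pk (right y))

/-- The pair is claw-free against quantum adversaries. -/
def ClawFree : Prop := F.clawProblem.Hard

/-- The Katz-Wang scheme for messages of `μ n` bits: a signature of `m` is the inverse under `f₁`
of `O (b, m)` for a random bit `b`. -/
def katzWang (μ : ℕ → ℕ) : SigScheme where
  pkLen := F.pkLen
  skLen := F.skLen
  msgLen := μ
  sigLen := F.domLen
  coinLen := fun _ => 1
  roIn := fun n => μ n + 1
  roOut := F.domLen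
  keyGen := F.keyGen
  rng := F.dom
  sign := fun n O sk m ρ => F.inv₁ n sk (O (Fin.cons (ρ 0) m))
  verify := fun n O pk m σ => decide (σ ∈ F.dom n pk ∧
    (F.f₁ n pk σ = O (Fin.cons false m) ∨ F.f₁ n pk σ = O (Fin.cons true m)))
  correct := by
    intro n k hk O hO m ρ
    have hy := hO (Fin.cons (ρ 0) m)
    have h1 := (F.invOn₁ n k hk).2 hy
    have h2 : F.inv₁ n k.1 (O (Fin.cons (ρ 0) m)) ∈ F.dom n k.2 := by
      obtain ⟨x, hx, hxy⟩ := (F.bijOn₁ n k hk).surjOn hy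
      rw [← hxy, (F.invOn₁ n k hk).1 hx]
      exact hx
    refine decide_eq_true ⟨h2, ?_⟩
    cases hb : ρ 0
    · left
      simpa [hb] using h1
    · right
      simpa [hb] using h1

/-- The reduction from forging Katz-Wang signatures to finding claws. The private random oracle
returns for every message coins for two independent domain elements `a`, `a'`, and a bit `b`. The
simulated oracle is `f₁ a` at `(b, m)` and `f₂ a'` at `(1 - b, m)`, the simulated signature of
`m` is `a`, and for a forgery `(m, σ)` the claw candidate is `(σ, a')`. -/
def kwReduction (μ : ℕ → ℕ) : Reduction (F.katzWang μ) F.clawProblem where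
  zLen := F.pkLen
  cIn := μ
  cOut := fun n => F.coinLen n + F.coinLen n + 1
  start := fun _ pk => (pk, pk)
  rand := fun n Oc (r : Bits (μ n + 1)) pk =>
    let w := Oc (Fin.tail r)
    if r 0 = right w 0 then F.f₁ n pk (F.sample n pk (left (left w)))
    else F.f₂ n pk (F.sample n pk (right (left w)))
  sign := fun n Oc m pk => some (F.sample n pk (left (left (Oc m))))
  finish := fun n Oc m σ pk => some (Fin.append σ (F.sample n pk (right (left (Oc m)))))
  inst := fun _ pk => pk

end TrapdoorPair

end QROM

end

/-!
The Katz-Wang reduction programs the random oracle: at each message `m` it knows preimages of both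
values, one under `f₁` at `(b, m)` and one under `f₂` at `(1 - b, m)`. Since `f₁` and `f₂` are
permutations and the sampled elements are uniform, the programmed oracle is exactly uniform and
independent of the bits `b` (`uniformOn_programmed`, `expect_programmed`), and the simulated
signatures are those that the signer makes with the coins `b` (`sample_eq_kwSign`). Hence the
experiment of the reduction is the forgery game in which the coins are drawn once for each message
(`kw_simProb`). The view of the forger does not depend on the coin of the forged message, which can
be redrawn at the end (`expect_gain_resample`), so that with probability at least `1/2` the forged
signature is a preimage of the value that was computed with `f₂`; together with the known preimage
it is a claw (`expect_prob_le_two_mul`). If no message is signed twice, then drawing the coins for each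
query or for each message is the same (`expect_gain_lazy`). All these are facts about
expected payoffs of a quantum algorithm (`QCircuit.gain`) for fixed oracles, and they hold whatever
the algorithm does.

To get an efficient algorithm `B`, the private random oracle is replaced by a pseudorandom function
(`exists_solver_of_prf`). This requires quantum circuits that run the forger and answer its queries
(`exists_simulation`): the Boolean circuits of the reduction are evaluated reversibly, the answer is
copied out and the work wires are uncomputed; the measurement of a signing query is deferred by
copying the message to fresh wires, and coins come from Hadamard gates. With the private oracle as
its oracle, such a circuit is a distinguisher against the pseudorandom function; if the queries to
the private oracle are in turn answered by evaluating the pseudorandom function, it is the solver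
`B`. As circuits are nonuniform, the worst instance can be hardwired into the distinguisher, and the
best key into the solver (`exists_hardwired`).

If the coins are fresh for each query, the forger may see both signatures of a message, and the
reduction above does not apply. Instead, both values at a message are computed with `f₁`, except for
messages that are marked, independently with probability `2 ^ (-t)`, where `2 ^ t` is polynomially
bounded and at least twice the number of queries; for these `f₂` is used. The oracle is still
uniform and independent of the marks. All signatures of messages that are not marked can be made,
and a forgery on a marked message gives a claw. With probability at least `1 / (2 * 2 ^ t)` the
forged message is marked and the signed ones are not (`le_expect_marked`), so the loss is polynomial
(`expect_prob_le_marked`, `kw_secure`).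
-/

noncomputable section

namespace QROM

/-! ### Composition of Boolean circuits -/

/-- Number of wires created by a list of gates. -/
def CGate.created {a : ℕ} (b : ℕ) (gs : List (CGate a)) : ℕ :=
  (gs.map fun g => match g with | .nand _ _ => 1 | .oracle _ => b).sum

section run

variable {a b : ℕ} (O : Bits a → Bits b)

theorem CGate.step_nand (w : List Bool) (i j : ℕ) :
    CGate.step O w (.nand i j) = w ++ [!(w.getD i false && w.getD j false)] := rfl

theorem CGate.step_oracle (w : List Bool) (x : Fin a → ℕ) :
    CGate.step O w (.oracle x) = w ++ List.ofFn (O fun k => w.getD (x k) false) := rfl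

@[simp] theorem CGate.created_nil : CGate.created b ([] : List (CGate a)) = 0 := rfl

@[simp] theorem CGate.created_nand (i j : ℕ) (gs : List (CGate a)) :
    CGate.created b (.nand i j :: gs) = 1 + CGate.created b gs := by simp [CGate.created]

@[simp] theorem CGate.created_oracle (x : Fin a → ℕ) (gs : List (CGate a)) :
    CGate.created b (.oracle x :: gs) = b + CGate.created b gs := by simp [CGate.created]

theorem CGate.created_append (gs hs : List (CGate a)) :
    CGate.created b (gs ++ hs) = CGate.created b gs + CGate.created b hs := by
  simp [CGate.created]

theorem CGate.created_le (gs : List (CGate a)) :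
    CGate.created b gs ≤ gs.length * (b + 1) := by
  induction gs with
  | nil => simp
  | cons g gs ih => cases g <;> simp [add_mul] <;> omega

theorem CGate.foldl_prefix (gs : List (CGate a)) (w : List Bool) :
    ∃ v, gs.foldl (CGate.step O) w = w ++ v ∧ v.length = CGate.created b gs := by
  induction gs generalizing w with
  | nil => exact ⟨[], by simp⟩
  | cons g gs ih =>
    obtain ⟨v, hv, hl⟩ := ih (CGate.step O w g)
    rw [List.foldl_cons, hv]
    cases g with
    | nand i j =>
      exact ⟨_, by rw [CGate.step_nand, List.append_assoc], by simp [hl]; omega⟩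
    | oracle x => exact ⟨_, by rw [CGate.step_oracle, List.append_assoc], by simp [hl]⟩

theorem CGate.length_foldl (gs : List (CGate a)) (w : List Bool) :
    (gs.foldl (CGate.step O) w).length = w.length + CGate.created b gs := by
  obtain ⟨v, hv, hl⟩ := CGate.foldl_prefix O gs w
  simp [hv, hl]

theorem CGate.getD_foldl (gs : List (CGate a)) (w : List Bool) {j : ℕ} (hj : j < w.length) :
    (gs.foldl (CGate.step O) w).getD j false = w.getD j false := by
  obtain ⟨v, hv, hl⟩ := CGate.foldl_prefix O gs w
  rw [hv, List.getD_append _ _ _ _ hj]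

end run

/-- A list of gates written for wires `0, …, m - 1` can be run in a context with `L` wires, where
the wire `j` is found at the position `σ j`. The function `τ` gives the positions of all wires after
the run. Reading the first unused position supplies the value `false` of wires that do not exist. -/
theorem CGate.exists_graft {a b : ℕ} (gs : List (CGate a)) (m L : ℕ) (σ : ℕ → ℕ)
    (hσ : ∀ j < m, σ j < L) :
    ∃ (gs' : List (CGate a)) (τ : ℕ → ℕ), gs'.length = gs.length ∧
      CGate.created b gs' = CGate.created b gs ∧
      (∀ j < m + CGate.created b gs, τ j < L + CGate.created b gs) ∧
      ∀ (O : Bits a → Bits b) (v w : List Bool), v.length = m → w.length = L →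
        (∀ j < m, w.getD (σ j) false = v.getD j false) →
        ∀ j < m + CGate.created b gs,
          (gs'.foldl (CGate.step O) w).getD (τ j) false =
            (gs.foldl (CGate.step O) v).getD j false := by
  induction gs generalizing m L σ with
  | nil => exact ⟨[], σ, rfl, rfl, by simpa using hσ, fun O v w _ _ h j hj => by
      simpa using h j (by simpa using hj)⟩
  | cons g gs ih =>
    set pos : ℕ → ℕ := fun j => if j < m then σ j else L with hpos
    have hread : ∀ v w : List Bool, v.length = m → w.length = L →
        (∀ j < m, w.getD (σ j) false = v.getD j false) →
        ∀ j, w.getD (pos j) false = v.getD j false := by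
      intro v w hv hw h j
      by_cases hj : j < m
      · simpa [hpos, hj] using h j hj
      · rw [List.getD_eq_default v _ (by omega), List.getD_eq_default _ _ (by simp [hpos, hj, hw])]
    have key : ∀ c : ℕ, ∀ j < m + c, (if j < m then σ j else L + (j - m)) < L + c := by
      intro c j hj
      split_ifs with h
      · have := hσ j h; omega
      · omega
    have hext : ∀ v w u : List Bool, v.length = m → w.length = L →
        (∀ j < m, w.getD (σ j) false = v.getD j false) →
        ∀ j < m + u.length, (w ++ u).getD (if j < m then σ j else L + (j - m)) false =
          (v ++ u).getD j false := by
      intro v w u hv hw h j hj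
      split_ifs with hjm
      · rw [List.getD_append _ _ _ _ (by rw [hw]; exact hσ j hjm),
          List.getD_append _ _ _ _ (by omega), h j hjm]
      · rw [List.getD_append_right _ _ _ _ (by omega), List.getD_append_right _ _ _ _ (by omega)]
        congr 1; omega
    cases g with
    | nand i j =>
      obtain ⟨gs', τ, hl, hc, hτ, h⟩ := ih (m + 1) (L + 1) _ (key 1)
      refine ⟨.nand (pos i) (pos j) :: gs', τ, by simp [hl], by simp [hc], ?_, ?_⟩
      · intro k hk
        have := hτ k (by simp at hk; omega)
        simp; omega
      · intro O v w hv hw hvw k hk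
        rw [List.foldl_cons, List.foldl_cons]
        refine h O _ _ (by simp [CGate.step_nand, hv]) (by simp [CGate.step_nand, hw]) ?_ k
          (by simp at hk; omega)
        intro k hk
        rw [CGate.step_nand, CGate.step_nand, hread v w hv hw hvw, hread v w hv hw hvw]
        exact hext v w _ hv hw hvw k (by simpa using hk)
    | oracle x =>
      obtain ⟨gs', τ, hl, hc, hτ, h⟩ := ih (m + b) (L + b) _ (key b)
      refine ⟨.oracle (fun k => pos (x k)) :: gs', τ, by simp [hl], by simp [hc], ?_, ?_⟩
      · intro k hk
        have := hτ k (by simp at hk; omega)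
        simp; omega
      · intro O v w hv hw hvw k hk
        rw [List.foldl_cons, List.foldl_cons]
        refine h O _ _ (by simp [CGate.step_oracle, hv]) (by simp [CGate.step_oracle, hw]) ?_ k
          (by simp at hk; omega)
        intro k hk
        rw [CGate.step_oracle, CGate.step_oracle]
        simp only [hread v w hv hw hvw]
        exact hext v w _ hv hw hvw k (by simpa using hk)

/-- `G` is computed, relative to every oracle, by a circuit with at most `s` gates. -/
def HasCircuit {a b i o : ℕ} (G : (Bits a → Bits b) → Bits i → Bits o) (s : ℕ) : Prop :=
  ∃ C : CCircuit a b i o, C.gates.length ≤ s ∧ ∀ O x, C.eval O x = G O x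

namespace HasCircuit

variable {a b i o m p q : ℕ}

theorem congr {G G' : (Bits a → Bits b) → Bits i → Bits o} {s : ℕ} (h : HasCircuit G s)
    (e : ∀ O x, G' O x = G O x) : HasCircuit G' s := by
  obtain ⟨C, hC, hG⟩ := h
  exact ⟨C, hC, fun O x => by rw [hG, e]⟩

/-- Two more gates create a wire with the value `false`, which can serve as the output wherever an
output refers to a wire that does not exist. -/
theorem normalize {G : (Bits a → Bits b) → Bits i → Bits o} {s : ℕ} (h : HasCircuit G s) :
    ∃ (gs : List (CGate a)) (out : Fin o → ℕ), gs.length ≤ s + 2 ∧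
      (∀ k, out k < i + CGate.created b gs) ∧
      ∀ O x k, (gs.foldl (CGate.step O) (List.ofFn x)).getD (out k) false = G O x k := by
  obtain ⟨C, hC, hG⟩ := h
  set T := i + CGate.created b C.gates with hT
  refine ⟨C.gates ++ [.nand T T, .nand T T], fun k => if C.out k < T then C.out k else T + 1,
    by simpa using hC, ?_, ?_⟩
  · intro k
    simp only [CGate.created_append, CGate.created_nand, CGate.created_nil]
    split_ifs <;> omega
  · intro O x k
    rw [← hG, CCircuit.eval, List.foldl_append]
    set w := C.gates.foldl (CGate.step O) (List.ofFn x) with hw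
    have hl : w.length = T := by rw [hw, CGate.length_foldl]; simp [hT]
    dsimp only
    split_ifs with hk
    · exact CGate.getD_foldl O _ w (by omega)
    · rw [List.getD_eq_default w _ (by omega)]
      simp only [List.foldl_cons, List.foldl_nil, CGate.step_nand]
      rw [List.getD_append_right _ _ _ _ (by simp [hl]), List.getD_append_right w _ _ _ (by omega),
        hl]
      simp [hl]

theorem comp {G : (Bits a → Bits b) → Bits i → Bits m} {H : (Bits a → Bits b) → Bits m → Bits o}
    {s t : ℕ} (hG : HasCircuit G s) (hH : HasCircuit H t) :
    HasCircuit (fun O x => H O (G O x)) (s + t + 4) := by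
  obtain ⟨gs, out, hl, ho, hg⟩ := hG.normalize
  obtain ⟨hs, out', hl', ho', hh⟩ := hH.normalize
  obtain ⟨ks, τ, hkl, hkc, hτ, hk⟩ := CGate.exists_graft (b := b) hs m (i + CGate.created b gs)
    (fun j => if h : j < m then out ⟨j, h⟩ else 0) (fun j hj => by simpa [hj] using ho _)
  refine ⟨⟨gs ++ ks, fun k => τ (out' k)⟩, by simp; omega, fun O x => ?_⟩
  funext k
  rw [CCircuit.eval, List.foldl_append, hk O (List.ofFn (G O x)) _ (by simp)
    (by rw [CGate.length_foldl]; simp) _ _ (ho' k), hh]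
  intro j hj
  simp [hj]
  simpa [List.getD_eq_getElem?_getD] using hg O x ⟨j, hj⟩

theorem pair {G : (Bits a → Bits b) → Bits i → Bits p} {H : (Bits a → Bits b) → Bits i → Bits q}
    {s t : ℕ} (hG : HasCircuit G s) (hH : HasCircuit H t) :
    HasCircuit (fun O x => Fin.append (G O x) (H O x)) (s + t + 4) := by
  obtain ⟨gs, out, hl, ho, hg⟩ := hG.normalize
  obtain ⟨hs, out', hl', ho', hh⟩ := hH.normalize
  obtain ⟨ks, τ, hkl, hkc, hτ, hk⟩ := CGate.exists_graft (b := b) hs i (i + CGate.created b gs)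
    id (fun j hj => by simp; omega)
  refine ⟨⟨gs ++ ks, Fin.append out fun k => τ (out' k)⟩, by simp; omega, fun O x => ?_⟩
  funext k
  rw [CCircuit.eval, List.foldl_append]
  refine Fin.addCases (fun k => ?_) (fun k => ?_) k
  · simp only [Fin.append_left]
    rw [CGate.getD_foldl _ _ _ (by rw [CGate.length_foldl]; simpa using ho k), hg]
  · simp only [Fin.append_right]
    rw [hk O (List.ofFn x) _ (by simp) (by rw [CGate.length_foldl]; simp) _ _ (ho' k), hh]
    intro j hj
    exact CGate.getD_foldl _ _ _ (by simpa using hj)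

theorem rewire (π : Fin o → Fin i) :
    HasCircuit (fun (_ : Bits a → Bits b) (x : Bits i) k => x (π k)) 0 :=
  ⟨⟨[], fun k => π k⟩, le_rfl, fun O x => by funext k; simp [CCircuit.eval]⟩

theorem const_false :
    HasCircuit (fun (_ : Bits a → Bits b) (_ : Bits i) (_ : Fin o) => false) 0 :=
  ⟨⟨[], fun _ => i⟩, le_rfl, fun O x => by funext k; simp [CCircuit.eval]⟩

theorem oracle : HasCircuit (fun (O : Bits a → Bits b) x => O x) 1 := by
  refine ⟨⟨[.oracle fun k => k], fun k => a + k⟩, le_rfl, fun O x => ?_⟩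
  funext k
  simp [CCircuit.eval, CGate.step_oracle]

theorem nands (f g : Fin o → Fin i) :
    HasCircuit (fun (_ : Bits a → Bits b) (x : Bits i) k => !(x (f k) && x (g k))) o := by
  have key : ∀ (O : Bits a → Bits b) (l : List (ℕ × ℕ)) (w : List Bool),
      (∀ e ∈ l, e.1 < w.length ∧ e.2 < w.length) →
      (l.map fun e => CGate.nand e.1 e.2).foldl (CGate.step O) w =
        w ++ l.map fun e => !(w.getD e.1 false && w.getD e.2 false) := by
    intro O l
    induction l with
    | nil => simp
    | cons e l ih =>
      intro w hw
      simp only [List.map_cons, List.foldl_cons]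
      rw [ih, CGate.step_nand, List.append_assoc, List.singleton_append]
      · congr 2
        refine List.map_congr_left fun e' he' => ?_
        have := hw e' (by simp [he'])
        rw [List.getD_append _ _ _ _ this.1, List.getD_append _ _ _ _ this.2]
      · intro e' he'
        have := hw e' (by simp [he'])
        simp [CGate.step_nand]; omega
  refine ⟨⟨(List.ofFn fun k : Fin o => ((f k : ℕ), (g k : ℕ))).map fun e => CGate.nand e.1 e.2,
    fun k => i + k⟩, by simp, fun O x => ?_⟩
  funext k
  rw [CCircuit.eval]
  simp only
  rw [key O _ _ (by simp [List.mem_ofFn])]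
  rw [List.getD_append_right _ _ _ _ (by simp)]
  simp [List.getD_eq_getElem?_getD]

theorem of_noOracle {G : Bits i → Bits o} {s : ℕ}
    (h : HasCircuit (fun (_ : Bits 0 → Bits 0) x => G x) s) :
    HasCircuit (fun (_ : Bits a → Bits b) x => G x) s := by
  obtain ⟨C, hC, hG⟩ := h
  set tr : CGate 0 → Option (CGate a) := fun g => match g with
    | .nand i j => some (.nand i j)
    | .oracle _ => none with htr
  have key : ∀ (O : Bits a → Bits b) (gs : List (CGate 0)) (w : List Bool),
      (gs.filterMap tr).foldl (CGate.step O) w = gs.foldl (CGate.step noOracle) w := by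
    intro O gs
    induction gs with
    | nil => intro w; rfl
    | cons g gs ih =>
      intro w
      cases g with
      | nand i j => simp [htr, CGate.step_nand, ← ih]
      | oracle x =>
        simp only [htr, List.filterMap_cons, List.foldl_cons, CGate.step_oracle, List.ofFn_zero,
          List.append_nil, ← ih]
  refine ⟨⟨C.gates.filterMap tr, C.out⟩, (List.length_filterMap_le _ _).trans hC, fun O x => ?_⟩
  funext k
  rw [CCircuit.eval, key, ← hG noOracle]
  rfl

end HasCircuit

/-! ### Polynomially bounded functions and efficient families -/

namespace PolyBounded

theorem mono {f g : ℕ → ℕ} (hg : PolyBounded g) (h : ∀ n, f n ≤ g n) : PolyBounded f := by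
  obtain ⟨p, hp⟩ := hg
  exact ⟨p, fun n => (h n).trans (hp n)⟩

theorem const (c : ℕ) : PolyBounded fun _ => c := ⟨Polynomial.C c, fun n => by simp⟩

theorem id : PolyBounded fun n => n := ⟨Polynomial.X, fun n => by simp⟩

theorem add {f g : ℕ → ℕ} (hf : PolyBounded f) (hg : PolyBounded g) :
    PolyBounded fun n => f n + g n := by
  obtain ⟨p, hp⟩ := hf
  obtain ⟨q, hq⟩ := hg
  exact ⟨p + q, fun n => by simpa using add_le_add (hp n) (hq n)⟩

theorem mul {f g : ℕ → ℕ} (hf : PolyBounded f) (hg : PolyBounded g) :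
    PolyBounded fun n => f n * g n := by
  obtain ⟨p, hp⟩ := hf
  obtain ⟨q, hq⟩ := hg
  exact ⟨p * q, fun n => by simpa using Nat.mul_le_mul (hp n) (hq n)⟩

end PolyBounded

@[simp] theorem left_append {a b : ℕ} (u : Bits a) (v : Bits b) : left (Fin.append u v) = u := by
  funext k; simp [left]

@[simp] theorem right_append {a b : ℕ} (u : Bits a) (v : Bits b) :
    right (Fin.append u v) = v := by
  funext k; simp [right]

theorem append_left_right {a b : ℕ} (w : Bits (a + b)) : Fin.append (left w) (right w) = w := by
  funext k
  refine Fin.addCases (fun k => ?_) (fun k => ?_) k <;> simp [left, right]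

theorem efficientRel_iff {a b i o : ℕ → ℕ}
    {F : ∀ n, (Bits (a n) → Bits (b n)) → Bits (i n) → Bits (o n)} :
    EfficientRel a b i o F ↔ ∃ s, PolyBounded s ∧ ∀ n, HasCircuit (F n) (s n) := by
  constructor
  · rintro ⟨C, hC, h⟩
    exact ⟨_, hC, fun n => ⟨C n, le_rfl, h n⟩⟩
  · rintro ⟨s, hs, h⟩
    choose C hC h using h
    exact ⟨C, hs.mono hC, h⟩

/-- Conjunction of all bits. -/
theorem HasCircuit.all {a b : ℕ} (i : ℕ) :
    HasCircuit (fun (_ : Bits a → Bits b) (x : Bits i) => bit (decide (∀ k, x k = true)))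
      (20 * i + 5) := by
  induction i with
  | zero =>
    have h := (HasCircuit.const_false (a := a) (b := b) (i := 0) (o := 1)).comp
      (HasCircuit.nands id id)
    exact h.congr fun O x => by funext k; simp [bit]
  | succ i ih =>
    have h1 := (HasCircuit.rewire (a := a) (b := b) (Fin.succ (n := i))).comp ih
    have h2 := (HasCircuit.rewire (a := a) (b := b) fun _ : Fin 1 => (0 : Fin (i + 1))).pair h1
    have h3 := (h2.comp (HasCircuit.nands (fun _ : Fin 1 => 0) fun _ => 1)).comp
      (HasCircuit.nands id id)
    obtain ⟨C, hC, h⟩ := h3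
    refine ⟨C, by omega, fun O x => ?_⟩
    rw [h]
    funext k
    have e1 : (0 : Fin (1 + 1)) = Fin.castAdd 1 0 := rfl
    have e2 : (1 : Fin (1 + 1)) = Fin.natAdd 1 0 := rfl
    rw [e1, e2]
    simp only [Fin.append_left, Fin.append_right, bit, Bool.and_self, Bool.not_not]
    rw [Bool.eq_iff_iff]
    simp [Fin.forall_fin_succ]

namespace EfficientRel

variable {a b i o m p q : ℕ → ℕ}

theorem congr {F F' : ∀ n, (Bits (a n) → Bits (b n)) → Bits (i n) → Bits (o n)}
    (h : EfficientRel a b i o F) (e : ∀ n O x, F' n O x = F n O x) : EfficientRel a b i o F' := by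
  obtain ⟨C, hC, hF⟩ := h
  exact ⟨C, hC, fun n O x => by rw [hF, e]⟩

theorem lift {F : ∀ n, Bits (i n) → Bits (o n)} (h : Efficient i o F) :
    EfficientRel a b i o fun n _ x => F n x := by
  obtain ⟨s, hs, h⟩ := efficientRel_iff.1 h
  exact efficientRel_iff.2 ⟨s, hs, fun n => (h n).of_noOracle⟩

theorem comp {G : ∀ n, (Bits (a n) → Bits (b n)) → Bits (i n) → Bits (m n)}
    {H : ∀ n, (Bits (a n) → Bits (b n)) → Bits (m n) → Bits (o n)}
    (hH : EfficientRel a b m o H) (hG : EfficientRel a b i m G) :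
    EfficientRel a b i o fun n O x => H n O (G n O x) := by
  obtain ⟨s, hs, hG⟩ := efficientRel_iff.1 hG
  obtain ⟨t, ht, hH⟩ := efficientRel_iff.1 hH
  exact efficientRel_iff.2 ⟨_, (hs.add ht).add (.const 4), fun n => (hG n).comp (hH n)⟩

theorem pair {G : ∀ n, (Bits (a n) → Bits (b n)) → Bits (i n) → Bits (p n)}
    {H : ∀ n, (Bits (a n) → Bits (b n)) → Bits (i n) → Bits (q n)}
    (hG : EfficientRel a b i p G) (hH : EfficientRel a b i q H) :
    EfficientRel a b i (fun n => p n + q n) fun n O x => Fin.append (G n O x) (H n O x) := by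
  obtain ⟨s, hs, hG⟩ := efficientRel_iff.1 hG
  obtain ⟨t, ht, hH⟩ := efficientRel_iff.1 hH
  exact efficientRel_iff.2 ⟨_, (hs.add ht).add (.const 4), fun n => (hG n).pair (hH n)⟩

theorem rewire (π : ∀ n, Fin (o n) → Fin (i n)) :
    EfficientRel a b i o fun _ _ x k => x (π _ k) :=
  efficientRel_iff.2 ⟨_, .const 0, fun n => .rewire (π n)⟩

theorem id : EfficientRel a b i i fun _ _ x => x := rewire fun _ k => k

theorem left : EfficientRel a b (fun n => i n + m n) i fun _ _ x => left x :=
  rewire fun n => Fin.castAdd (m n)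

theorem right : EfficientRel a b (fun n => m n + i n) i fun _ _ x => right x :=
  rewire fun n => Fin.natAdd (m n)

theorem query {G : ∀ n, (Bits (a n) → Bits (b n)) → Bits (i n) → Bits (a n)}
    (hG : EfficientRel a b i a G) : EfficientRel a b i b fun n O x => O (G n O x) :=
  comp (H := fun _ O x => O x)
    (efficientRel_iff.2 ⟨_, .const 1, fun _ => HasCircuit.oracle⟩) hG

theorem comp₂ {f : ∀ n, Bits (p n) → Bits (q n) → Bits (o n)}
    {G : ∀ n, (Bits (a n) → Bits (b n)) → Bits (i n) → Bits (p n)}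
    {H : ∀ n, (Bits (a n) → Bits (b n)) → Bits (i n) → Bits (q n)}
    (hf : Efficient (fun n => p n + q n) o fun n w => f n (QROM.left w) (QROM.right w))
    (hG : EfficientRel a b i p G) (hH : EfficientRel a b i q H) :
    EfficientRel a b i o fun n O x => f n (G n O x) (H n O x) :=
  ((lift hf).comp (hG.pair hH)).congr fun n O x => by simp

/-- Bitwise negated conjunction. -/
theorem nand (ho : PolyBounded o) {G H : ∀ n, (Bits (a n) → Bits (b n)) → Bits (i n) → Bits (o n)}
    (hG : EfficientRel a b i o G) (hH : EfficientRel a b i o H) :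
    EfficientRel a b i o fun n O x k => !(G n O x k && H n O x k) := by
  have h : EfficientRel a b (fun n => o n + o n) o fun n _ x k =>
      !(x (Fin.castAdd (o n) k) && x (Fin.natAdd (o n) k)) :=
    efficientRel_iff.2 ⟨_, ho, fun n => .nands _ _⟩
  exact (h.comp (hG.pair hH)).congr fun n O x => by simp only [Fin.append_left, Fin.append_right]

theorem not (ho : PolyBounded o) {G : ∀ n, (Bits (a n) → Bits (b n)) → Bits (i n) → Bits (o n)}
    (hG : EfficientRel a b i o G) : EfficientRel a b i o fun n O x k => !(G n O x k) :=
  (nand ho hG hG).congr fun n O x => by simp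

theorem and (ho : PolyBounded o) {G H : ∀ n, (Bits (a n) → Bits (b n)) → Bits (i n) → Bits (o n)}
    (hG : EfficientRel a b i o G) (hH : EfficientRel a b i o H) :
    EfficientRel a b i o fun n O x k => G n O x k && H n O x k :=
  (not ho (nand ho hG hH)).congr fun n O x => by simp

theorem const_true : EfficientRel a b i (fun _ => 1) fun _ _ _ => bit true :=
  (not (.const 1) (efficientRel_iff.2 ⟨_, .const 0, fun _ => .const_false⟩)).congr
    fun n O x => by funext; simp [bit]

theorem ite (ho : PolyBounded o) {c : ∀ n, (Bits (a n) → Bits (b n)) → Bits (i n) → Bool}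
    {G H : ∀ n, (Bits (a n) → Bits (b n)) → Bits (i n) → Bits (o n)}
    (hc : EfficientRel a b i (fun _ => 1) fun n O x => bit (c n O x))
    (hG : EfficientRel a b i o G) (hH : EfficientRel a b i o H) :
    EfficientRel a b i o fun n O x => if c n O x then G n O x else H n O x := by
  have hd : EfficientRel a b i o fun n O x (_ : Fin (o n)) => c n O x :=
    ((rewire (i := fun _ => 1) fun _ _ => 0).comp hc).congr fun n O x => rfl
  refine (nand ho (nand ho hd hG) (nand ho (not ho hd) hH)).congr fun n O x => ?_
  funext k
  cases h : c n O x <;> simp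

/-- Test of equality. -/
theorem eq (ho : PolyBounded o) {G H : ∀ n, (Bits (a n) → Bits (b n)) → Bits (i n) → Bits (o n)}
    (hG : EfficientRel a b i o G) (hH : EfficientRel a b i o H) :
    EfficientRel a b i (fun _ => 1) fun n O x => bit (decide (G n O x = H n O x)) := by
  have hall : EfficientRel a b o (fun _ => 1) fun n _ x => bit (decide (∀ k, x k = true)) :=
    efficientRel_iff.2 ⟨_, ((PolyBounded.const 20).mul ho).add (.const 5), fun n => .all _⟩
  refine (hall.comp (nand ho (nand ho hG hH) (nand ho (not ho hG) (not ho hH)))).congr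
    fun n O x => ?_
  congr 1
  rw [decide_eq_decide, funext_iff]
  refine forall_congr' fun k => ?_
  dsimp only
  cases G n O x k <;> cases H n O x k <;> simp

theorem optBits_some {G : ∀ n, (Bits (a n) → Bits (b n)) → Bits (i n) → Bits (o n)}
    (hG : EfficientRel a b i o G) :
    EfficientRel a b i (fun n => o n + 1) fun n O x => optBits (some (G n O x)) :=
  ((rewire (i := fun n => 1 + o n) fun n =>
    (Fin.cons (Fin.castAdd _ 0) (Fin.natAdd 1) : Fin (o n + 1) → Fin (1 + o n))).comp
      (const_true.pair hG)).congr fun n O x => by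
    funext k
    refine Fin.cases ?_ (fun k => ?_) k <;> simp [optBits, bit]

end EfficientRel

/-! ### Reversible computation of Boolean circuits -/

section xorAt

variable {N b : ℕ} (y : Fin b ↪ Fin N) (v : Bits b) (s : Bits N)

theorem xorAt_apply (j : Fin b) : xorAt y v s (y j) = xor (s (y j)) (v j) := by
  simp [xorAt]

theorem xorAt_apply_of_ne {q : Fin N} (h : ∀ j, y j ≠ q) : xorAt y v s q = s q := by
  simp [xorAt, h]

theorem xorAt_xorAt : xorAt y v (xorAt y v s) = s := by
  funext q
  simp [xorAt]

theorem xorAt_comp_of_ne {i : ℕ} {x : Fin i → Fin N} (h : ∀ k j, x k ≠ y j) :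
    xorAt y v s ∘ x = s ∘ x := by
  funext k
  exact xorAt_apply_of_ne y v s fun j => (h k j).symm

theorem xorAt_eq_of_forall {t : Bits N} (h1 : ∀ j, t (y j) = xor (s (y j)) (v j))
    (h2 : ∀ q, (∀ j, y j ≠ q) → t q = s q) : t = xorAt y v s := by
  funext q
  by_cases h : ∃ j, y j = q
  · obtain ⟨j, rfl⟩ := h
    rw [h1, xorAt_apply]
  · push Not at h
    rw [h2 q h, xorAt_apply_of_ne y v s h]

end xorAt

/-- The instructions that permute the computational basis. -/
inductive RInstr (N a b : ℕ) : Type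
  | not (q : Fin N)
  | cnot (c t : Fin N) (h : c ≠ t)
  | toffoli (c d t : Fin N) (hcd : c ≠ d) (hc : c ≠ t) (hd : d ≠ t)
  | query (x : Fin a ↪ Fin N) (y : Fin b ↪ Fin N) (h : ∀ i j, x i ≠ y j)

namespace RInstr

variable {N a b : ℕ}

/-- The corresponding instruction of a quantum algorithm. -/
def toQ : RInstr N a b → QInstr N a b 0 0
  | not q => .gate (.not q)
  | cnot c t h => .gate (.cnot c t h)
  | toffoli c d t hcd hc hd => .gate (.toffoli c d t hcd hc hd)
  | query x y h => .query x y h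

/-- The action on basis strings. -/
def act (O : Bits a → Bits b) : RInstr N a b → Bits N → Bits N
  | not q, s => Function.update s q (!(s q))
  | cnot c t _, s => Function.update s t (xor (s t) (s c))
  | toffoli c d t _ _ _, s => Function.update s t (xor (s t) (s c && s d))
  | query x y _, s => xorAt y (O (s ∘ x)) s

theorem act_act (O : Bits a → Bits b) (g : RInstr N a b) (s : Bits N) :
    g.act O (g.act O s) = s := by
  cases g with
  | not q => simp [act]
  | cnot c t h => simp [act, Function.update_of_ne h]
  | toffoli c d t hcd hc hd => simp [act, Function.update_of_ne hc, Function.update_of_ne hd]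
  | query x y h => simp [act, xorAt_comp_of_ne y _ s h, xorAt_xorAt]

/-- The basis string that a list of instructions takes to `t`. -/
def back (O : Bits a → Bits b) (L : List (RInstr N a b)) (t : Bits N) : Bits N :=
  L.foldr (act O) t

/-- The basis string to which a list of instructions takes `t`. -/
def fwd (O : Bits a → Bits b) (L : List (RInstr N a b)) (t : Bits N) : Bits N :=
  L.foldl (fun s g => act O g s) t

variable (O : Bits a → Bits b)

@[simp] theorem back_nil (t : Bits N) : back O [] t = t := rfl
@[simp] theorem fwd_nil (t : Bits N) : fwd O [] t = t := rfl
@[simp] theorem back_cons (g : RInstr N a b) (L) (t : Bits N) :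
    back O (g :: L) t = g.act O (back O L t) := rfl
@[simp] theorem fwd_cons (g : RInstr N a b) (L) (t : Bits N) :
    fwd O (g :: L) t = fwd O L (g.act O t) := rfl
theorem back_append (L K : List (RInstr N a b)) (t : Bits N) :
    back O (L ++ K) t = back O L (back O K t) := by simp [back]
theorem fwd_append (L K : List (RInstr N a b)) (t : Bits N) :
    fwd O (L ++ K) t = fwd O K (fwd O L t) := by simp [fwd]
theorem back_reverse (L : List (RInstr N a b)) (t : Bits N) :
    back O L.reverse t = fwd O L t := by simp [back, fwd]

theorem back_fwd (L : List (RInstr N a b)) (t : Bits N) : back O L (fwd O L t) = t := by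
  induction L generalizing t with
  | nil => rfl
  | cons g L ih => simp [ih, act_act]

theorem fwd_back (L : List (RInstr N a b)) (t : Bits N) : fwd O L (back O L t) = t := by
  induction L generalizing t with
  | nil => rfl
  | cons g L ih => simp [ih, act_act]

theorem weight_append {c : ℕ} (sgn : Bits c → Bits 0 → Option (Bits 0))
    (E : List (Bits 0) → Bits N → Bool) (L : List (RInstr N a b)) (rest : List (QInstr N a b 0 0))
    (log : List (Bits 0)) (ψ : QState N) :
    weight O sgn E (L.map toQ ++ rest) log ψ =
      weight O sgn E rest log fun t => ψ (back O L t) := by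
  induction L generalizing ψ with
  | nil => rfl
  | cons g L ih => cases g <;> exact ih _

/-- Controlled negations that add, for every `k`, the value of the wire `src k` (or nothing) to the
wire `dst k`. -/
theorem exists_copy {m : ℕ} (src : Fin m → Option (Fin N)) (dst : Fin m ↪ Fin N)
    (h : ∀ k q, src k = some q → ∀ j, q ≠ dst j) :
    ∃ R : List (RInstr N a b), R.length ≤ m ∧ ∀ O t,
      back O R t = xorAt dst (fun k => (src k).elim false t) t ∧
      fwd O R t = xorAt dst (fun k => (src k).elim false t) t := by
  suffices hs : ∀ l : List (Fin m), l.Nodup → ∃ R : List (RInstr N a b), R.length ≤ l.length ∧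
      ∀ (O : Bits a → Bits b) (t : Bits N), (∀ k ∈ l, back O R t (dst k) =
        xor (t (dst k)) ((src k).elim false t)) ∧
        ∀ q, (∀ k ∈ l, dst k ≠ q) → back O R t q = t q by
    obtain ⟨R, hR, hb⟩ := hs (List.finRange m) (List.nodup_finRange m)
    have hback : ∀ O t, back O R t = xorAt dst (fun k => (src k).elim false t) t := fun O t =>
      xorAt_eq_of_forall _ _ _ (fun j => (hb O t).1 j (List.mem_finRange j))
        fun q hq => (hb O t).2 q fun k _ => hq k
    refine ⟨R, by simpa using hR, fun O t => ⟨hback O t, ?_⟩⟩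
    have h1 := hback O (fwd O R t)
    rw [back_fwd] at h1
    have h2 : (fun k => (src k).elim false t) = fun k => (src k).elim false (fwd O R t) := by
      funext k
      cases hk : src k with
      | none => rfl
      | some q =>
        simp only [Option.elim_some]
        rw [h1, xorAt_apply_of_ne _ _ _ fun j => (h k q hk j).symm]
        rw [← h1]
    rw [h2]
    nth_rw 3 [h1]
    rw [xorAt_xorAt]
  intro l hl
  induction l with
  | nil => exact ⟨[], by simp, fun O t => by simp⟩
  | cons k l ih =>
    obtain ⟨hk, hl⟩ := List.nodup_cons.1 hl
    obtain ⟨R, hR, hb⟩ := ih hl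
    cases hs : src k with
    | none =>
      refine ⟨R, by simp; omega, fun O t => ⟨fun j hj => ?_, fun q hq =>
        (hb O t).2 q fun j hj => hq j (by simp [hj])⟩⟩
      rcases List.mem_cons.1 hj with rfl | hj
      · rw [(hb O t).2 _ fun j' hj' e => hk (by rw [← dst.injective e]; exact hj'), hs]
        simp
      · exact (hb O t).1 j hj
    | some c =>
      refine ⟨.cnot c (dst k) (h k c hs k) :: R, by simpa using hR,
        fun O t => ⟨fun j hj => ?_, fun q hq => ?_⟩⟩
      · have hc : back O R t c = t c := (hb O t).2 c fun j' _ e => h k c hs j' e.symm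
        rw [back_cons, act]
        rcases List.mem_cons.1 hj with rfl | hj
        · rw [Function.update_self, (hb O t).2 _ fun j' hj' e =>
            hk (by rw [← dst.injective e]; exact hj'), hs, hc]
          rfl
        · have hne : dst j ≠ dst k := fun e => hk (by rw [← dst.injective e]; exact hj)
          rw [Function.update_of_ne hne]
          exact (hb O t).1 j hj
      · rw [back_cons, act, Function.update_of_ne (hq k (by simp)).symm]
        exact (hb O t).2 q fun j hj => hq j (by simp [hj])

end RInstr

/-- The work wires `ws` hold the values `w` of the wires of a Boolean circuit, the scratch wires
`sx` hold zeros. -/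
def Holds {N M a : ℕ} (ws : Fin M ↪ Fin N) (sx : Fin a ↪ Fin N) (t : Bits N) (w : List Bool) :
    Prop :=
  (∀ k : Fin M, t (ws k) = w.getD k false) ∧ ∀ j, t (sx j) = false

/-- The wires outside of the workspace are unchanged. -/
def SameOff {N M a : ℕ} (ws : Fin M ↪ Fin N) (sx : Fin a ↪ Fin N) (t t' : Bits N) : Prop :=
  ∀ q, (∀ k, ws k ≠ q) → (∀ j, sx j ≠ q) → t' q = t q

section compile

variable {N M a b : ℕ} {ws : Fin M ↪ Fin N} {sx : Fin a ↪ Fin N}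

/-- The reversible version of one gate of a Boolean circuit: the wires that the gate creates are
computed on the work wires, which are still zero. -/
theorem exists_reversible_gate (hd : ∀ j k, sx j ≠ ws k) (g : CGate a) (l : ℕ)
    (hl : l + CGate.created b [g] ≤ M) :
    ∃ R : List (RInstr N a b), R.length ≤ 2 * a + 2 ∧ ∀ (O : Bits a → Bits b) t w,
      w.length = l → Holds ws sx t w →
        Holds ws sx (RInstr.fwd O R t) (CGate.step O w g) ∧
        SameOff ws sx t (RInstr.fwd O R t) := by
  cases g with
  | nand i j =>
    have hl' : l < M := by simp at hl; omega
    suffices hs : ∃ R : List (RInstr N a b), R.length ≤ 2 * a + 2 ∧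
        ∀ (O : Bits a → Bits b) t w, w.length = l → Holds ws sx t w →
          RInstr.fwd O R t = Function.update t (ws ⟨l, hl'⟩)
            (!(w.getD i false && w.getD j false)) by
      obtain ⟨R, hR, h⟩ := hs
      refine ⟨R, hR, fun O t w hw ht => ?_⟩
      rw [h O t w hw ht]
      refine ⟨⟨fun k => ?_, fun j => ?_⟩, fun q hq _ => ?_⟩
      · rw [CGate.step_nand]
        by_cases hk : (k : ℕ) = l
        · have hk' : k = ⟨l, hl'⟩ := Fin.ext hk
          rw [hk', Function.update_self, List.getD_append_right _ _ _ _ (by simp [hw])]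
          simp [hw]
        · rw [Function.update_of_ne (fun e => hk (congrArg Fin.val (ws.injective e))), ht.1 k]
          rcases lt_or_gt_of_ne hk with hk | hk
          · rw [List.getD_append _ _ _ _ (by omega)]
          · rw [List.getD_eq_default _ _ (by omega), List.getD_eq_default _ _ (by simp; omega)]
      · rw [Function.update_of_ne (hd _ _)]
        exact ht.2 j
      · exact Function.update_of_ne (hq _).symm _ _
    have hzero : ∀ t w, w.length = l → Holds ws sx t w → t (ws ⟨l, hl'⟩) = false :=
      fun t w hw ht => by rw [ht.1, List.getD_eq_default _ _ (by simp [hw])]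
    by_cases hij : i < l ∧ j < l
    · have hi : ws ⟨i, by omega⟩ ≠ ws ⟨l, hl'⟩ := fun e => by
        have := congrArg Fin.val (ws.injective e); simp at this; omega
      have hj : ws ⟨j, by omega⟩ ≠ ws ⟨l, hl'⟩ := fun e => by
        have := congrArg Fin.val (ws.injective e); simp at this; omega
      by_cases e : i = j
      · refine ⟨[.not (ws ⟨l, hl'⟩), .cnot _ _ hi], by simp, fun O t w hw ht => ?_⟩
        have h1 := ht.1 ⟨i, by omega⟩
        simp only at h1
        subst e
        simp only [RInstr.fwd_cons, RInstr.fwd_nil, RInstr.act, Function.update_self,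
          Function.update_idem, Function.update_of_ne hi, h1, hzero t w hw ht]
        simp
      · have hne : ws ⟨i, by omega⟩ ≠ ws ⟨j, by omega⟩ := fun e' => by
          have := congrArg Fin.val (ws.injective e'); simp at this; omega
        refine ⟨[.not (ws ⟨l, hl'⟩), .toffoli _ _ _ hne hi hj], by simp, fun O t w hw ht => ?_⟩
        have h1 := ht.1 ⟨i, by omega⟩
        have h2 := ht.1 ⟨j, by omega⟩
        simp only at h1 h2
        simp only [RInstr.fwd_cons, RInstr.fwd_nil, RInstr.act, Function.update_self,
          Function.update_idem, Function.update_of_ne hi, Function.update_of_ne hj, h1, h2,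
          hzero t w hw ht]
        simp
    · refine ⟨[.not (ws ⟨l, hl'⟩)], by simp, fun O t w hw ht => ?_⟩
      have : (w.getD i false && w.getD j false) = false := by
        rcases not_and_or.1 hij with h | h
        · rw [List.getD_eq_default _ _ (by omega)]; simp
        · rw [List.getD_eq_default w (n := j) _ (by omega)]; simp
      rw [this]
      simp [RInstr.act, hzero t w hw ht]
  | oracle x =>
    have hl' : l + b ≤ M := by simpa using hl
    -- the arguments are copied to the scratch wires, because a query needs distinct wires
    obtain ⟨R, hR, hc⟩ := RInstr.exists_copy (a := a) (b := b)
      (fun k => if h : x k < l then some (ws ⟨x k, by omega⟩) else none) sx (by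
        intro k q hq j
        split_ifs at hq with h
        · cases hq
          exact (hd _ _).symm)
    let y : Fin b ↪ Fin N := ⟨fun j => ws ⟨l + j, by omega⟩, fun j j' e => by
      have := congrArg Fin.val (ws.injective e); simp at this; exact Fin.ext this⟩
    have hy : ∀ i j, sx i ≠ y j := fun i j => hd _ _
    refine ⟨R ++ [.query sx y hy] ++ R, by simp; omega, fun O t w hw ht => ?_⟩
    set v : Bits a := fun k => w.getD (x k) false with hv
    have hsrc : ∀ s : Bits N, (∀ k : Fin M, (k : ℕ) < l → s (ws k) = t (ws k)) →
        (fun k => (if h : x k < l then some (ws ⟨x k, by omega⟩) else none).elim false s) = v := by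
      intro s hs
      funext k
      split_ifs with h
      · have := hs ⟨x k, by omega⟩ h
        simp only [Option.elim_some, this, ht.1, hv]
      · simp [hv, List.getElem?_eq_none (l := w) (i := x k) (by omega)]
    have e1 : RInstr.fwd O R t = xorAt sx v t := by
      rw [(hc O t).2, hsrc t fun _ _ => rfl]
    have e2 : xorAt sx v t ∘ sx = v := by
      funext k
      simp [xorAt_apply, ht.2]
    have e3 : RInstr.fwd O (R ++ [.query sx y hy] ++ R) t = xorAt y (O v) t := by
      rw [RInstr.fwd_append, RInstr.fwd_append, e1]
      simp only [RInstr.fwd_cons, RInstr.fwd_nil, RInstr.act, e2]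
      rw [(hc O _).2, hsrc]
      · funext q
        by_cases h : ∃ j, sx j = q
        · obtain ⟨j, rfl⟩ := h
          rw [xorAt_apply, xorAt_apply_of_ne y _ _ fun k => (hy _ _).symm, xorAt_apply,
            xorAt_apply_of_ne y _ _ fun k => (hy _ _).symm]
          simp
        · push Not at h
          rw [xorAt_apply_of_ne sx _ _ h]
          simp [xorAt, h]
      · intro k hk
        rw [xorAt_apply_of_ne y, xorAt_apply_of_ne sx _ _ fun j => hd _ _]
        intro j e
        have := congrArg Fin.val (ws.injective e); simp at this; omega
    rw [e3]
    refine ⟨⟨fun k => ?_, fun j => ?_⟩, fun q hq _ => ?_⟩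
    · rw [CGate.step_oracle]
      by_cases hk : ∃ j, y j = ws k
      · obtain ⟨j, hj⟩ := hk
        have hjk : l + (j : ℕ) = k := by
          have := congrArg Fin.val (ws.injective hj); simpa using this
        rw [← hj, xorAt_apply, hj, ht.1, List.getD_eq_default _ _ (by omega), ← hjk,
          List.getD_append_right _ _ _ _ (by omega)]
        simp [hw, hv]
      · push Not at hk
        rw [xorAt_apply_of_ne y _ _ hk, ht.1]
        rcases lt_or_ge (k : ℕ) l with h | h
        · rw [List.getD_append _ _ _ _ (by omega)]
        · rcases lt_or_ge (k : ℕ) (l + b) with h' | h'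
          · exact absurd (congrArg ws (Fin.ext (by simp; omega))) (hk ⟨k - l, by omega⟩)
          · rw [List.getD_eq_default _ _ (by omega), List.getD_eq_default _ _ (by simp; omega)]
    · rw [xorAt_apply_of_ne y _ _ fun k => (hy _ _).symm]
      exact ht.2 j
    · exact xorAt_apply_of_ne y _ _ fun j => hq _

theorem exists_reversible_gates (hd : ∀ j k, sx j ≠ ws k) (gs : List (CGate a)) (l : ℕ)
    (hl : l + CGate.created b gs ≤ M) :
    ∃ R : List (RInstr N a b), R.length ≤ gs.length * (2 * a + 2) ∧ ∀ (O : Bits a → Bits b) t w,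
      w.length = l → Holds ws sx t w →
        Holds ws sx (RInstr.fwd O R t) (gs.foldl (CGate.step O) w) ∧
        SameOff ws sx t (RInstr.fwd O R t) := by
  induction gs generalizing l with
  | nil => exact ⟨[], by simp, fun O t w _ h => ⟨h, fun _ _ _ => rfl⟩⟩
  | cons g gs ih =>
    have hc : CGate.created b (g :: gs) = CGate.created b [g] + CGate.created b gs :=
      CGate.created_append [g] gs
    obtain ⟨R, hR, h⟩ := exists_reversible_gate (b := b) hd g l (by omega)
    obtain ⟨R', hR', h'⟩ := ih (l + CGate.created b [g]) (by omega)
    refine ⟨R ++ R', by simp [add_mul]; omega, fun O t w hw ht => ?_⟩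
    obtain ⟨h1, h2⟩ := h O t w hw ht
    obtain ⟨h3, h4⟩ := h' O _ _ (by
      have := CGate.length_foldl O [g] w
      simpa [hw] using this) h1
    rw [RInstr.fwd_append]
    exact ⟨h3, fun q hq hq' => (h4 q hq hq').trans (h2 q hq hq')⟩

/-- A Boolean circuit is evaluated reversibly: compute all its wires on the work wires, add the
outputs to the wires `y`, and uncompute. -/
theorem exists_reversible_circuit {i o : ℕ} (C : CCircuit a b i o) (hd : ∀ j k, sx j ≠ ws k)
    (hM : i + C.gates.length * (b + 1) ≤ M) (inp : Fin i → Fin N) (y : Fin o ↪ Fin N)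
    (hiw : ∀ j k, inp j ≠ ws k) (hiy : ∀ j k, inp j ≠ y k)
    (hyw : ∀ j k, y j ≠ ws k) (hys : ∀ j k, y j ≠ sx k) :
    ∃ R : List (RInstr N a b), R.length ≤ 2 * (i + C.gates.length * (2 * a + 2)) + o ∧
      ∀ (O : Bits a → Bits b) t, Holds ws sx t [] →
        RInstr.back O R t = xorAt y (C.eval O (t ∘ inp)) t := by
  have hcr := CGate.created_le (b := b) C.gates
  let wi : Fin i ↪ Fin N := ⟨fun k => ws ⟨k, by omega⟩, fun j j' e => by
    have := congrArg Fin.val (ws.injective e); simp at this; exact Fin.ext this⟩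
  obtain ⟨R₀, hR₀, h₀⟩ := RInstr.exists_copy (a := a) (b := b) (fun k => some (inp k)) wi
    (by rintro k q ⟨⟩ j; exact hiw _ _)
  obtain ⟨R₁, hR₁, h₁⟩ := exists_reversible_gates (b := b) hd C.gates i (by omega)
  set T := i + CGate.created b C.gates with hT
  obtain ⟨R₂, hR₂, h₂⟩ := RInstr.exists_copy (a := a) (b := b)
    (fun k => if h : C.out k < T then some (ws ⟨C.out k, by omega⟩) else none) y (by
      intro k q hq j
      split_ifs at hq with h
      · cases hq
        exact (hyw _ _).symm)
  have hcomp : ∀ (O : Bits a → Bits b) t, Holds ws sx t [] →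
      Holds ws sx (RInstr.fwd O (R₀ ++ R₁) t) (C.gates.foldl (CGate.step O) (List.ofFn (t ∘ inp)))
        ∧ SameOff ws sx t (RInstr.fwd O (R₀ ++ R₁) t) := by
    intro O t ht
    rw [RInstr.fwd_append, (h₀ O t).2]
    have hh : Holds ws sx (xorAt wi (fun k => (some (inp k)).elim false t) t)
        (List.ofFn (t ∘ inp)) := by
      refine ⟨fun k => ?_, fun j => ?_⟩
      · by_cases hk : (k : ℕ) < i
        · have : ws k = wi ⟨k, hk⟩ := rfl
          rw [this, xorAt_apply, ← this, ht.1]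
          simp [hk]
        · rw [xorAt_apply_of_ne, ht.1, List.getD_eq_default _ _ (by simp),
            List.getD_eq_default _ _ (by simp; omega)]
          intro j e
          have := congrArg Fin.val (ws.injective e); simp at this; omega
      · rw [xorAt_apply_of_ne wi _ _ fun k => (hd _ _).symm]
        exact ht.2 j
    obtain ⟨h3, h4⟩ := h₁ O _ _ (by simp) hh
    exact ⟨h3, fun q hq hq' => (h4 q hq hq').trans (xorAt_apply_of_ne wi _ _ fun j => hq _)⟩
  refine ⟨R₀ ++ R₁ ++ R₂ ++ (R₀ ++ R₁).reverse, by simp; omega, fun O t ht => ?_⟩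
  rw [RInstr.back_append, RInstr.back_append, RInstr.back_reverse, (h₂ O _).1]
  obtain ⟨h3, h4⟩ := hcomp O t ht
  set t1 := RInstr.fwd O (R₀ ++ R₁) t with ht1
  have hout : (fun k => (if h : C.out k < T then some (ws ⟨C.out k, by omega⟩)
      else none).elim false t1) = C.eval O (t ∘ inp) := by
    funext k
    rw [CCircuit.eval]
    split_ifs with h
    · simp [h3.1]
    · rw [List.getD_eq_default _ _ (by rw [CGate.length_foldl]; simp; omega)]
      rfl
  rw [hout]
  set v := C.eval O (t ∘ inp) with hv
  have ht' : Holds ws sx (xorAt y v t) [] :=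
    ⟨fun k => by rw [xorAt_apply_of_ne y _ _ fun j => hyw _ _]; exact ht.1 k,
      fun k => by rw [xorAt_apply_of_ne y _ _ fun j => hys _ _]; exact ht.2 k⟩
  obtain ⟨h5, h6⟩ := hcomp O _ ht'
  rw [xorAt_comp_of_ne y v t hiy] at h5
  -- adding `v` to the wires `y` commutes with the computation, which does not see them
  have hcommute : RInstr.fwd O (R₀ ++ R₁) (xorAt y v t) = xorAt y v t1 := by
    funext q
    by_cases hw : ∃ k, ws k = q
    · obtain ⟨k, rfl⟩ := hw
      rw [h5.1, xorAt_apply_of_ne y _ _ fun j => hyw _ _, h3.1]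
    by_cases hs : ∃ k, sx k = q
    · obtain ⟨k, rfl⟩ := hs
      rw [h5.2, xorAt_apply_of_ne y _ _ fun j => hys _ _, h3.2]
    push Not at hw hs
    rw [h6 q hw hs, xorAt, xorAt, h4 q hw hs]
  rw [← hcommute, RInstr.back_fwd]

/-- On states whose workspace is zero, the reversible evaluation of a circuit acts like a query to
the function that the circuit computes. -/
theorem exists_weight_circuit {i o : ℕ} (C : CCircuit a b i o) (hd : ∀ j k, sx j ≠ ws k)
    (hM : i + C.gates.length * (b + 1) ≤ M) (inp : Fin i → Fin N) (y : Fin o ↪ Fin N)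
    (hiw : ∀ j k, inp j ≠ ws k) (hiy : ∀ j k, inp j ≠ y k)
    (hyw : ∀ j k, y j ≠ ws k) (hys : ∀ j k, y j ≠ sx k) :
    ∃ L : List (QInstr N a b 0 0), L.length ≤ 2 * (i + C.gates.length * (2 * a + 2)) + o ∧
      ∀ (O : Bits a → Bits b) (E : List (Bits 0) → Bits N → Bool) rest log (ψ : QState N),
        (∀ t, ψ t ≠ 0 → Holds ws sx t []) →
        weight O noSign E (L ++ rest) log ψ =
          weight O noSign E rest log fun t => ψ (xorAt y (C.eval O (t ∘ inp)) t) := by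
  obtain ⟨R, hR, h⟩ := exists_reversible_circuit C hd hM inp y hiw hiy hyw hys
  refine ⟨R.map RInstr.toQ, by simpa using hR, fun O E rest log ψ hψ => ?_⟩
  rw [RInstr.weight_append]
  congr 1
  have hclean : ∀ v t, Holds ws sx (xorAt y v t) [] ↔ Holds ws sx t [] := by
    intro v t
    have h1 : ∀ k, xorAt y v t (ws k) = t (ws k) := fun k =>
      xorAt_apply_of_ne y _ _ fun j => hyw _ _
    have h2 : ∀ k, xorAt y v t (sx k) = t (sx k) := fun k =>
      xorAt_apply_of_ne y _ _ fun j => hys _ _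
    simp [Holds, h1, h2]
  funext t
  by_cases ht : Holds ws sx t []
  · rw [h O t ht]
  · have h1 : ψ (xorAt y (C.eval O (t ∘ inp)) t) = 0 := by
      by_contra hne
      exact ht ((hclean _ _).1 (hψ _ hne))
    rw [h1]
    by_contra hne
    -- a clean string is the preimage of a clean string only
    have hs := hψ _ hne
    set s := RInstr.back O R t with hsdef
    have h2 := h O (xorAt y (C.eval O (s ∘ inp)) s) ((hclean _ _).2 hs)
    rw [xorAt_comp_of_ne y _ s hiy, xorAt_xorAt] at h2
    have h3 := congrArg (RInstr.fwd O R) h2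
    rw [RInstr.fwd_back, hsdef, RInstr.fwd_back] at h3
    exact ht (h3 ▸ (hclean _ _).2 hs)

end compile

/-! ### States of a quantum algorithm with ancillas -/

section slices

variable {N K : ℕ}

/-- The unnormalised state of the first `N` wires when the other wires are measured as `r`. -/
def slice (r : Bits K) (ψ : QState (N + K)) : QState N := fun t => ψ (Fin.append t r)

/-- The gate on the first `N` of `N + K` qubits. -/
def QGate.castAdd (K : ℕ) : QGate N → QGate (N + K)
  | .hadamard q => .hadamard (q.castAdd K)
  | .phase q => .phase (q.castAdd K)
  | .pi8 q => .pi8 (q.castAdd K)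
  | .not q => .not (q.castAdd K)
  | .cnot c t h => .cnot (c.castAdd K) (t.castAdd K) (by simpa using h)
  | .toffoli c d t hcd hc hd => .toffoli (c.castAdd K) (d.castAdd K) (t.castAdd K)
      (by simpa using hcd) (by simpa using hc) (by simpa using hd)

theorem update_append_left (t : Bits N) (r : Bits K) (q : Fin N) (v : Bool) :
    Function.update (Fin.append t r) (q.castAdd K) v = Fin.append (Function.update t q v) r := by
  funext k
  refine Fin.addCases (fun k => ?_) (fun k => ?_) k
  · simp [Function.update_apply]
  · rw [Function.update_of_ne]
    · simp only [Fin.append_right]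
    · simp [Fin.ext_iff]; omega

theorem slice_apply (g : QGate N) (r : Bits K) (ψ : QState (N + K)) :
    slice r ((g.castAdd K).apply ψ) = g.apply (slice r ψ) := by
  funext t
  cases g <;>
    simp [slice, QGate.castAdd, QGate.apply, update_append_left]

theorem QGate.apply_zero (g : QGate N) : g.apply (fun _ => 0) = fun _ => 0 := by
  funext t
  cases g <;> simp [QGate.apply]

theorem QGate.apply_smul (g : QGate N) (x : ℂ) (ψ : QState N) :
    g.apply (fun t => x * ψ t) = fun t => x * g.apply ψ t := by
  funext t
  cases g <;> simp only [QGate.apply] <;> ring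

theorem xorAt_append_left {b : ℕ} (y : Fin b ↪ Fin N) (v : Bits b) (t : Bits N) (r : Bits K) :
    xorAt (y.trans (Fin.castAddEmb K)) v (Fin.append t r) = Fin.append (xorAt y v t) r := by
  symm
  refine xorAt_eq_of_forall _ _ _ (fun j => ?_) fun q => ?_
  · simp [xorAt_apply]
  · refine Fin.addCases (fun k hk => ?_) (fun k _ => ?_) q
    · rw [Fin.append_left, Fin.append_left, xorAt_apply_of_ne]
      intro j e
      exact hk j (by simp [e])
    · simp only [Fin.append_right]

theorem xorAt_append_right {b : ℕ} (y : Fin b ↪ Fin K) (v : Bits b) (t : Bits N) (r : Bits K) :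
    xorAt (y.trans (Fin.natAddEmb N)) v (Fin.append t r) = Fin.append t (xorAt y v r) := by
  symm
  refine xorAt_eq_of_forall _ _ _ (fun j => ?_) fun q => ?_
  · simp [xorAt_apply]
  · refine Fin.addCases (fun k _ => ?_) (fun k hk => ?_) q
    · simp only [Fin.append_left]
    · rw [Fin.append_right, Fin.append_right, xorAt_apply_of_ne]
      intro j e
      exact hk j (by simp [e])

theorem sum_append (f : Bits (N + K) → ℝ) :
    ∑ t, f t = ∑ r : Bits K, ∑ s : Bits N, f (Fin.append s r) := by
  rw [← (Fin.appendEquiv N K).sum_comp, Fintype.sum_prod_type, Finset.sum_comm]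
  rfl

/-- Summation over the strings of `K` bits by the values on the wires `U` and the string that
remains when these wires are reset to zero. -/
theorem sum_reset {u : ℕ} (U : Fin u ↪ Fin K) (F : Bits K → Bits u → ℝ) :
    ∑ r, F (xorAt U (r ∘ U) r) (r ∘ U) =
      ∑ v, ∑ r : Bits K, if r ∘ U = (fun _ => false) then F r v else 0 := by
  have h : ∀ v : Bits u, (∑ r : Bits K, if r ∘ U = (fun _ => false) then F r v else 0) =
      ∑ r : Bits K, if r ∘ U = v then F (xorAt U v r) v else 0 := by
    intro v
    refine Fintype.sum_equiv ⟨xorAt U v, xorAt U v, xorAt_xorAt U v, xorAt_xorAt U v⟩ _ _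
      fun r => ?_
    simp only [Equiv.coe_fn_mk, xorAt_xorAt]
    congr 1
    simp only [funext_iff, Function.comp_apply, xorAt_apply, eq_iff_iff]
    refine forall_congr' fun k => ?_
    cases r (U k) <;> simp
  simp only [h]
  rw [Finset.sum_comm]
  simp

end slices

section weight

variable {N a b μ s c : ℕ} (O : Bits a → Bits b) (sgn : Bits c → Bits μ → Option (Bits s))
  (E : List (Bits μ) → Bits N → Bool)

theorem weight_smul (L : List (QInstr N a b μ s)) (log : List (Bits μ)) (x : ℂ) (ψ : QState N) :
    weight O sgn E L log (fun t => x * ψ t) = ‖x‖ ^ 2 * weight O sgn E L log ψ := by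
  induction L generalizing log ψ with
  | nil =>
    simp only [weight, Finset.mul_sum]
    refine Finset.sum_congr rfl fun t _ => ?_
    split_ifs <;> simp [mul_pow]
  | cons g L ih =>
    cases g with
    | gate g => simp only [weight, QGate.apply_smul, ih]
    | query x y h => simp only [weight, ih]
    | sign y z h =>
      simp only [weight, Finset.mul_sum, Finset.mul_expect]
      refine Finset.sum_congr rfl fun m _ => Finset.expect_congr rfl fun ρ _ => ?_
      cases sgn ρ m with
      | none => simp
      | some σ =>
        simp only [← ih]
        congr 1
        funext t
        split_ifs <;> simp

theorem weight_zero (L : List (QInstr N a b μ s)) (log : List (Bits μ)) :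
    weight O sgn E L log (fun _ => 0) = 0 := by
  simpa using weight_smul O sgn E L log 0 fun _ => 0

/-- Hadamard gates on wires that are zero put these wires into the uniform superposition. -/
theorem weight_hadamards {u : ℕ} (U : Fin u ↪ Fin N) (rest : List (QInstr N a b μ s))
    (log : List (Bits μ)) (ψ : QState N) (hψ : ∀ t, ψ t ≠ 0 → t ∘ U = fun _ => false) :
    weight O sgn E (((List.finRange u).map fun k => .gate (.hadamard (U k))) ++ rest) log ψ =
      weight O sgn E rest log fun t =>
        ((Real.sqrt 2 : ℂ)⁻¹) ^ u * ψ (xorAt U (t ∘ U) t) := by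
  have key : ∀ (l : List (Fin N)), l.Nodup → ∀ ψ : QState N,
      (∀ t, ψ t ≠ 0 → ∀ q ∈ l, t q = false) →
      weight O sgn E ((l.map fun q => .gate (.hadamard q)) ++ rest) log ψ =
        weight O sgn E rest log fun t => ((Real.sqrt 2 : ℂ)⁻¹) ^ l.length *
          ψ fun q => if q ∈ l then false else t q := by
    intro l
    induction l with
    | nil => intro _ ψ _; simp
    | cons q l ih =>
      intro hl ψ hψ
      obtain ⟨hq, hl⟩ := List.nodup_cons.1 hl
      have h1 : ∀ t, (QGate.hadamard q).apply ψ t =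
          (Real.sqrt 2 : ℂ)⁻¹ * ψ (Function.update t q false) := by
        intro t
        have : ψ (Function.update t q true) = 0 := by
          by_contra h
          simpa using hψ _ h q (by simp)
        simp only [QGate.apply, this]
        ring
      rw [List.map_cons, List.cons_append, weight, ih hl]
      · congr 1
        funext t
        rw [h1, List.length_cons, pow_succ, mul_assoc]
        congr 3
        funext p
        by_cases hp : p = q
        · subst hp; simp
        · simp [hp]
      · intro t ht p hp
        rw [h1] at ht
        have hne : p ≠ q := fun e => hq (e ▸ hp)
        have := hψ _ (right_ne_zero_of_mul ht) p (by simp [hp])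
        rwa [Function.update_of_ne hne] at this
  have h := key ((List.finRange u).map U) ((List.nodup_finRange u).map U.injective) ψ
    fun t ht q hq => by
      obtain ⟨k, -, rfl⟩ := List.mem_map.1 hq
      exact congrFun (hψ t ht) k
  rw [List.map_map] at h
  refine h.trans ?_
  congr 1
  funext t
  simp only [List.length_map, List.length_finRange]
  congr 2
  refine xorAt_eq_of_forall _ _ _ (fun j => ?_) fun q hq => ?_
  · simp
  · rw [if_neg]
    simpa using hq

end weight

/-! ### Simulation of a quantum algorithm whose oracles are computed by circuits -/

/-- The ancillas of a simulation: `Z` input wires, `M` work wires, `a` scratch wires, `o` output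
wires, and, for each of `J` instructions, `u` wires for the coins and the message of a signing
query. -/
abbrev Anc (Z M a o J u : ℕ) : Type := Fin Z ⊕ Fin M ⊕ Fin a ⊕ Fin o ⊕ (Fin J × Fin u)

namespace Anc

variable {Z M a o J u : ℕ}

/-- The input wires. -/
def inp : Fin Z ↪ Anc Z M a o J u := .inl

/-- The work wires, on which Boolean circuits are evaluated. -/
def work : Fin M ↪ Anc Z M a o J u := Function.Embedding.inl.trans .inr

/-- The scratch wires, from which the oracle is queried. -/
def scratch : Fin a ↪ Anc Z M a o J u :=
  (Function.Embedding.inl.trans .inr).trans .inr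

/-- The output wires. -/
def out : Fin o ↪ Anc Z M a o J u :=
  ((Function.Embedding.inl.trans .inr).trans .inr).trans .inr

/-- The wires for the coins and the message of the `j`-th instruction. -/
def slot (j : Fin J) : Fin u ↪ Anc Z M a o J u :=
  ⟨fun k => .inr (.inr (.inr (.inr (j, k)))), fun k k' h => by simpa using h⟩

theorem slot_apply (j : Fin J) (k : Fin u) :
    (slot j k : Anc Z M a o J u) = .inr (.inr (.inr (.inr (j, k)))) := rfl

end Anc

section simulation

variable {N K Z M a b o J c μ : ℕ} (e : Anc Z M a o J (c + μ) ↪ Fin K)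

/-- The values of the ancillas between two steps of the simulation: the input wires hold `z`, and
all other wires, except possibly those for the first `j` instructions, are zero. -/
structure Clean (z : Bits Z) (j : ℕ) (r : Bits K) : Prop where
  inp : ∀ k, r (e (Anc.inp k)) = z k
  work : ∀ k, r (e (Anc.work k)) = false
  scratch : ∀ k, r (e (Anc.scratch k)) = false
  out : ∀ k, r (e (Anc.out k)) = false
  slot : ∀ (i : Fin J) k, j ≤ i → r (e (Anc.slot i k)) = false

/-- The state is a superposition of basis strings with clean ancillas. -/
def CleanState (z : Bits Z) (j : ℕ) (ψ : QState (N + K)) : Prop :=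
  ∀ (s : Bits N) (r : Bits K), ψ (Fin.append s r) ≠ 0 → Clean e z j r

variable {e}

theorem Clean.mono {z : Bits Z} {j j' : ℕ} {r : Bits K} (h : Clean e z j r) (hj : j ≤ j') :
    Clean e z j' r :=
  ⟨h.inp, h.work, h.scratch, h.out, fun i k hi => h.slot i k (hj.trans hi)⟩

theorem CleanState.mono {z : Bits Z} {j j' : ℕ} {ψ : QState (N + K)} (h : CleanState e z j ψ)
    (hj : j ≤ j') : CleanState e z j' ψ := fun s r hr => (h s r hr).mono hj

theorem CleanState.slice_eq_zero {z : Bits Z} {j : ℕ} {ψ : QState (N + K)}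
    (h : CleanState e z j ψ) {r : Bits K} (hr : ¬ Clean e z j r) : slice r ψ = fun _ => 0 := by
  funext s
  by_contra hne
  exact hr (h s r hne)

/-- The wires that hold an argument of a simulated oracle, followed by the input of the
simulation. -/
def argWires {p : ℕ} (e : Anc Z M a o J (c + μ) ↪ Fin K) (x : Fin p → Fin (N + K)) :
    Fin (p + Z) → Fin (N + K) :=
  Fin.append x fun k => Fin.natAdd N (e (Anc.inp k))

theorem comp_argWires {p : ℕ} {z : Bits Z} {j : ℕ} (x : Fin p → Fin (N + K)) (s : Bits N)
    {r : Bits K} (h : Clean e z j r) :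
    Fin.append s r ∘ argWires e x = Fin.append (Fin.append s r ∘ x) z := by
  funext k
  refine Fin.addCases (fun k => ?_) (fun k => ?_) k
  · simp [argWires]
  · simp only [Function.comp_apply, argWires, Fin.append_right]
    exact h.inp k

/-- Reversible evaluation of a circuit on an argument and the input of the simulation, with the
result added to the wires `y`. -/
theorem exists_simulated_query {p q : ℕ} (C : CCircuit a b (p + Z) q)
    (hM : p + Z + C.gates.length * (b + 1) ≤ M) (x : Fin p → Fin (N + K)) (y : Fin q ↪ Fin (N + K))
    (hxy : ∀ i j, x i ≠ y j)
    (hxw : ∀ i j, x i ≠ Fin.natAdd N (e (Anc.work j)))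
    (hyi : ∀ i j, y i ≠ Fin.natAdd N (e (Anc.inp j)))
    (hyw : ∀ i j, y i ≠ Fin.natAdd N (e (Anc.work j)))
    (hys : ∀ i j, y i ≠ Fin.natAdd N (e (Anc.scratch j))) :
    ∃ L : List (QInstr (N + K) a b 0 0),
      L.length ≤ 2 * (p + Z + C.gates.length * (2 * a + 2)) + q ∧
      ∀ (O : Bits a → Bits b) (E : List (Bits 0) → Bits (N + K) → Bool) rest log
        (ψ : QState (N + K)) z j, CleanState e z j ψ →
        weight O noSign E (L ++ rest) log ψ = weight O noSign E rest log fun t =>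
          ψ (xorAt y (C.eval O (t ∘ argWires e x)) t) := by
  obtain ⟨L, hL, h⟩ := exists_weight_circuit C
    (ws := (Anc.work.trans e).trans (Fin.natAddEmb N))
    (sx := (Anc.scratch.trans e).trans (Fin.natAddEmb N))
    (fun j k => by simp [Anc.scratch, Anc.work]) hM (argWires e x) y
    (fun j k => by
      refine Fin.addCases (fun j => ?_) (fun j => ?_) j
      · simpa [argWires] using hxw j k
      · simp [argWires, Anc.inp, Anc.work])
    (fun j k => by
      refine Fin.addCases (fun j => ?_) (fun j => ?_) j
      · simpa [argWires] using hxy j k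
      · simpa [argWires] using (hyi k j).symm)
    hyw hys
  refine ⟨L, hL, fun O E rest log ψ z j hψ => h O E rest log ψ fun t ht => ?_⟩
  rw [← append_left_right t] at ht
  have hc := hψ _ _ ht
  refine ⟨fun k => ?_, fun k => ?_⟩
  · exact (hc.work k).trans (by simp)
  · exact hc.scratch k

theorem weight_log_congr {s : ℕ} (O : Bits a → Bits b) (sgn : Bits c → Bits μ → Option (Bits s))
    (E : Bits N → Bool) (L : List (QInstr N a b μ s)) (log log' : List (Bits μ)) (ψ : QState N) :
    weight O sgn (fun _ t => E t) L log ψ = weight O sgn (fun _ t => E t) L log' ψ := by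
  induction L generalizing log log' ψ with
  | nil => rfl
  | cons g L ih =>
    cases g with
    | gate g => exact ih _ _ _
    | query x y h => exact ih _ _ _
    | sign x y h =>
      simp only [weight]
      refine Finset.sum_congr rfl fun m _ => Finset.expect_congr rfl fun ρ _ => ?_
      cases sgn ρ m with
      | none => rfl
      | some σ => exact ih _ _ _

variable {a' b' s : ℕ}

/-- The simulation of one instruction. The gates are applied to the first `N` wires, the answers of
the random oracle and of the signing oracle are computed by the circuits `CR` and `CS`. For a
signing query, fresh wires are brought into the uniform superposition to serve as coins, and the
message is copied to fresh wires, which has the effect of a measurement. -/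
theorem exists_simulated_instr (CR : CCircuit a b (a' + Z) b') (CS : CCircuit a b (c + μ + Z) s)
    (hR : a' + Z + CR.gates.length * (b + 1) ≤ M) (hS : c + μ + Z + CS.gates.length * (b + 1) ≤ M)
    (g : QInstr N a' b' μ s) (j : ℕ) (hj : j < J) :
    ∃ L : List (QInstr (N + K) a b 0 0),
      L.length ≤ 1 + (2 * (a' + Z + CR.gates.length * (2 * a + 2)) + b') +
        (c + μ + (2 * (c + μ + Z + CS.gates.length * (2 * a + 2)) + s)) ∧
      ∀ (O : Bits a → Bits b) (z : Bits Z) (ψ : QState (N + K)), CleanState e z j ψ →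
        ∃ ψ' : QState (N + K), CleanState e z (j + 1) ψ' ∧
          (∀ E rest log, weight O noSign E (L ++ rest) log ψ = weight O noSign E rest log ψ') ∧
          ∀ (E : Bits N → Bool) rest log, ∑ r, weight (fun x => CR.eval O (Fin.append x z))
              (fun (ρ : Bits c) m => some (CS.eval O (Fin.append (Fin.append ρ m) z)))
              (fun _ => E) (g :: rest) log (slice r ψ) =
            ∑ r, weight (fun x => CR.eval O (Fin.append x z))
              (fun (ρ : Bits c) m => some (CS.eval O (Fin.append (Fin.append ρ m) z)))
              (fun _ => E) rest log (slice r ψ') := by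
  cases g with
  | gate g =>
    refine ⟨[.gate (g.castAdd K)], by simp; omega, fun O z ψ hψ => ⟨(g.castAdd K).apply ψ, ?_,
      fun E rest log => rfl, fun E rest log => ?_⟩⟩
    · intro s r hr
      by_contra hc
      have h1 := slice_apply g r ψ
      rw [(hψ.mono (Nat.le_succ j)).slice_eq_zero hc, QGate.apply_zero] at h1
      exact hr (congrFun h1 s)
    · simp only [slice_apply, weight]
  | query x y h =>
    obtain ⟨L, hL, hw⟩ := exists_simulated_query (e := e) CR hR
      (fun i => Fin.castAdd K (x i)) (y.trans (Fin.castAddEmb K))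
      (fun i j => by simpa using h i j) (fun i j => by simp [Fin.ext_iff]; omega)
      (fun i j => by simp [Fin.ext_iff]; omega) (fun i j => by simp [Fin.ext_iff]; omega)
      (fun i j => by simp [Fin.ext_iff]; omega)
    refine ⟨L, by omega, fun O z ψ hψ => ⟨_, ?_, fun E rest log => hw O E rest log ψ z j hψ, ?_⟩⟩
    · intro s r hr
      beta_reduce at hr
      rw [xorAt_append_left] at hr
      exact (hψ _ r hr).mono (Nat.le_succ j)
    · intro E rest log
      refine Finset.sum_congr rfl fun r _ => ?_
      rw [weight]
      congr 1
      funext t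
      simp only [slice, xorAt_append_left]
      by_cases hr : Clean e z j r
      · rw [comp_argWires _ _ hr]
        have hx : (Fin.append t r ∘ fun i => Fin.castAdd K (x i)) = t ∘ x := by funext k; simp
        rw [hx]
      · exact (congrFun (hψ.slice_eq_zero hr) _).trans (congrFun (hψ.slice_eq_zero hr) _).symm
  | sign x y h =>
    -- the wires for the coins and the copy of the message
    let U : Fin (c + μ) ↪ Fin K := (Anc.slot ⟨j, hj⟩).trans e
    let cW : Fin c ↪ Fin K := (Fin.castAddEmb μ).trans U
    let mW : Fin μ ↪ Fin K := (Fin.natAddEmb c).trans U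
    obtain ⟨R, hRl, hRc⟩ := RInstr.exists_copy (N := N + K) (a := a) (b := b)
      (fun k => some (Fin.castAdd K (x k))) (mW.trans (Fin.natAddEmb N))
      (by rintro k q ⟨⟩ j; simp [Fin.ext_iff]; omega)
    obtain ⟨L, hL, hw⟩ := exists_simulated_query (e := e) CS hS
      (Fin.append (fun i => Fin.natAdd N (cW i)) fun i => Fin.castAdd K (x i))
      (y.trans (Fin.castAddEmb K))
      (fun i j => by
        refine Fin.addCases (fun i => ?_) (fun i => ?_) i
        · simp [Fin.ext_iff]; omega
        · simpa using h i j)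
      (fun i j => by
        refine Fin.addCases (fun i => ?_) (fun i => ?_) i
        · simp [cW, U, Anc.slot_apply, Anc.work]
        · simp [Fin.ext_iff]; omega)
      (fun i j => by simp [Fin.ext_iff]; omega) (fun i j => by simp [Fin.ext_iff]; omega)
      (fun i j => by simp [Fin.ext_iff]; omega)
    refine ⟨((List.finRange c).map fun k => .gate (.hadamard (Fin.natAdd N (cW k)))) ++
      (R.map RInstr.toQ ++ L), by simp; omega, fun O z ψ hψ => ?_⟩
    have hUclean : ∀ r, Clean e z j r → ∀ k, r (U k) = false := fun r hr k =>
      hr.slot ⟨j, hj⟩ k le_rfl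
    set w : ℂ := ((Real.sqrt 2 : ℂ)⁻¹) ^ c with hwdef
    have hwnorm : ‖w‖ ^ 2 = ((Fintype.card (Bits c) : ℝ))⁻¹ := by
      rw [hwdef, norm_pow, norm_inv, Complex.norm_real, Real.norm_of_nonneg (Real.sqrt_nonneg _),
        ← pow_mul, mul_comm, pow_mul, inv_pow, Real.sq_sqrt (by norm_num)]
      simp
    set sg : Bits c → Bits μ → Bits s := fun ρ m => CS.eval O (Fin.append (Fin.append ρ m) z)
      with hsg
    -- the state after the Hadamard gates
    let ψ₁ : QState (N + K) := fun t =>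
      w * ψ (xorAt (cW.trans (Fin.natAddEmb N)) (t ∘ cW.trans (Fin.natAddEmb N)) t)
    -- the state after the message has been copied
    let ψ₂ : QState (N + K) := fun t =>
      ψ₁ (xorAt (mW.trans (Fin.natAddEmb N)) (fun k => t (Fin.castAdd K (x k))) t)
    have e₁ : ∀ t r, ψ₁ (Fin.append t r) = w * ψ (Fin.append t (xorAt cW (r ∘ cW) r)) := by
      intro t r
      have hc : Fin.append t r ∘ (cW.trans (Fin.natAddEmb N)) = r ∘ cW := by funext k; simp
      simp only [ψ₁, hc, xorAt_append_right]
    have e₂ : ∀ t r, ψ₂ (Fin.append t r) = w * ψ (Fin.append t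
        (xorAt cW (xorAt mW (t ∘ x) r ∘ cW) (xorAt mW (t ∘ x) r))) := by
      intro t r
      have hx : (fun k => Fin.append t r (Fin.castAdd K (x k))) = t ∘ x := by funext k; simp
      simp only [ψ₂, hx, xorAt_append_right, e₁]
    have hreset : ∀ (v : Bits μ) (r : Bits K),
        (∀ k, xorAt cW (xorAt mW v r ∘ cW) (xorAt mW v r) (U k) = false) → r ∘ mW = v := by
      intro v r hr
      funext k
      have := hr (Fin.natAdd c k)
      rw [xorAt_apply_of_ne cW] at this
      · have h2 : xorAt mW v r (mW k) = false := this
        rw [xorAt_apply] at h2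
        rw [Function.comp_apply]
        revert h2
        cases r (mW k) <;> cases v k <;> simp
      · intro i
        simp [cW, Fin.ext_iff]; omega
    have hreset' : ∀ r : Bits K, xorAt cW (xorAt mW (r ∘ mW) r ∘ cW) (xorAt mW (r ∘ mW) r) =
        xorAt U (r ∘ U) r := by
      intro r
      refine xorAt_eq_of_forall _ _ _ (fun i => ?_) fun q hq => ?_
      · refine Fin.addCases (fun i => ?_) (fun i => ?_) i
        · have : U (Fin.castAdd μ i) = cW i := rfl
          rw [this, xorAt_apply]
          simp [this]
        · have : U (Fin.natAdd c i) = mW i := rfl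
          rw [this, xorAt_apply_of_ne cW, xorAt_apply]
          · simp [this]
          · intro i
            simp [cW, mW, Fin.ext_iff]; omega
      · rw [xorAt_apply_of_ne cW _ _ fun i => hq _, xorAt_apply_of_ne mW _ _ fun i => hq _]
    have hU : ∀ (v : Bits (c + μ)) r, Clean e z j (xorAt U v r) → Clean e z (j + 1) r := by
      intro v r hr
      have hne : ∀ q, (∀ k, U k ≠ q) → xorAt U v r q = r q := fun q => xorAt_apply_of_ne U v r
      refine ⟨fun k => ?_, fun k => ?_, fun k => ?_, fun k => ?_, fun i k hi => ?_⟩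
      · rw [← hr.inp k, hne]; intro k'; simp [U, Anc.slot_apply, Anc.inp]
      · rw [← hr.work k, hne]; intro k'; simp [U, Anc.slot_apply, Anc.work]
      · rw [← hr.scratch k, hne]; intro k'; simp [U, Anc.slot_apply, Anc.scratch]
      · rw [← hr.out k, hne]; intro k'; simp [U, Anc.slot_apply, Anc.out]
      · rw [← hr.slot i k (by omega), hne]
        intro k' e'
        simp only [U, Anc.slot_apply, Function.Embedding.trans_apply, e.injective.eq_iff,
          Sum.inr.injEq, Prod.mk.injEq] at e'
        obtain ⟨rfl, -⟩ := e'
        simp at hi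
    have hclean₂ : CleanState e z (j + 1) ψ₂ := by
      intro t r hr
      rw [e₂] at hr
      have hc := hψ _ _ (right_ne_zero_of_mul hr)
      have hm := hreset _ _ (hUclean _ hc)
      rw [← hm, hreset'] at hc
      exact hU _ _ hc
    refine ⟨fun t => ψ₂ (xorAt (y.trans (Fin.castAddEmb K)) (CS.eval O (t ∘ argWires e
      (Fin.append (fun i => Fin.natAdd N (cW i)) fun i => Fin.castAdd K (x i)))) t), ?_, ?_, ?_⟩
    · intro t r hr
      beta_reduce at hr
      rw [xorAt_append_left] at hr
      exact hclean₂ _ r hr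
    · intro E rest log
      rw [List.append_assoc, List.append_assoc]
      refine (weight_hadamards O noSign E (cW.trans (Fin.natAddEmb N)) _ log ψ ?_).trans ?_
      · intro t ht
        rw [← append_left_right t] at ht ⊢
        funext k
        have := hUclean _ (hψ _ _ ht) (Fin.castAdd μ k)
        exact (Fin.append_right _ _ _).trans this
      · rw [RInstr.weight_append]
        refine Eq.trans ?_ (hw O E rest log ψ₂ z (j + 1) hclean₂)
        congr 1
        funext t
        rw [(hRc O t).1]
        rfl
    · intro E rest log
      -- the branch of a message `m` and coins `ρ`
      let Φ : Bits K → Bits c → Bits μ → QState N := fun r ρ m t =>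
        if t ∘ x = m then slice r ψ (xorAt y (sg ρ m) t) else 0
      have hΦ : ∀ r, slice r (fun t => ψ₂ (xorAt (y.trans (Fin.castAddEmb K)) (CS.eval O (t ∘
          argWires e (Fin.append (fun i => Fin.natAdd N (cW i)) fun i => Fin.castAdd K (x i)))) t)) =
          fun t => w * Φ (xorAt U (r ∘ U) r) (left (r ∘ U)) (right (r ∘ U)) t := by
        intro r
        funext t
        have hl : left (r ∘ U) = r ∘ cW := rfl
        have hr : right (r ∘ U) = r ∘ mW := rfl
        simp only [slice, xorAt_append_left, e₂, Φ, hl, hr]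
        by_cases hc : Clean e z (j + 1) r
        · rw [comp_argWires _ _ hc]
          have harg : Fin.append t r ∘ (Fin.append (fun i => Fin.natAdd N (cW i))
              fun i => Fin.castAdd K (x i)) = Fin.append (r ∘ cW) (t ∘ x) := by
            funext k
            refine Fin.addCases (fun k => ?_) (fun k => ?_) k <;> simp
          rw [harg, xorAt_comp_of_ne y _ t h]
          by_cases hm : t ∘ x = r ∘ mW
          · rw [hm, if_pos rfl, hreset']
          · rw [if_neg hm]
            congr 1
            by_contra hne
            exact hm (hreset _ _ (hUclean _ (hψ _ _ hne))).symm
        · rw [← e₂]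
          have h0 : ∀ t, ψ₂ (Fin.append t r) = 0 := fun t => by
            by_contra hne
            exact hc (hclean₂ _ _ hne)
          rw [h0]
          split_ifs with hm
          · symm
            refine mul_eq_zero_of_right _ ?_
            by_contra hne
            exact hc (hU _ _ (hψ _ _ hne))
          · simp
      simp only [hΦ, weight_smul, hwnorm]
      rw [sum_reset U fun r v => (Fintype.card (Bits c) : ℝ)⁻¹ *
        weight (fun x => CR.eval O (Fin.append x z)) (fun ρ m => some (sg ρ m)) (fun _ => E)
          rest log (Φ r (left v) (right v))]
      simp only [weight, Fintype.expect_eq_sum_div_card]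
      rw [← (Fin.appendEquiv c μ).sum_comp, Fintype.sum_prod_type]
      refine Finset.sum_comm.trans (Eq.trans ?_ Finset.sum_comm)
      refine Finset.sum_congr rfl fun m _ => ?_
      simp only [Finset.sum_div]
      refine Finset.sum_comm.trans ?_
      refine Finset.sum_congr rfl fun ρ _ => Finset.sum_congr rfl fun r _ => ?_
      have h1 : left (Fin.appendEquiv c μ (ρ, m)) = ρ := left_append ρ m
      have h2 : right (Fin.appendEquiv c μ (ρ, m)) = m := right_append ρ m
      rw [h1, h2, div_eq_inv_mul]
      split_ifs with hr
      · congr 1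
        exact weight_log_congr _ _ E rest _ _ _
      · have : slice r ψ = fun _ => 0 := hψ.slice_eq_zero fun hc => hr (funext (hUclean r hc))
        rw [this]
        simp [weight_zero]

theorem exists_simulated_instrs (CR : CCircuit a b (a' + Z) b') (CS : CCircuit a b (c + μ + Z) s)
    (hR : a' + Z + CR.gates.length * (b + 1) ≤ M) (hS : c + μ + Z + CS.gates.length * (b + 1) ≤ M)
    (G : List (QInstr N a' b' μ s)) (j : ℕ) (hj : j + G.length ≤ J) :
    ∃ L : List (QInstr (N + K) a b 0 0),
      L.length ≤ G.length * (1 + (2 * (a' + Z + CR.gates.length * (2 * a + 2)) + b') +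
        (c + μ + (2 * (c + μ + Z + CS.gates.length * (2 * a + 2)) + s))) ∧
      ∀ (O : Bits a → Bits b) (z : Bits Z) (ψ : QState (N + K)), CleanState e z j ψ →
        ∃ ψ' : QState (N + K), CleanState e z J ψ' ∧
          (∀ E rest log, weight O noSign E (L ++ rest) log ψ = weight O noSign E rest log ψ') ∧
          ∀ (E : Bits N → Bool) log, ∑ r, weight (fun x => CR.eval O (Fin.append x z))
              (fun (ρ : Bits c) m => some (CS.eval O (Fin.append (Fin.append ρ m) z)))
              (fun _ => E) G log (slice r ψ) =
            ∑ r, ∑ t, if E t then ‖slice r ψ' t‖ ^ 2 else 0 := by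
  induction G generalizing j with
  | nil =>
    exact ⟨[], by simp, fun O z ψ hψ => ⟨ψ, hψ.mono (by simpa using hj), fun _ _ _ => rfl,
      fun _ _ => rfl⟩⟩
  | cons g G ih =>
    simp only [List.length_cons] at hj
    obtain ⟨L₁, hL₁, h₁⟩ := exists_simulated_instr (e := e) CR CS hR hS g j (by omega)
    obtain ⟨L₂, hL₂, h₂⟩ := ih (j + 1) (by omega)
    refine ⟨L₁ ++ L₂, ?_, fun O z ψ hψ => ?_⟩
    · rw [List.length_append, List.length_cons, add_mul, one_mul]
      omega
    · obtain ⟨ψ₁, hc₁, hw₁, hs₁⟩ := h₁ O z ψ hψ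
      obtain ⟨ψ₂, hc₂, hw₂, hs₂⟩ := h₂ O z ψ₁ hc₁
      exact ⟨ψ₂, hc₂, fun E rest log => by rw [List.append_assoc, hw₁, hw₂],
        fun E log => by rw [hs₁, hs₂]⟩

end simulation

/-- A quantum algorithm `A` with a random oracle and a (randomised) signing oracle can be simulated
with access to an oracle `O` only, if the answers of its oracles are computed from `O` and the input
`z` by the circuits `CR` and `CS`. The output of the simulation is obtained from the output of `A`
with the circuit `CF`. -/
theorem exists_simulation {a b a' b' μ s i o o' c Z : ℕ} (A : QCircuit a' b' μ s i o)
    (inpZ : Fin i → Fin Z) (CR : CCircuit a b (a' + Z) b') (CS : CCircuit a b (c + μ + Z) s)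
    (CF : CCircuit a b (o + Z) o') :
    ∃ D : QCircuit a b 0 0 Z o',
      D.size ≤ A.wires + (Z + (a' + Z + CR.gates.length * (b + 1) +
          (c + μ + Z + CS.gates.length * (b + 1)) + (o + Z + CF.gates.length * (b + 1))) +
          a + o' + A.instrs.length * (c + μ)) +
        (i + A.instrs.length * (1 + (2 * (a' + Z + CR.gates.length * (2 * a + 2)) + b') +
          (c + μ + (2 * (c + μ + Z + CS.gates.length * (2 * a + 2)) + s))) +
          (2 * (o + Z + CF.gates.length * (2 * a + 2)) + o')) ∧
      ∀ (O : Bits a → Bits b) (z : Bits Z) (E : Bits o' → Bool),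
        D.prob O noSign z (fun _ y => E y) =
          A.prob (fun x => CR.eval O (Fin.append x z))
            (fun (ρ : Bits c) m => some (CS.eval O (Fin.append (Fin.append ρ m) z)))
            (z ∘ inpZ) (fun _ y => E (CF.eval O (Fin.append y z))) := by
  set M := a' + Z + CR.gates.length * (b + 1) + (c + μ + Z + CS.gates.length * (b + 1)) +
    (o + Z + CF.gates.length * (b + 1)) with hM
  set J := A.instrs.length with hJ
  set N := A.wires with hN
  set K := Fintype.card (Anc Z M a o' J (c + μ)) with hK
  let e : Anc Z M a o' J (c + μ) ↪ Fin K := (Fintype.equivFin _).toEmbedding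
  have hKcard : K = Z + M + a + o' + J * (c + μ) := by
    rw [hK]; simp; omega
  obtain ⟨R, hRl, hRc⟩ := RInstr.exists_copy (N := N + K) (a := a) (b := b)
    (fun k => some (Fin.natAdd N (e (Anc.inp (inpZ k))))) (A.inp.trans (Fin.castAddEmb K))
    (by rintro k q ⟨⟩ j; simp [Fin.ext_iff]; omega)
  obtain ⟨L, hL, hLw⟩ := exists_simulated_instrs (e := e) CR CS (by omega) (by omega) A.instrs 0
    (by omega)
  let ow : Fin o' ↪ Fin (N + K) := (Anc.out.trans e).trans (Fin.natAddEmb N)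
  obtain ⟨F, hF, hFw⟩ := exists_simulated_query (N := N) (e := e) CF (by omega)
    (fun k => Fin.castAdd K (A.out k)) ow (fun i j => by simp [ow, Fin.ext_iff]; omega)
    (fun i j => by simp [Fin.ext_iff]; omega) (fun i j => by simp [ow, Anc.out, Anc.inp])
    (fun i j => by simp [ow, Anc.out, Anc.work]) (fun i j => by simp [ow, Anc.out, Anc.scratch])
  refine ⟨⟨N + K, R.map RInstr.toQ ++ (L ++ F), (Anc.inp.trans e).trans (Fin.natAddEmb N), ow⟩,
    ?_, fun O z E => ?_⟩
  · rw [← hJ] at hL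
    simp only [QCircuit.size, List.length_append, List.length_map]
    omega
  -- the values of the ancillas at the beginning
  set r₀ : Bits K := xorAt (Anc.inp.trans e) z fun _ => false with hr₀
  have hr₀c : Clean e z 0 r₀ := by
    have hne : ∀ q, (∀ k, (Anc.inp.trans e) k ≠ q) → r₀ q = false := fun q hq =>
      xorAt_apply_of_ne _ _ _ hq
    refine ⟨fun k => ?_, fun k => hne _ ?_, fun k => hne _ ?_, fun k => hne _ ?_,
      fun i k _ => hne _ ?_⟩
    · have := xorAt_apply (Anc.inp.trans e) z (fun _ => false) k
      simpa using this
    · intro k'; simp [Anc.inp, Anc.work]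
    · intro k'; simp [Anc.inp, Anc.scratch]
    · intro k'; simp [Anc.inp, Anc.out]
    · intro k'; simp [Anc.inp, Anc.slot_apply]
  set s₀ : Bits N := xorAt A.inp (z ∘ inpZ) fun _ => false with hs₀
  have hinit : (fun t => (Pi.single (xorAt ((Anc.inp.trans e).trans (Fin.natAddEmb N)) z
      fun _ => false) 1 : QState (N + K)) (RInstr.back O R t)) = Pi.single (Fin.append s₀ r₀) 1 := by
    have h0 : (fun _ => false : Bits (N + K)) = Fin.append (fun _ => false) fun _ => false := by
      funext k
      refine Fin.addCases (fun k => ?_) (fun k => ?_) k <;> simp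
    funext t
    obtain ⟨s, r, rfl⟩ : ∃ s r, t = Fin.append s r := ⟨_, _, (append_left_right t).symm⟩
    rw [(hRc O _).1, h0, xorAt_append_right, xorAt_append_left, ← hr₀, Pi.single_apply,
      Pi.single_apply]
    congr 1
    have hinj : ∀ (u u' : Bits N) (v v' : Bits K), Fin.append u v = Fin.append u' v' ↔
        u = u' ∧ v = v' := fun u u' v v' =>
      ⟨fun h => ⟨by simpa using congrArg left h, by simpa using congrArg right h⟩,
        fun h => by rw [h.1, h.2]⟩
    rw [hinj, hinj, eq_iff_iff]
    refine and_congr_left fun hr => ?_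
    have hv : (fun k => (some (Fin.natAdd N (e (Anc.inp (inpZ k))))).elim false (Fin.append s r)) =
        z ∘ inpZ := by
      funext k
      simp only [Option.elim_some, Function.comp_apply]
      rw [Fin.append_right, hr]
      exact hr₀c.inp _
    rw [hv]
    constructor
    · intro h
      rw [hs₀, ← h, xorAt_xorAt]
    · intro h
      rw [h, hs₀, xorAt_xorAt]
  have hclean : CleanState e z 0 (Pi.single (Fin.append s₀ r₀) 1 : QState (N + K)) := by
    intro s r hsr
    have : Fin.append s r = Fin.append s₀ r₀ := by
      by_contra hne
      exact hsr (Pi.single_eq_of_ne hne _)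
    have hr : r = r₀ := by simpa using congrArg right this
    rwa [hr]
  obtain ⟨ψ', hc', hw', hs'⟩ := hLw O z _ hclean
  simp only [QCircuit.prob]
  rw [RInstr.weight_append, hinit, hw']
  have h1 := hFw O (fun _ t => E (t ∘ ow)) [] [] ψ' z J hc'
  rw [List.append_nil] at h1
  rw [h1]
  have h2 := hs' (fun t => E (CF.eval O (Fin.append (t ∘ A.out) z))) []
  rw [Finset.sum_eq_single r₀] at h2
  · have hsl : slice r₀ (Pi.single (Fin.append s₀ r₀) 1 : QState (N + K)) = Pi.single s₀ 1 := by
      funext t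
      simp only [slice, Pi.single_apply]
      congr 1
      rw [eq_iff_iff]
      exact ⟨fun h => by simpa using congrArg left h, fun h => by rw [h]⟩
    rw [hsl] at h2
    refine Eq.trans ?_ h2.symm
    simp only [weight]
    have hx : ∀ (k : Fin (o + Z)) (j : Fin o'),
        argWires e (fun k => Fin.castAdd K (A.out k)) k ≠ ow j := by
      intro k j
      refine Fin.addCases (fun k => ?_) (fun k => ?_) k
      · simp [argWires, ow, Fin.ext_iff]; omega
      · simp only [argWires, Fin.append_right]
        intro h
        have := e.injective (Fin.natAdd_injective _ _ h)
        simp [Anc.inp, Anc.out] at this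
    set X : Bits (N + K) → Bits (N + K) := fun t =>
      xorAt ow (CF.eval O (t ∘ argWires e fun k => Fin.castAdd K (A.out k))) t with hX
    have hXX : ∀ t, X (X t) = t := fun t => by
      simp only [hX]
      rw [xorAt_comp_of_ne ow _ t hx, xorAt_xorAt]
    rw [← Equiv.sum_comp ⟨X, X, hXX, hXX⟩, sum_append]
    refine Finset.sum_congr rfl fun r _ => Finset.sum_congr rfl fun t _ => ?_
    have hXX' : xorAt ow (CF.eval O (X (Fin.append t r) ∘ argWires e
      fun k => Fin.castAdd K (A.out k))) (X (Fin.append t r)) = Fin.append t r := hXX _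
    simp only [Equiv.coe_fn_mk, hXX', slice]
    by_cases hr : Clean e z J r
    · have hy : X (Fin.append t r) ∘ ow = CF.eval O (Fin.append (t ∘ A.out) z) := by
        have ht : (Fin.append t r ∘ fun k => Fin.castAdd K (A.out k)) = t ∘ A.out := by
          funext k; simp
        simp only [hX]
        rw [comp_argWires _ _ hr, ht]
        funext k
        rw [Function.comp_apply, xorAt_apply]
        have : Fin.append t r (ow k) = false := (Fin.append_right _ _ _).trans (hr.out k)
        rw [this]
        simp
      rw [hy]
    · have : ψ' (Fin.append t r) = 0 := congrFun (hc'.slice_eq_zero hr) t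
      simp [this]
  · intro r _ hr
    have : slice r (Pi.single (Fin.append s₀ r₀) 1 : QState (N + K)) = fun _ => 0 := by
      funext t
      refine Pi.single_eq_of_ne (fun h => hr ?_) _
      simpa using congrArg right h
    rw [this, weight_zero]
  · simp

/-! ### Families of simulations and pseudorandom private oracles -/

/-- Efficiency of the simulation `exists_simulation`, for families of algorithms. -/
theorem exists_simulation_family {a b a' b' μ s i o o' c Z : ℕ → ℕ} (ha : PolyBounded a)
    (hb : PolyBounded b) (ha' : PolyBounded a') (hb' : PolyBounded b') (hμ : PolyBounded μ)
    (hs : PolyBounded s) (hi : PolyBounded i) (ho : PolyBounded o) (ho' : PolyBounded o')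
    (hc : PolyBounded c) (hZ : PolyBounded Z)
    (A : ∀ n, QCircuit (a' n) (b' n) (μ n) (s n) (i n) (o n)) (hA : PolySize A)
    (inpZ : ∀ n, Fin (i n) → Fin (Z n))
    {rand : ∀ n, (Bits (a n) → Bits (b n)) → Bits (a' n) → Bits (Z n) → Bits (b' n)}
    (hrand : EfficientRel a b (fun n => a' n + Z n) b' fun n O w => rand n O (left w) (right w))
    {sign : ∀ n, (Bits (a n) → Bits (b n)) → Bits (c n) → Bits (μ n) → Bits (Z n) → Bits (s n)}
    (hsign : EfficientRel a b (fun n => c n + μ n + Z n) s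
      fun n O w => sign n O (left (left w)) (right (left w)) (right w))
    {fin : ∀ n, (Bits (a n) → Bits (b n)) → Bits (o n) → Bits (Z n) → Bits (o' n)}
    (hfin : EfficientRel a b (fun n => o n + Z n) o' fun n O w => fin n O (left w) (right w)) :
    ∃ D : ∀ n, QCircuit (a n) (b n) 0 0 (Z n) (o' n), PolySize D ∧ ∀ n O z (E : Bits (o' n) → Bool),
      (D n).prob O noSign z (fun _ y => E y) =
        (A n).prob (fun x => rand n O x z) (fun ρ m => some (sign n O ρ m z)) (z ∘ inpZ n)
          fun _ y => E (fin n O y z) := by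
  obtain ⟨CR, hR, hRe⟩ := hrand
  obtain ⟨CS, hS, hSe⟩ := hsign
  obtain ⟨CF, hF, hFe⟩ := hfin
  choose D hD hDe using fun n => exists_simulation (A n) (inpZ n) (CR n) (CS n) (CF n)
  refine ⟨D, ?_, fun n O z E => ?_⟩
  · have hW : PolyBounded fun n => (A n).wires := hA.mono fun n => Nat.le_add_right _ _
    have hI : PolyBounded fun n => (A n).instrs.length := hA.mono fun n => Nat.le_add_left _ _
    have h2 : PolyBounded fun n => 2 * a n + 2 := ((PolyBounded.const 2).mul ha).add (.const 2)
    have hb1 : PolyBounded fun n => b n + 1 := hb.add (.const 1)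
    refine PolyBounded.mono ?_ hD
    refine (hW.add ((((hZ.add ?_).add ha).add ho').add (hI.mul (hc.add hμ)))).add
      ((hi.add (hI.mul ?_)).add (?_))
    · exact (((ha'.add hZ).add (hR.mul hb1)).add (((hc.add hμ).add hZ).add (hS.mul hb1))).add
        ((ho.add hZ).add (hF.mul hb1))
    · exact ((PolyBounded.const 1).add (((PolyBounded.const 2).mul ((ha'.add hZ).add
        (hR.mul h2))).add hb')).add ((hc.add hμ).add (((PolyBounded.const 2).mul
          (((hc.add hμ).add hZ).add (hS.mul h2))).add hs))
    · exact ((PolyBounded.const 2).mul ((ho.add hZ).add (hF.mul h2))).add ho'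
  · rw [hDe]
    congr 1
    · funext x; simp [hRe]
    · funext ρ m; simp [hSe]
    · funext log y; simp [hFe]

/-- Inputs of a quantum algorithm can be fixed by negations at the beginning: the input `x` is added
to the fixed input `k`. -/
theorem exists_hardwired {a b i Z o : ℕ} (D : QCircuit a b 0 0 Z o) (f : Fin i ↪ Fin Z)
    (k : Bits Z) :
    ∃ D' : QCircuit a b 0 0 i o, D'.size ≤ D.size + Z ∧ ∀ O x E,
      D'.prob O noSign x E = D.prob O noSign (xorAt f x k) E := by
  have hnot : ∀ l : List (Fin Z), l.Nodup → ∃ R : List (RInstr D.wires a b),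
      R.length ≤ l.length ∧ ∀ (O : Bits a → Bits b) (t : Bits D.wires) q,
        RInstr.back O R t q = xor (t q) (decide (∃ j ∈ l, D.inp j = q ∧ k j = true)) := by
    intro l hl
    induction l with
    | nil => exact ⟨[], by simp, fun O t q => by simp⟩
    | cons j l ih =>
      obtain ⟨hj, hl⟩ := List.nodup_cons.1 hl
      obtain ⟨R, hR, h⟩ := ih hl
      by_cases hk : k j = true
      · refine ⟨.not (D.inp j) :: R, by simpa using hR, fun O t q => ?_⟩
        rw [RInstr.back_cons, RInstr.act]
        by_cases hq : q = D.inp j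
        · have : ¬ ∃ j' ∈ l, D.inp j' = D.inp j ∧ k j' = true := by
            rintro ⟨j', hj', e, -⟩
            exact hj (D.inp.injective e ▸ hj')
          subst hq
          rw [Function.update_self, h, decide_eq_false this]
          simp [hk]
        · rw [Function.update_of_ne hq, h]
          congr 2
          simp [Ne.symm hq]
      · exact ⟨R, by simp; omega, fun O t q => by rw [h]; simp [hk]⟩
  obtain ⟨R, hR, h⟩ := hnot (List.finRange Z) (List.nodup_finRange Z)
  have hback : ∀ (O : Bits a → Bits b) t, RInstr.back O R t = xorAt D.inp k t := fun O t => by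
    funext q
    rw [h, xorAt]
    simp
  refine ⟨⟨D.wires, R.map RInstr.toQ ++ D.instrs, f.trans D.inp, D.out⟩, ?_, fun O x E => ?_⟩
  · simp only [QCircuit.size, List.length_append, List.length_map]
    simp at hR
    omega
  · simp only [QCircuit.prob]
    rw [RInstr.weight_append]
    congr 1
    have hx : xorAt D.inp k (xorAt (f.trans D.inp) x fun _ => false) =
        xorAt D.inp (xorAt f x k) fun _ => false := by
      refine xorAt_eq_of_forall _ _ _ (fun j => ?_) fun q hq => ?_
      · rw [xorAt_apply]
        simp only [xorAt, Function.Embedding.trans_apply, D.inp.injective.eq_iff]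
        simp [Bool.xor_comm]
      · rw [xorAt_apply_of_ne _ _ _ hq, xorAt_apply_of_ne (f.trans D.inp) _ _ fun j => hq _]
    funext t
    rw [hback, Pi.single_apply, Pi.single_apply, ← hx]
    congr 1
    rw [eq_iff_iff]
    constructor
    · intro e; rw [← e, xorAt_xorAt]
    · intro e; rw [e, xorAt_xorAt]

theorem sum_toReal_pmf {α : Type*} [Fintype α] (p : PMF α) : ∑ x, (p x).toReal = 1 := by
  have h := p.tsum_coe
  rw [tsum_fintype] at h
  rw [← ENNReal.toReal_sum fun x _ => p.apply_ne_top x, h]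
  simp

/-- The private random oracle of a reduction can be replaced by a quantum-accessible pseudorandom
function: the advantage of the reduction is at most that of some efficient solver, up to a
negligible error. The distinguisher has the worst instance built in, and the solver has the best
key of the pseudorandom function built in. -/
theorem exists_solver_of_prf (hprf : QuantumPRFsExist) (P : Problem) (hinst : PolyBounded P.instLen)
    (hans : PolyBounded P.ansLen)
    (hacc : Efficient (fun n => P.instLen n + P.ansLen n) (fun _ => 1)
      fun n w => bit (P.accept n (left w) (right w)))
    {a b a' b' μ s o c : ℕ → ℕ} (ha : PolyBounded a)
    (hb : PolyBounded b) (ha' : PolyBounded a') (hb' : PolyBounded b') (hμ : PolyBounded μ)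
    (hs : PolyBounded s) (ho : PolyBounded o) (hc : PolyBounded c)
    (A : ∀ n, QCircuit (a' n) (b' n) (μ n) (s n) (P.instLen n) (o n)) (hA : PolySize A)
    {rand : ∀ n, (Bits (a n) → Bits (b n)) → Bits (a' n) → Bits (P.instLen n) → Bits (b' n)}
    (hrand : EfficientRel a b (fun n => a' n + P.instLen n) b'
      fun n O w => rand n O (left w) (right w))
    {sign : ∀ n, (Bits (a n) → Bits (b n)) → Bits (c n) → Bits (μ n) → Bits (P.instLen n) →
      Bits (s n)}
    (hsign : EfficientRel a b (fun n => c n + μ n + P.instLen n) s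
      fun n O w => sign n O (left (left w)) (right (left w)) (right w))
    {fin : ∀ n, (Bits (a n) → Bits (b n)) → Bits (o n) → Bits (P.instLen n) → Bits (P.ansLen n)}
    (hfin : EfficientRel a b (fun n => o n + P.instLen n) P.ansLen
      fun n O w => fin n O (left w) (right w)) :
    ∃ B : P.Solver, PolySize B ∧ ∃ ν : ℕ → ℝ, Negligible ν ∧ (∀ n, 0 ≤ ν n) ∧ ∀ n,
      ∑ x, (P.gen n x).toReal * 𝔼 Oc : Bits (a n) → Bits (b n),
        (A n).prob (fun r => rand n Oc r x) (fun ρ m => some (sign n Oc ρ m x)) x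
          (fun _ y => P.accept n x (fin n Oc y x)) ≤ P.adv B n + ν n := by
  obtain ⟨F, hFe, hF⟩ := hprf a b ha hb
  obtain ⟨D, hD, hDe⟩ := exists_simulation_family ha hb ha' hb' hμ hs hinst ho hans hc hinst A hA
    (fun _ => id) hrand hsign hfin
  obtain ⟨D₁, hD₁, hD₁e⟩ := exists_simulation_family (o' := fun _ => 1) ha hb ha' hb' hμ hs hinst ho
    (.const 1) hc hinst A hA (fun _ => id) hrand hsign
    (fin := fun n O y z => bit (P.accept n z (fin n O y z)))
    ((EfficientRel.comp₂ (f := fun n x y => bit (P.accept n x y)) hacc .right hfin).congr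
      fun n O x => rfl)
  set val : ∀ n, Bits (P.instLen n) → (Bits (a n) → Bits (b n)) → ℝ := fun n x Oc =>
    (A n).prob (fun r => rand n Oc r x) (fun ρ m => some (sign n Oc ρ m x)) x
      (fun _ y => P.accept n x (fin n Oc y x)) with hval
  have hDv : ∀ n x O, (D n).prob O noSign x (fun _ y => P.accept n x y) = val n x O :=
    fun n x O => hDe n O x _
  have hD₁v : ∀ n x O, (D₁ n).prob O noSign x (fun _ y => y 0) = val n x O :=
    fun n x O => hD₁e n O x _
  -- the instance on which the pseudorandom function is most distinguishable
  set gap : ∀ n, Bits (P.instLen n) → ℝ := fun n x =>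
    |(𝔼 k : Bits n, val n x (F n k)) - 𝔼 O : Bits (a n) → Bits (b n), val n x O| with hgap
  choose xs hxs using fun n => Finite.exists_max (gap n)
  choose T hT hTe using fun n => exists_hardwired (D₁ n) ⟨Fin.elim0, fun i => i.elim0⟩ (xs n)
  have hTv : ∀ n O, Distinguisher.accProb T n O = val n (xs n) O := fun n O => by
    rw [Distinguisher.accProb, hTe, ← hD₁v]
    congr 1
    funext q
    simp [xorAt]
  have hν : Negligible fun n => gap n (xs n) := by
    have := hF T ((hD₁.add hinst).mono hT)
    simpa only [hTv] using this
  -- the solver, with the key of the pseudorandom function as an additional input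
  obtain ⟨B', hB', hB'e⟩ := exists_simulation_family (c := fun _ => 0) (a := fun _ => 0)
    (b := fun _ => 0) (μ := fun _ => 0) (s := fun _ => 0) (Z := fun n => P.instLen n + n)
    (.const 0) (.const 0) ha hb (.const 0) (.const 0) hinst hans hans (.const 0)
    (hinst.add .id) D hD (fun n => Fin.castAdd n)
    (rand := fun n _ r z => F n (right z) r)
    (EfficientRel.comp₂ (f := F) hFe (.comp .right .right) .left)
    (sign := fun n _ _ _ _ _ => false)
    (efficientRel_iff.2 ⟨_, .const 0, fun _ => .const_false⟩)
    (fin := fun n _ y _ => y) .left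
  set score : ∀ n, Bits n → ℝ := fun n k => ∑ x, (P.gen n x).toReal * val n x (F n k) with hscore
  choose ks hks using fun n => Finite.exists_max (score n)
  choose B hB hBe using fun n => exists_hardwired (B' n) (Fin.castAddEmb n)
    (Fin.append (fun _ => false) (ks n))
  have hBadv : ∀ n, P.adv B n = score n (ks n) := by
    intro n
    refine Finset.sum_congr rfl fun x _ => ?_
    congr 1
    have hz : xorAt (Fin.castAddEmb n) x (Fin.append (fun _ => false) (ks n)) =
        Fin.append x (ks n) := by
      symm
      refine xorAt_eq_of_forall _ _ _ (fun j => by simp) fun q => ?_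
      refine Fin.addCases (fun j hj => (hj j rfl).elim) (fun j _ => ?_) q
      rw [Fin.append_right, Fin.append_right]
    have hx : Fin.append x (ks n) ∘ Fin.castAdd n = x := by funext; simp
    have hsg : (fun (_ _ : Bits 0) => some fun _ => false) = noSign := by
      funext ρ m
      exact congrArg some (Subsingleton.elim _ _)
    rw [hBe, hz, hB'e, ← hDv]
    simp only [right_append, hx, hsg]
  refine ⟨B, (hB'.add (hinst.add .id)).mono hB, _, hν, fun n => abs_nonneg _, fun n => ?_⟩
  rw [hBadv]
  have h1 : 𝔼 k : Bits n, score n k ≤ score n (ks n) :=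
    Finset.expect_le Finset.univ_nonempty fun k _ => hks n k
  have h2 : ∀ x, 𝔼 O : Bits (a n) → Bits (b n), val n x O ≤
      (𝔼 k : Bits n, val n x (F n k)) + gap n (xs n) := fun x => by
    have h3 := hxs n x
    have h4 := neg_abs_le ((𝔼 k : Bits n, val n x (F n k)) -
      𝔼 O : Bits (a n) → Bits (b n), val n x O)
    simp only [hgap] at h3 ⊢
    linarith
  calc ∑ x, (P.gen n x).toReal * 𝔼 O : Bits (a n) → Bits (b n), val n x O
      ≤ ∑ x, (P.gen n x).toReal * ((𝔼 k : Bits n, val n x (F n k)) + gap n (xs n)) :=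
        Finset.sum_le_sum fun x _ => mul_le_mul_of_nonneg_left (h2 x) ENNReal.toReal_nonneg
    _ = (𝔼 k : Bits n, score n k) + gap n (xs n) := by
        simp only [mul_add, Finset.sum_add_distrib, ← Finset.sum_mul, sum_toReal_pmf, one_mul,
          hscore, Finset.expect_sum_comm, Finset.mul_expect]
    _ ≤ _ := by linarith

/-! ### Expected payoffs and changes of the signing oracle -/

section payoff

variable {N a b μ s c : ℕ}

/-- The expectation of the payoff `φ`, a function of the list of signed messages and of the final
measurement; `weight` is the case where the payoff is the indicator function of an event. -/
def payoff (O : Bits a → Bits b) (sgn : Bits c → Bits μ → Option (Bits s))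
    (φ : List (Bits μ) → Bits N → ℝ) :
    List (QInstr N a b μ s) → List (Bits μ) → QState N → ℝ
  | [], log, ψ => ∑ t : Bits N, φ log t * ‖ψ t‖ ^ 2
  | .gate g :: rest, log, ψ => payoff O sgn φ rest log (g.apply ψ)
  | .query x y _ :: rest, log, ψ =>
      payoff O sgn φ rest log (fun t => ψ (xorAt y (O (t ∘ x)) t))
  | .sign x y _ :: rest, log, ψ =>
      ∑ m : Bits μ, 𝔼 ρ : Bits c,
        match sgn ρ m with
        | none => 0
        | some σ => payoff O sgn φ rest (m :: log)
            (fun t => if t ∘ x = m then ψ (xorAt y σ t) else 0)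

variable (O : Bits a → Bits b) (sgn : Bits c → Bits μ → Option (Bits s))

theorem weight_eq_payoff (E : List (Bits μ) → Bits N → Bool) (L : List (QInstr N a b μ s))
    (log : List (Bits μ)) (ψ : QState N) :
    weight O sgn E L log ψ = payoff O sgn (fun l t => if E l t then 1 else 0) L log ψ := by
  induction L generalizing log ψ with
  | nil => simp [weight, payoff]
  | cons g L ih =>
    cases g with
    | gate g => exact ih _ _
    | query x y h => exact ih _ _
    | sign x y h =>
      simp only [weight, payoff]
      refine Finset.sum_congr rfl fun m _ => Finset.expect_congr rfl fun ρ _ => ?_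
      cases sgn ρ m with
      | none => rfl
      | some σ => exact ih _ _

theorem payoff_mono {φ φ' : List (Bits μ) → Bits N → ℝ} (L : List (QInstr N a b μ s))
    (log : List (Bits μ)) (ψ : QState N)
    (h : ∀ l t, l.length ≤ log.length + L.length → φ l t ≤ φ' l t) :
    payoff O sgn φ L log ψ ≤ payoff O sgn φ' L log ψ := by
  induction L generalizing log ψ with
  | nil =>
    exact Finset.sum_le_sum fun t _ => mul_le_mul_of_nonneg_right (h _ _ (by simp)) (by positivity)
  | cons g L ih =>
    have h' : ∀ l t, l.length ≤ log.length + L.length → φ l t ≤ φ' l t := fun l t hl =>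
      h l t (by simp only [List.length_cons]; omega)
    cases g with
    | gate g => exact ih _ _ h'
    | query x y _ => exact ih _ _ h'
    | sign x y _ =>
      simp only [payoff]
      refine Finset.sum_le_sum fun m _ => Finset.expect_le_expect fun ρ _ => ?_
      cases sgn ρ m with
      | none => exact le_rfl
      | some σ =>
        exact ih _ _ fun l t hl => h l t (by simp only [List.length_cons] at hl ⊢; omega)

theorem payoff_sum {ι : Type*} (S : Finset ι) (w : ι → ℝ) (φ : ι → List (Bits μ) → Bits N → ℝ)
    (L : List (QInstr N a b μ s)) (log : List (Bits μ)) (ψ : QState N) :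
    payoff O sgn (fun l t => ∑ i ∈ S, w i * φ i l t) L log ψ =
      ∑ i ∈ S, w i * payoff O sgn (φ i) L log ψ := by
  induction L generalizing log ψ with
  | nil =>
    simp only [payoff, Finset.sum_mul, Finset.mul_sum, mul_assoc]
    exact Finset.sum_comm
  | cons g L ih =>
    cases g with
    | gate g => exact ih _ _
    | query x y h => exact ih _ _
    | sign x y h =>
      simp only [payoff, Finset.mul_sum]
      rw [Finset.sum_comm]
      refine Finset.sum_congr rfl fun m _ => ?_
      simp only [Finset.mul_expect]
      rw [← Finset.expect_sum_comm]
      refine Finset.expect_congr rfl fun ρ _ => ?_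
      cases sgn ρ m with
      | none => simp
      | some σ => exact ih _ _

theorem payoff_eq_zero {φ : List (Bits μ) → Bits N → ℝ} {dead : List (Bits μ) → Prop}
    (hd : ∀ l m, dead l → dead (m :: l)) (hφ : ∀ l t, dead l → φ l t = 0)
    (L : List (QInstr N a b μ s)) (log : List (Bits μ)) (ψ : QState N) (hlog : dead log) :
    payoff O sgn φ L log ψ = 0 := by
  induction L generalizing log ψ with
  | nil => exact Finset.sum_eq_zero fun t _ => by rw [hφ _ _ hlog, zero_mul]
  | cons g L ih =>
    cases g with
    | gate g => exact ih _ _ hlog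
    | query x y h => exact ih _ _ hlog
    | sign x y h =>
      simp only [payoff]
      refine Finset.sum_eq_zero fun m _ => Finset.expect_eq_zero fun ρ _ => ?_
      cases sgn ρ m with
      | none => rfl
      | some σ => exact ih _ _ (hd _ _ hlog)

/-- Two signing oracles are interchangeable if they differ only in runs that have no payoff. -/
theorem payoff_congr {sgn' : Bits c → Bits μ → Option (Bits s)}
    {φ : List (Bits μ) → Bits N → ℝ} {dead : List (Bits μ) → Prop}
    (hd : ∀ l m, dead l → dead (m :: l)) (hφ : ∀ l t, dead l → φ l t = 0)
    (L : List (QInstr N a b μ s)) (log : List (Bits μ)) (ψ : QState N)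
    (h : ∀ l m ρ, log <:+ l → ¬ dead (m :: l) → sgn ρ m = sgn' ρ m) :
    payoff O sgn φ L log ψ = payoff O sgn' φ L log ψ := by
  induction L generalizing log ψ with
  | nil => rfl
  | cons g L ih =>
    cases g with
    | gate g => exact ih _ _ h
    | query x y _ => exact ih _ _ h
    | sign x y _ =>
      simp only [payoff]
      refine Finset.sum_congr rfl fun m _ => Finset.expect_congr rfl fun ρ _ => ?_
      by_cases hm : dead (m :: log)
      · have h0 := fun sg ψ => payoff_eq_zero O (c := c) (s := s) sg hd hφ L (m :: log) ψ hm
        cases sgn ρ m <;> cases sgn' ρ m <;> simp [h0]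
      · rw [← h log m ρ List.suffix_rfl hm]
        cases sgn ρ m with
        | none => rfl
        | some σ => exact ih _ _ fun l m' ρ' hl => h l m' ρ' ((List.suffix_cons _ _).trans hl)

/-- Summation over pairs of strings that differ on the wire `q` only. -/
theorem sum_update_eq (f : Bits N → ℝ) (q : Fin N) :
    ∑ t, f t = ∑ t, if t q then 0 else f t + f (Function.update t q true) := by
  have h1 : ∑ t, (if t q then f t else 0) =
      ∑ t, if t q then 0 else f (Function.update t q true) := by
    rw [← Equiv.sum_comp ⟨fun t => Function.update t q (!(t q)),
      fun t => Function.update t q (!(t q)), fun t => by simp, fun t => by simp⟩]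
    refine Finset.sum_congr rfl fun t _ => ?_
    simp only [Equiv.coe_fn_mk, Function.update_self]
    cases h : t q <;> simp
  have h2 : ∑ t, f t = ∑ t, (if t q then 0 else f t) + ∑ t, if t q then f t else 0 := by
    rw [← Finset.sum_add_distrib]
    refine Finset.sum_congr rfl fun t _ => ?_
    split_ifs <;> simp
  rw [h2, h1, ← Finset.sum_add_distrib]
  refine Finset.sum_congr rfl fun t _ => ?_
  split_ifs <;> simp

/-- Gates preserve the norm. -/
theorem QGate.sum_norm_apply (g : QGate N) (ψ : QState N) :
    ∑ t, ‖g.apply ψ t‖ ^ 2 = ∑ t, ‖ψ t‖ ^ 2 := by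
  cases g with
  | hadamard q =>
    rw [sum_update_eq _ q, sum_update_eq (fun t => ‖ψ t‖ ^ 2) q]
    refine Finset.sum_congr rfl fun t _ => ?_
    cases h : t q
    · have ht : Function.update t q false = t := by rw [← h, Function.update_eq_self]
      simp only [QGate.apply, Function.update_idem, Function.update_self, h, ht]
      generalize ψ t = u
      generalize ψ (Function.update t q true) = v
      have h2 : ‖(Real.sqrt 2 : ℂ)‖ ^ 2 = 2 := by
        rw [Complex.norm_real, Real.norm_of_nonneg (Real.sqrt_nonneg _), Real.sq_sqrt (by norm_num)]
      have hp : ‖u + v‖ ^ 2 + ‖u - v‖ ^ 2 = 2 * (‖u‖ ^ 2 + ‖v‖ ^ 2) := by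
        simp only [Complex.sq_norm, Complex.normSq_apply, Complex.add_re, Complex.add_im,
          Complex.sub_re, Complex.sub_im]
        ring
      simp only [Bool.false_eq_true, if_false, if_true, norm_div, div_pow, h2]
      rw [one_mul, neg_one_mul, ← sub_eq_add_neg, ← add_div, hp, mul_div_cancel_left₀ _ two_ne_zero]
    · simp
  | phase q =>
    refine Finset.sum_congr rfl fun t _ => ?_
    simp only [QGate.apply]
    split_ifs <;> simp
  | pi8 q =>
    refine Finset.sum_congr rfl fun t _ => ?_
    simp only [QGate.apply]
    have : Complex.I * Real.pi / 4 = ((Real.pi / 4 : ℝ) : ℂ) * Complex.I := by push_cast; ring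
    rw [this]
    split_ifs
    · rw [norm_mul, Complex.norm_exp_ofReal_mul_I, one_mul]
    · rw [one_mul]
  | not q =>
    exact Equiv.sum_comp ⟨(RInstr.not (a := 0) (b := 0) q).act noOracle, _,
      RInstr.act_act _ _, RInstr.act_act _ _⟩ fun t => ‖ψ t‖ ^ 2
  | cnot c t h =>
    exact Equiv.sum_comp ⟨(RInstr.cnot (a := 0) (b := 0) c t h).act noOracle, _,
      RInstr.act_act _ _, RInstr.act_act _ _⟩ fun t => ‖ψ t‖ ^ 2
  | toffoli c d t hcd hc hd =>
    exact Equiv.sum_comp ⟨(RInstr.toffoli (a := 0) (b := 0) c d t hcd hc hd).act noOracle, _,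
      RInstr.act_act _ _, RInstr.act_act _ _⟩ fun t => ‖ψ t‖ ^ 2

/-- If the signing oracle never aborts, the probabilities add up to one. -/
theorem payoff_one (sg : Bits c → Bits μ → Bits s) (L : List (QInstr N a b μ s))
    (log : List (Bits μ)) (ψ : QState N) :
    payoff O (fun ρ m => some (sg ρ m)) (fun _ _ => 1) L log ψ = ∑ t, ‖ψ t‖ ^ 2 := by
  induction L generalizing log ψ with
  | nil => simp [payoff]
  | cons g L ih =>
    cases g with
    | gate g => rw [payoff, ih, QGate.sum_norm_apply]
    | query x y h =>
      rw [payoff, ih]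
      exact Equiv.sum_comp ⟨(RInstr.query x y h).act O, _, RInstr.act_act _ _, RInstr.act_act _ _⟩
        fun t => ‖ψ t‖ ^ 2
    | sign x y h =>
      simp only [payoff, ih]
      have key : ∀ m ρ, ∑ t, ‖if t ∘ x = m then ψ (xorAt y (sg ρ m) t) else 0‖ ^ 2 =
          ∑ t, if t ∘ x = m then ‖ψ t‖ ^ 2 else 0 := by
        intro m ρ
        rw [← Equiv.sum_comp ⟨xorAt y (sg ρ m), xorAt y (sg ρ m), xorAt_xorAt _ _, xorAt_xorAt _ _⟩]
        refine Finset.sum_congr rfl fun t _ => ?_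
        simp only [Equiv.coe_fn_mk, xorAt_xorAt, xorAt_comp_of_ne y _ t h]
        split_ifs <;> simp
      simp only [key]
      simp only [Finset.expect_const Finset.univ_nonempty]
      rw [Finset.sum_comm]
      simp

end payoff

section gain

variable {a b μ s i o c : ℕ}

/-- The expected payoff of a quantum algorithm. -/
def QCircuit.gain (C : QCircuit a b μ s i o) (O : Bits a → Bits b)
    (sgn : Bits c → Bits μ → Option (Bits s)) (x : Bits i)
    (φ : List (Bits μ) → Bits o → ℝ) : ℝ :=
  payoff O sgn (fun log t => φ log (t ∘ C.out)) C.instrs []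
    (Pi.single (xorAt C.inp x fun _ => false) 1)

namespace QCircuit

variable (C : QCircuit a b μ s i o) (O : Bits a → Bits b)
  (sgn : Bits c → Bits μ → Option (Bits s)) (x : Bits i)

theorem prob_eq_gain (E : List (Bits μ) → Bits o → Bool) :
    C.prob O sgn x E = C.gain O sgn x fun l y => if E l y then 1 else 0 :=
  weight_eq_payoff _ _ _ _ _ _

theorem gain_mono {φ φ' : List (Bits μ) → Bits o → ℝ}
    (h : ∀ l y, l.length ≤ C.instrs.length → φ l y ≤ φ' l y) :
    C.gain O sgn x φ ≤ C.gain O sgn x φ' :=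
  payoff_mono _ _ _ _ _ fun l t hl => h l _ (by simpa using hl)

theorem gain_sum {ι : Type*} (S : Finset ι) (w : ι → ℝ) (φ : ι → List (Bits μ) → Bits o → ℝ) :
    C.gain O sgn x (fun l y => ∑ i ∈ S, w i * φ i l y) = ∑ i ∈ S, w i * C.gain O sgn x (φ i) :=
  payoff_sum _ _ S w (fun i l t => φ i l (t ∘ C.out)) _ _ _

theorem gain_const_mul (r : ℝ) (φ : List (Bits μ) → Bits o → ℝ) :
    C.gain O sgn x (fun l y => r * φ l y) = r * C.gain O sgn x φ := by
  simpa using C.gain_sum O sgn x {()} (fun _ => r) fun _ => φ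

theorem gain_expect {ι : Type*} [Fintype ι] (φ : ι → List (Bits μ) → Bits o → ℝ) :
    C.gain O sgn x (fun l y => 𝔼 i, φ i l y) = 𝔼 i, C.gain O sgn x (φ i) := by
  have := C.gain_sum O sgn x Finset.univ (fun _ : ι => (Fintype.card ι : ℝ)⁻¹) φ
  simpa only [Fintype.expect_eq_sum_div_card, div_eq_inv_mul, Finset.mul_sum] using this

theorem gain_congr {sgn' : Bits c → Bits μ → Option (Bits s)} {φ : List (Bits μ) → Bits o → ℝ}
    {dead : List (Bits μ) → Prop} (hd : ∀ l m, dead l → dead (m :: l))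
    (hφ : ∀ l y, dead l → φ l y = 0)
    (h : ∀ l m ρ, ¬ dead (m :: l) → sgn ρ m = sgn' ρ m) :
    C.gain O sgn x φ = C.gain O sgn' x φ :=
  payoff_congr _ _ hd (fun l _ => hφ l _) _ _ _ fun l m ρ _ => h l m ρ

theorem prob_true (sg : Bits c → Bits μ → Bits s) :
    C.prob O (fun ρ m => some (sg ρ m)) x (fun _ _ => true) = 1 := by
  rw [prob_eq_gain]
  refine Eq.trans (?_ : _ = payoff O (fun ρ m => some (sg ρ m)) (fun _ _ => 1) C.instrs []
    (Pi.single (xorAt C.inp x fun _ => false) 1)) ?_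
  · simp [gain]
  · rw [payoff_one, Finset.sum_eq_single (xorAt C.inp x fun _ => false)]
    · simp
    · intro t _ ht
      rw [Pi.single_eq_of_ne ht]
      simp
    · simp

end QCircuit

/-- The value at one point of a uniformly random function can be drawn afresh. -/
theorem expect_update {ι X : Type*} [Fintype ι] [DecidableEq ι] [Fintype X] [Nonempty X]
    (m : ι) (H : (ι → X) → ℝ) :
    𝔼 β, H β = 𝔼 β, 𝔼 v : X, H (Function.update β m v) := by
  have h1 : 𝔼 β, 𝔼 v : X, H (Function.update β m v) =
      𝔼 p : (ι → X) × X, H (Function.update p.1 m p.2) := by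
    rw [← Finset.univ_product_univ, Finset.expect_product]
  have h2 : 𝔼 β, H β = 𝔼 p : (ι → X) × X, H p.1 := by
    rw [← Finset.univ_product_univ, Finset.expect_product]
    simp [Finset.expect_const Finset.univ_nonempty]
  rw [h1, h2]
  refine Fintype.expect_equiv ⟨fun p => (Function.update p.1 m p.2, p.1 m),
    fun p => (Function.update p.1 m p.2, p.1 m), fun p => by simp, fun p => by simp⟩ _ _ fun p => ?_
  simp

/-- If the signer uses, for the message `m`, the coins `β m`, then the coins of a message that was
not signed are still uniformly random at the end of the game. -/
theorem expect_gain_resample (C : QCircuit a b μ s i o) (O : Bits a → Bits b) (x : Bits i)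
    {X : Type} [Fintype X] [Nonempty X] (sg : X → Bits μ → Bits s) (msg : Bits o → Bits μ)
    (φ : (Bits μ → X) → List (Bits μ) → Bits o → ℝ) (hφ : ∀ β l y, msg y ∈ l → φ β l y = 0) :
    𝔼 β, C.gain O (fun (_ : Bits 0) m => some (sg (β m) m)) x (φ β) =
      𝔼 β, C.gain O (fun (_ : Bits 0) m => some (sg (β m) m)) x
        fun l y => 𝔼 v, φ (Function.update β (msg y) v) l y := by
  have hsplit : ∀ (sgn : Bits 0 → Bits μ → Option (Bits s)) (χ : List (Bits μ) → Bits o → ℝ),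
      C.gain O sgn x χ = ∑ m, C.gain O sgn x fun l y => if msg y = m then χ l y else 0 := by
    intro sgn χ
    have := C.gain_sum O sgn x Finset.univ (fun _ : Bits μ => 1)
      fun m l y => if msg y = m then χ l y else 0
    simpa using this
  have h1 : ∀ β, C.gain O (fun (_ : Bits 0) m => some (sg (β m) m)) x (φ β) = _ :=
    fun β => hsplit _ _
  have h2 : ∀ β, C.gain O (fun (_ : Bits 0) m => some (sg (β m) m)) x
      (fun l y => 𝔼 v, φ (Function.update β (msg y) v) l y) = _ := fun β => hsplit _ _
  simp only [h1, h2]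
  rw [Finset.expect_sum_comm, Finset.expect_sum_comm]
  refine Finset.sum_congr rfl fun m _ => ?_
  rw [expect_update m]
  refine Finset.expect_congr rfl fun β _ => ?_
  have h3 : (fun l y => if msg y = m then 𝔼 v, φ (Function.update β (msg y) v) l y else 0) =
      fun l y => 𝔼 v, if msg y = m then φ (Function.update β m v) l y else 0 := by
    funext l y
    split_ifs with h
    · rw [h]
    · simp
  rw [h3, C.gain_expect]
  refine Finset.expect_congr rfl fun v _ => ?_
  refine C.gain_congr O _ x (dead := fun l => m ∈ l) (fun l m' h => List.mem_cons_of_mem _ h) ?_ ?_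
  · intro l y hl
    split_ifs with h
    · exact hφ _ _ _ (h ▸ hl)
    · rfl
  · intro l m' ρ hl
    rw [Function.update_of_ne]
    rintro rfl
    exact hl (by simp)

/-- As long as no message is signed twice, it makes no difference whether the coins are drawn for
each query or for each message. -/
theorem expect_gain_lazy (C : QCircuit a b μ s i o) (O : Bits a → Bits b) (x : Bits i)
    (sg : Bits c → Bits μ → Bits s) (φ : List (Bits μ) → Bits o → ℝ)
    (hφ : ∀ l y, ¬ l.Nodup → φ l y = 0) :
    𝔼 β : Bits μ → Bits c, C.gain O (fun (_ : Bits 0) m => some (sg (β m) m)) x φ =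
      C.gain O (fun ρ m => some (sg ρ m)) x φ := by
  have hd : ∀ (l : List (Bits μ)) m, ¬ l.Nodup → ¬ (m :: l).Nodup := fun l m h h' =>
    h (List.nodup_cons.1 h').2
  suffices hs : ∀ (L : List (QInstr C.wires a b μ s)) log ψ,
      𝔼 β : Bits μ → Bits c, payoff O (fun (_ : Bits 0) m => some (sg (β m) m))
        (fun l t => φ l (t ∘ C.out)) L log ψ =
      payoff O (fun ρ m => some (sg ρ m)) (fun l t => φ l (t ∘ C.out)) L log ψ from hs _ _ _
  intro L
  induction L with
  | nil => intro log ψ; simp only [payoff]; exact Finset.expect_const Finset.univ_nonempty _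
  | cons g L ih =>
    intro log ψ
    cases g with
    | gate g => exact ih _ _
    | query x y h => exact ih _ _
    | sign x y h =>
      simp only [payoff]
      rw [Finset.expect_sum_comm]
      refine Finset.sum_congr rfl fun m _ => ?_
      simp only [Finset.expect_const Finset.univ_nonempty]
      rw [expect_update m, Finset.expect_comm]
      refine Finset.expect_congr rfl fun v _ => ?_
      rw [← ih]
      refine Finset.expect_congr rfl fun β _ => ?_
      rw [Function.update_self]
      refine payoff_congr O _ (dead := fun l => ¬ l.Nodup) hd (fun l t => hφ l _) L _ _ ?_
      intro l m' ρ hl hm'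
      rw [Function.update_of_ne]
      rintro rfl
      exact hm' fun hn => (List.nodup_cons.1 hn).1 (hl.subset (by simp))

end gain

/-! ### Programming a random oracle -/

/-- The image under `T` of a uniformly random element is uniformly distributed on `S`. -/
def UniformOn {X Y : Type*} [Fintype X] [DecidableEq Y] (T : X → Y) (S : Finset Y) : Prop :=
  (∀ x, T x ∈ S) ∧ ∀ y ∈ S, (Finset.univ.filter fun x => T x = y).card * S.card = Fintype.card X

namespace UniformOn

variable {X Y Z : Type*} [Fintype X] [DecidableEq Y] [DecidableEq Z] {T : X → Y} {S : Finset Y}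

theorem expect_comp [Nonempty X] (h : UniformOn T S) (Φ : Y → ℝ) :
    𝔼 x, Φ (T x) = 𝔼 y ∈ S, Φ y := by
  have hS : (S.card : ℝ) ≠ 0 := by
    have : S.Nonempty := ⟨_, h.1 (Classical.arbitrary X)⟩
    exact_mod_cast this.card_pos.ne'
  have hX : (Fintype.card X : ℝ) ≠ 0 := by exact_mod_cast Fintype.card_ne_zero
  rw [Fintype.expect_eq_sum_div_card, Finset.expect_eq_sum_div_card,
    ← Finset.sum_fiberwise_of_maps_to (s := Finset.univ) (t := S) fun x _ => h.1 x, Finset.sum_div,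
    Finset.sum_div]
  refine Finset.sum_congr rfl fun y hy => ?_
  have h1 : ∑ x ∈ Finset.univ.filter (fun x => T x = y), Φ (T x) =
      (Finset.univ.filter fun x => T x = y).card * Φ y := by
    rw [Finset.sum_congr rfl fun x hx => by rw [(Finset.mem_filter.1 hx).2], Finset.sum_const,
      nsmul_eq_mul]
  have h2 : ((Finset.univ.filter fun x => T x = y).card : ℝ) * S.card = Fintype.card X := by
    exact_mod_cast h.2 y hy
  rw [h1, ← h2]
  have hc : ((Finset.univ.filter fun x => T x = y).card : ℝ) ≠ 0 := fun h0 => by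
    rw [h0, zero_mul] at h2
    exact hX h2.symm
  field_simp

theorem comp_bijOn {e : Y → Z} {S' : Finset Z} (h : UniformOn T S) (he : Set.BijOn e S S') :
    UniformOn (fun x => e (T x)) S' := by
  refine ⟨fun x => he.mapsTo (h.1 x), fun z hz => ?_⟩
  obtain ⟨y, hy, rfl⟩ := he.surjOn hz
  have hc : S'.card = S.card := by
    have : S.image e = S' := by
      apply Finset.coe_injective
      rw [Finset.coe_image, he.image_eq]
    rw [← this, Finset.card_image_of_injOn he.injOn]
  rw [hc, ← h.2 y hy]
  congr 2
  ext x
  simp only [Finset.mem_filter, Finset.mem_univ, true_and]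
  exact ⟨fun hx => he.injOn (h.1 x) hy hx, fun hx => by rw [hx]⟩

theorem comp_equiv {X' : Type*} [Fintype X'] (h : UniformOn T S) (e : X' ≃ X) :
    UniformOn (fun x => T (e x)) S := by
  refine ⟨fun x => h.1 _, fun y hy => ?_⟩
  rw [Fintype.card_congr e, ← h.2 y hy]
  congr 1
  refine Finset.card_bij (fun x _ => e x) (by simp) (by simp) fun x hx => ⟨e.symm x, ?_⟩
  simpa using hx

/-- Two independent uniform values, computed in a way that depends on a third one. -/
theorem prod {A B G Y' : Type*} [Fintype A] [Fintype B] [Fintype G] [DecidableEq G]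
    [DecidableEq Y'] {U : G → A → Y} {V : G → B → Y'} {S' : Finset Y'}
    (hU : ∀ g, UniformOn (U g) S) (hV : ∀ g, UniformOn (V g) S') :
    UniformOn (fun p : (A × B) × G => ((U p.2 p.1.1, V p.2 p.1.2), p.2))
      ((S ×ˢ S') ×ˢ (Finset.univ : Finset G)) := by
  refine ⟨fun p => by simp [(hU p.2).1, (hV p.2).1], ?_⟩
  rintro ⟨⟨y, y'⟩, g⟩ hy
  simp only [Finset.mem_product, Finset.mem_univ, and_true] at hy
  have : (Finset.univ.filter fun p : (A × B) × G =>
      ((U p.2 p.1.1, V p.2 p.1.2), p.2) = ((y, y'), g)) =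
      ((Finset.univ.filter fun x => U g x = y) ×ˢ (Finset.univ.filter fun x => V g x = y')) ×ˢ
        {g} := by
    ext ⟨⟨p, q⟩, r⟩
    simp only [Finset.mem_filter, Finset.mem_univ, true_and, Prod.mk.injEq, Finset.mem_product,
      Finset.mem_singleton]
    constructor
    · rintro ⟨⟨h1, h2⟩, rfl⟩; exact ⟨⟨h1, h2⟩, rfl⟩
    · rintro ⟨⟨h1, h2⟩, rfl⟩; exact ⟨⟨h1, h2⟩, rfl⟩
  rw [this]
  simp only [Finset.card_product, Finset.card_singleton, Fintype.card_prod, Finset.card_univ]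
  rw [← (hU g).2 y hy.1, ← (hV g).2 y' hy.2]
  ring

/-- Uniformly random functions. -/
theorem pi {I : Type*} [Fintype I] [DecidableEq I] (h : UniformOn T S) :
    UniformOn (fun (f : I → X) i => T (f i)) (Fintype.piFinset fun _ => S) := by
  classical
  refine ⟨fun f => Fintype.mem_piFinset.2 fun i => h.1 _, fun g hg => ?_⟩
  rw [Fintype.mem_piFinset] at hg
  have : (Finset.univ.filter fun f : I → X => (fun i => T (f i)) = g) =
      Fintype.piFinset fun i => Finset.univ.filter fun x => T x = g i := by
    ext f
    simp [funext_iff]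
  rw [this, Fintype.card_piFinset, Fintype.card_piFinset, ← Finset.prod_mul_distrib,
    Finset.prod_congr rfl fun i _ => h.2 _ (hg i)]
  simp

end UniformOn

/-- The parts of a string that consists of the coins of two samples and of `t` further bits. -/
def splitCoins (l t : ℕ) : Bits (l + l + t) ≃ (Bits l × Bits l) × Bits t where
  toFun w := ((left (left w), right (left w)), right w)
  invFun p := Fin.append (Fin.append p.1.1 p.1.2) p.2
  left_inv w := by simp only [append_left_right]
  right_inv p := by simp

/-- The random oracle that is programmed as follows: the value at `(b, m)` is `U g x` if `b` is
the bit `σ g` and `V g x'` otherwise, where the private oracle supplies at `m` the string `g` and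
the coins of two samples `x` and `x'`. -/
def programmed {l d t k : ℕ} (samp : Bits l → Bits d) (U V : Bits t → Bits d → Bits d)
    (σ : Bits t → Bool) (Oc : Bits k → Bits (l + l + t)) (r : Bits (k + 1)) : Bits d :=
  let w := Oc (Fin.tail r)
  if r 0 = σ (right w) then U (right w) (samp (left (left w)))
  else V (right w) (samp (right (left w)))

/-- A random oracle that is programmed with permutations `U g` and `V g` of the range is uniformly
distributed and independent of the strings `g`. -/
theorem uniformOn_programmed {l d t k : ℕ} {samp : Bits l → Bits d} {S : Finset (Bits d)}
    (hs : UniformOn samp S) {U V : Bits t → Bits d → Bits d} (hU : ∀ g, Set.BijOn (U g) S S)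
    (hV : ∀ g, Set.BijOn (V g) S S) (σ : Bits t → Bool) :
    UniformOn (fun Oc : Bits k → Bits (l + l + t) =>
        (programmed samp U V σ Oc, fun m => right (Oc m)))
      ((Fintype.piFinset fun _ => S) ×ˢ Finset.univ) := by
  have h1 := ((UniformOn.prod (fun g => hs.comp_bijOn (hU g))
    (fun g => hs.comp_bijOn (hV g))).comp_equiv (splitCoins l t)).pi (I := Bits k)
  let e : (Bits k → (Bits d × Bits d) × Bits t) → (Bits (k + 1) → Bits d) × (Bits k → Bits t) :=
    fun h => (fun r => if r 0 = σ (h (Fin.tail r)).2 then (h (Fin.tail r)).1.1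
      else (h (Fin.tail r)).1.2, fun m => (h m).2)
  refine h1.comp_bijOn (e := e) ?_
  refine Set.InvOn.bijOn (f' := fun p m => ((p.1 (Fin.cons (σ (p.2 m)) m),
    p.1 (Fin.cons (!σ (p.2 m)) m)), p.2 m)) ⟨?_, ?_⟩ ?_ ?_
  · intro h _
    funext m
    simp [e]
  · rintro ⟨O, g⟩ _
    simp only [e]
    congr 1
    funext r
    split_ifs with h
    · rw [← h, Fin.cons_self_tail]
    · have : (!σ (g (Fin.tail r))) = r 0 := by
        revert h
        cases r 0 <;> cases σ (g (Fin.tail r)) <;> simp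
      rw [this, Fin.cons_self_tail]
  · intro h hh
    simp only [Finset.mem_coe, Fintype.mem_piFinset, Finset.mem_product, Finset.mem_univ,
      and_true] at hh ⊢
    intro r
    simp only [e]
    split_ifs
    · exact (hh _).1
    · exact (hh _).2
  · rintro ⟨O, g⟩ hh
    simp only [Finset.mem_coe, Fintype.mem_piFinset, Finset.mem_product, Finset.mem_univ,
      and_true] at hh ⊢
    exact fun m => ⟨hh _, hh _⟩

theorem expect_programmed {l d t k : ℕ} {samp : Bits l → Bits d} {S : Finset (Bits d)}
    (hs : UniformOn samp S) {U V : Bits t → Bits d → Bits d} (hU : ∀ g, Set.BijOn (U g) S S)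
    (hV : ∀ g, Set.BijOn (V g) S S) (σ : Bits t → Bool)
    (Φ : (Bits (k + 1) → Bits d) → (Bits k → Bits t) → ℝ) :
    𝔼 Oc : Bits k → Bits (l + l + t),
        Φ (programmed samp U V σ Oc) (fun m => right (Oc m)) =
      𝔼 O ∈ Fintype.piFinset (fun _ => S), 𝔼 g, Φ O g := by
  rw [(uniformOn_programmed hs hU hV σ).expect_comp fun p => Φ p.1 p.2, Finset.expect_product]

theorem TrapdoorPair.uniformOn_sample (F : TrapdoorPair) (n : ℕ) {k}
    (hk : k ∈ (F.keyGen n).support) :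
    UniformOn (F.sample n k.2) (F.dom n k.2) := by
  refine ⟨F.sample_mem n k hk, fun y hy => ?_⟩
  have h := Finset.card_eq_sum_card_fiberwise (f := F.sample n k.2) (s := Finset.univ)
    (t := F.dom n k.2) fun ρ _ => F.sample_mem n k hk ρ
  rw [Finset.sum_congr rfl fun x hx => F.sample_uniform n k hk x hx y hy, Finset.sum_const,
    smul_eq_mul, mul_comm] at h
  exact h.symm

/-! ### The reduction from forging Katz-Wang signatures to claw-finding -/

theorem negligible_zero : Negligible fun _ => 0 := fun m => by simp

theorem not_negligible_const {r : ℝ} (hr : r ≠ 0) : ¬ Negligible fun _ => r := by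
  intro h
  have h0 := h 0
  simp only [pow_zero, one_mul] at h0
  exact hr (tendsto_nhds_unique tendsto_const_nhds h0)

theorem sum_map_toReal {α β : Type*} [Fintype α] [Fintype β] (p : PMF α) (f : α → β)
    (H : β → ℝ) : ∑ x, ((p.map f) x).toReal * H x = ∑ k, (p k).toReal * H (f k) := by
  classical
  have h : ∀ x, ((p.map f) x).toReal = ∑ k, if x = f k then (p k).toReal else 0 := by
    intro x
    rw [PMF.map_apply, tsum_fintype, ENNReal.toReal_sum]
    · refine Finset.sum_congr rfl fun k _ => ?_
      split_ifs <;> simp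
    · intro k _
      split_ifs
      · exact p.apply_ne_top k
      · simp
  simp only [h, Finset.sum_mul]
  rw [Finset.sum_comm]
  refine Finset.sum_congr rfl fun k _ => ?_
  simp [ite_mul]

theorem sum_toReal_congr {α : Type*} [Fintype α] (p : PMF α) {H H' : α → ℝ}
    (h : ∀ k ∈ p.support, H k = H' k) :
    ∑ k, (p k).toReal * H k = ∑ k, (p k).toReal * H' k := by
  refine Finset.sum_congr rfl fun k _ => ?_
  by_cases hk : k ∈ p.support
  · rw [h k hk]
  · rw [(p.apply_eq_zero_iff k).2 hk]
    simp

theorem sum_toReal_mono {α : Type*} [Fintype α] (p : PMF α) {H H' : α → ℝ}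
    (h : ∀ k ∈ p.support, H k ≤ H' k) :
    ∑ k, (p k).toReal * H k ≤ ∑ k, (p k).toReal * H' k := by
  refine Finset.sum_le_sum fun k _ => ?_
  by_cases hk : k ∈ p.support
  · exact mul_le_mul_of_nonneg_left (h k hk) ENNReal.toReal_nonneg
  · rw [(p.apply_eq_zero_iff k).2 hk]
    simp

/-- The values of a random function at distinct points are independent. -/
theorem expect_comp_injective {I J X : Type*} [Fintype I] [DecidableEq I] [Fintype J]
    [DecidableEq J] [Fintype X] [Nonempty X] {ms : J → I} (hms : Function.Injective ms)
    (Φ : (J → X) → ℝ) :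
    𝔼 g : I → X, Φ (fun j => g (ms j)) = 𝔼 ρ : J → X, Φ ρ := by
  classical
  let e : J ⊕ {i // ¬ i ∈ Set.range ms} ≃ I :=
    ((Equiv.ofInjective ms hms).sumCongr (Equiv.refl _)).trans (Equiv.sumCompl (· ∈ Set.range ms))
  have h : 𝔼 g : I → X, Φ (fun j => g (ms j)) =
      𝔼 p : (J → X) × ({i // ¬ i ∈ Set.range ms} → X), Φ p.1 := by
    refine Fintype.expect_equiv ((e.arrowCongr (Equiv.refl X)).symm.trans
      (Equiv.sumArrowEquivProdArrow _ _ _)) _ _ fun g => ?_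
    congr 1
  rw [h, ← Finset.univ_product_univ, Finset.expect_product]
  simp [Finset.expect_const Finset.univ_nonempty]

namespace TrapdoorPair

variable (F : TrapdoorPair)

/-- The random oracle that the reduction simulates, for messages of `k` bits. -/
def kwRand (n : ℕ) {k : ℕ} (Oc : Bits k → Bits (F.coinLen n + F.coinLen n + 1))
    (pk : Bits (F.pkLen n)) : Bits (k + 1) → Bits (F.domLen n) :=
  programmed (F.sample n pk) (fun _ => F.f₁ n pk) (fun _ => F.f₂ n pk) (fun g => g 0) Oc

/-- The Katz-Wang signing algorithm. -/
def kwSign (n : ℕ) {k : ℕ} (O : Bits (k + 1) → Bits (F.domLen n)) (sk : Bits (F.skLen n))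
    (m : Bits k) (ρ : Bits 1) : Bits (F.domLen n) :=
  F.inv₁ n sk (O (Fin.cons (ρ 0) m))

/-- The winning condition of the forgery game of the Katz-Wang scheme. -/
def kwForgery (n : ℕ) {k : ℕ} (O : Bits (k + 1) → Bits (F.domLen n)) (pk : Bits (F.pkLen n))
    (log : List (Bits k)) (y : Bits (k + F.domLen n)) : Bool :=
  decide (left y ∉ log) && decide (right y ∈ F.dom n pk ∧
    (F.f₁ n pk (right y) = O (Fin.cons false (left y)) ∨
      F.f₁ n pk (right y) = O (Fin.cons true (left y))))

/-- The forged signature is a preimage under `f₁` of the value of the random oracle that the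
signer, with coins `β`, does not use for this message. -/
def hits (n : ℕ) {k : ℕ} (O : Bits (k + 1) → Bits (F.domLen n)) (pk : Bits (F.pkLen n))
    (β : Bits k → Bits 1) (y : Bits (k + F.domLen n)) : Bool :=
  decide (right y ∈ F.dom n pk ∧ F.f₁ n pk (right y) = O (Fin.cons (!β (left y) 0) (left y)))

/-- The random oracles for messages of `k` bits. -/
def kwOracles (n k : ℕ) (pk : Bits (F.pkLen n)) : Finset (Bits (k + 1) → Bits (F.domLen n)) :=
  Fintype.piFinset fun _ => F.dom n pk

/-! ### Efficiency of the reduction -/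

section efficient

variable {F} {μ : ℕ → ℕ}

theorem efficient_accept (F : TrapdoorPair) :
    Efficient (fun n => F.clawProblem.instLen n + F.clawProblem.ansLen n) (fun _ => 1)
      fun n w => bit (F.clawProblem.accept n (left w) (right w)) := by
  change Efficient (fun n => F.pkLen n + (F.domLen n + F.domLen n)) (fun _ => 1) fun n w =>
    bit (decide (left (right w) ∈ F.dom n (left w) ∧ right (right w) ∈ F.dom n (left w) ∧
      F.f₁ n (left w) (left (right w)) = F.f₂ n (left w) (right (right w))))
  have hp : EfficientRel (fun _ => 0) (fun _ => 0)
    (fun n => F.pkLen n + (F.domLen n + F.domLen n)) F.pkLen fun _ _ w => left w := .left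
  have hx : EfficientRel (fun _ => 0) (fun _ => 0)
    (fun n => F.pkLen n + (F.domLen n + F.domLen n)) F.domLen fun _ _ w => left (right w) :=
      .comp .left .right
  have hy : EfficientRel (fun _ => 0) (fun _ => 0)
    (fun n => F.pkLen n + (F.domLen n + F.domLen n)) F.domLen fun _ _ w => right (right w) :=
      .comp .right .right
  have h1 := EfficientRel.comp₂ (f := fun n pk x => bit (decide (x ∈ F.dom n pk))) F.dom_eff hp hx
  have h2 := EfficientRel.comp₂ (f := fun n pk x => bit (decide (x ∈ F.dom n pk))) F.dom_eff hp hy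
  have h3 := EfficientRel.eq F.domLen_poly (EfficientRel.comp₂ (f := F.f₁) F.f₁_eff hp hx)
    (EfficientRel.comp₂ (f := F.f₂) F.f₂_eff hp hy)
  refine ((h1.and (.const 1) h2).and (.const 1) h3).congr fun n O w => ?_
  funext k
  simp [bit, Bool.and_assoc]

variable {a b i : ℕ → ℕ} {pk : ∀ n, (Bits (a n) → Bits (b n)) → Bits (i n) → Bits (F.pkLen n)}

theorem efficient_sample (hpk : EfficientRel a b i F.pkLen pk)
    {ρ : ∀ n, (Bits (a n) → Bits (b n)) → Bits (i n) → Bits (F.coinLen n)}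
    (hρ : EfficientRel a b i F.coinLen ρ) :
    EfficientRel a b i F.domLen fun n O w => F.sample n (pk n O w) (ρ n O w) :=
  .comp₂ (f := F.sample) F.sample_eff hpk hρ

theorem efficient_f₁ (hpk : EfficientRel a b i F.pkLen pk)
    {x : ∀ n, (Bits (a n) → Bits (b n)) → Bits (i n) → Bits (F.domLen n)}
    (hx : EfficientRel a b i F.domLen x) :
    EfficientRel a b i F.domLen fun n O w => F.f₁ n (pk n O w) (x n O w) :=
  .comp₂ (f := F.f₁) F.f₁_eff hpk hx

theorem efficient_f₂ (hpk : EfficientRel a b i F.pkLen pk)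
    {x : ∀ n, (Bits (a n) → Bits (b n)) → Bits (i n) → Bits (F.domLen n)}
    (hx : EfficientRel a b i F.domLen x) :
    EfficientRel a b i F.domLen fun n O w => F.f₂ n (pk n O w) (x n O w) :=
  .comp₂ (f := F.f₂) F.f₂_eff hpk hx

theorem efficient_kw_rand :
    EfficientRel μ (fun n => F.coinLen n + F.coinLen n + 1) (fun n => μ n + 1 + F.pkLen n) F.domLen
      fun n Oc w => F.kwRand n Oc (right w) (left w) := by
  have hw : EfficientRel μ (fun n => F.coinLen n + F.coinLen n + 1)
      (fun n => μ n + 1 + F.pkLen n) (fun n => F.coinLen n + F.coinLen n + 1)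
      fun n Oc w => Oc (Fin.tail (left w)) :=
    EfficientRel.query (EfficientRel.rewire fun n k => Fin.castAdd (F.pkLen n) k.succ)
  have hg : EfficientRel μ (fun n => F.coinLen n + F.coinLen n + 1)
      (fun n => μ n + 1 + F.pkLen n) (fun _ => 1)
      fun n Oc w => bit (decide (left w 0 = right (Oc (Fin.tail (left w))) 0)) := by
    refine (EfficientRel.eq (.const 1) (EfficientRel.rewire fun n _ => Fin.castAdd (F.pkLen n) 0)
      (EfficientRel.right.comp hw)).congr fun n O w => ?_
    congr 1
    rw [decide_eq_decide, funext_iff, Fin.forall_fin_one]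
    rfl
  refine (EfficientRel.ite F.domLen_poly hg
    (efficient_f₁ .right (efficient_sample .right (.comp .left (.comp .left hw))))
    (efficient_f₂ .right (efficient_sample .right (.comp .right (.comp .left hw))))).congr
      fun n O w => ?_
  simp only [decide_eq_true_eq]
  rfl

/-- The first element supplied by the private oracle for a message. -/
theorem efficient_kw_sign {m : ∀ n, (Bits (μ n) → Bits (F.coinLen n + F.coinLen n + 1)) →
      Bits (i n) → Bits (μ n)} {pk : ∀ n, (Bits (μ n) → Bits (F.coinLen n + F.coinLen n + 1)) →
      Bits (i n) → Bits (F.pkLen n)}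
    (hm : EfficientRel μ (fun n => F.coinLen n + F.coinLen n + 1) i μ m)
    (hpk : EfficientRel μ (fun n => F.coinLen n + F.coinLen n + 1) i F.pkLen pk) :
    EfficientRel μ (fun n => F.coinLen n + F.coinLen n + 1) i F.domLen
      fun n Oc w => F.sample n (pk n Oc w) (left (left (Oc (m n Oc w)))) :=
  efficient_sample hpk (.comp .left (.comp .left (.query hm)))

/-- The second element supplied by the private oracle for a message. -/
theorem efficient_kw_finish {m : ∀ n, (Bits (μ n) → Bits (F.coinLen n + F.coinLen n + 1)) →
      Bits (i n) → Bits (μ n)} {pk : ∀ n, (Bits (μ n) → Bits (F.coinLen n + F.coinLen n + 1)) →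
      Bits (i n) → Bits (F.pkLen n)}
    (hm : EfficientRel μ (fun n => F.coinLen n + F.coinLen n + 1) i μ m)
    (hpk : EfficientRel μ (fun n => F.coinLen n + F.coinLen n + 1) i F.pkLen pk) :
    EfficientRel μ (fun n => F.coinLen n + F.coinLen n + 1) i F.domLen
      fun n Oc w => F.sample n (pk n Oc w) (right (left (Oc (m n Oc w)))) :=
  efficient_sample hpk (.comp .right (.comp .left (.query hm)))

end efficient

/-! ### The simulated oracle and the simulated signatures -/

section simulated

variable {F} {n k : ℕ} {κ : Bits (F.skLen n) × Bits (F.pkLen n)}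

theorem expect_kw (hκ : κ ∈ (F.keyGen n).support)
    (Φ : (Bits (k + 1) → Bits (F.domLen n)) → (Bits k → Bits 1) → ℝ) :
    𝔼 Oc : Bits k → Bits (F.coinLen n + F.coinLen n + 1),
        Φ (F.kwRand n Oc κ.2) (fun m => right (Oc m)) =
      𝔼 O ∈ F.kwOracles n k κ.2, 𝔼 β, Φ O β :=
  expect_programmed (F.uniformOn_sample n hκ) (fun _ => F.bijOn₁ n κ hκ)
    (fun _ => F.bijOn₂ n κ hκ) (fun g => g 0) Φ

variable (Oc : Bits k → Bits (F.coinLen n + F.coinLen n + 1)) (m : Bits k)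

theorem kwRand_self (pk : Bits (F.pkLen n)) :
    F.kwRand n Oc pk (Fin.cons (right (Oc m) 0) m) =
      F.f₁ n pk (F.sample n pk (left (left (Oc m)))) := by
  simp [kwRand, programmed]

theorem kwRand_not (pk : Bits (F.pkLen n)) :
    F.kwRand n Oc pk (Fin.cons (!right (Oc m) 0) m) =
      F.f₂ n pk (F.sample n pk (right (left (Oc m)))) := by
  simp [kwRand, programmed]

/-- The simulated signature is the one that the signer makes with the coin `b` of the private
oracle. -/
theorem sample_eq_kwSign (hκ : κ ∈ (F.keyGen n).support) :
    F.sample n κ.2 (left (left (Oc m))) =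
      F.kwSign n (F.kwRand n Oc κ.2) κ.1 m (right (Oc m)) := by
  rw [kwSign, kwRand_self]
  exact ((F.invOn₁ n κ hκ).1 (F.sample_mem n κ hκ _)).symm

theorem kwRand_mem (hκ : κ ∈ (F.keyGen n).support) (r : Bits (k + 1)) :
    F.kwRand n Oc κ.2 r ∈ F.dom n κ.2 := by
  simp only [kwRand, programmed]
  split_ifs
  · exact (F.bijOn₁ n κ hκ).mapsTo (F.sample_mem n κ hκ _)
  · exact (F.bijOn₂ n κ hκ).mapsTo (F.sample_mem n κ hκ _)

theorem accept_eq_hits (hκ : κ ∈ (F.keyGen n).support) (y : Bits (k + F.domLen n)) :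
    F.clawProblem.accept n κ.2
        (Fin.append (right y) (F.sample n κ.2 (right (left (Oc (left y)))))) =
      F.hits n (F.kwRand n Oc κ.2) κ.2 (fun m => right (Oc m)) y := by
  have h := F.sample_mem n κ hκ (right (left (Oc (left y))))
  rw [hits, kwRand_not]
  refine decide_eq_decide.2 ?_
  rw [left_append, right_append]
  exact ⟨fun ⟨h1, _, h2⟩ => ⟨h1, h2⟩, fun ⟨h1, h2⟩ => ⟨h1, h, h2⟩⟩

/-- Whatever the forgery is, it hits with probability at least `1/2`, because the coin of the forged
message is independent of the view of the adversary. -/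
theorem expect_prob_le_two_mul
    (A : QCircuit (k + 1) (F.domLen n) k (F.domLen n) (F.pkLen n) (k + F.domLen n))
    (O : Bits (k + 1) → Bits (F.domLen n)) (κ : Bits (F.skLen n) × Bits (F.pkLen n))
    (V : List (Bits k) → Bits (k + F.domLen n) → Bool)
    (hV : ∀ log y, V log y = true → F.kwForgery n O κ.2 log y = true) :
    𝔼 β : Bits k → Bits 1, A.prob O
        (fun (_ : Bits 0) m => some (F.kwSign n O κ.1 m (β m))) κ.2 V ≤
      2 * 𝔼 β : Bits k → Bits 1, A.prob O
        (fun (_ : Bits 0) m => some (F.kwSign n O κ.1 m (β m))) κ.2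
        fun log y => V log y && F.hits n O κ.2 β y := by
  simp only [QCircuit.prob_eq_gain]
  have h := expect_gain_resample A O κ.2 (fun v m => F.kwSign n O κ.1 m v)
    (fun y : Bits (k + F.domLen n) => left y)
    (fun β log y => if (V log y && F.hits n O κ.2 β y) = true then (1 : ℝ) else 0) (by
      intro β l y hy
      rw [if_neg]
      intro h
      have := hV l y (Bool.and_eq_true_iff.1 h).1
      simp only [kwForgery, Bool.and_eq_true, decide_eq_true_eq] at this
      exact this.1 hy)
  refine le_trans ?_ (le_of_eq (congrArg (2 * ·) h.symm))
  simp only [Finset.mul_expect, ← QCircuit.gain_const_mul]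
  refine Finset.expect_le_expect fun β _ => QCircuit.gain_mono _ _ _ _ fun l y _ => ?_
  have hcard : Fintype.card (Bits 1) = 2 := by simp
  rw [← Finset.mul_expect, Fintype.expect_eq_sum_div_card, hcard]
  have hnn : ∀ v ∈ (Finset.univ : Finset (Bits 1)),
      (0 : ℝ) ≤ if (V l y && F.hits n O κ.2 (Function.update β (left y) v) y) = true
        then 1 else 0 :=
    fun v _ => by split_ifs <;> norm_num
  split_ifs with hv
  · have hf := hV l y hv
    -- the coin for which the signer does not use the value that the forger has inverted
    have h2 : ∃ v : Bits 1, F.hits n O κ.2 (Function.update β (left y) v) y = true := by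
      simp only [kwForgery, Bool.and_eq_true, decide_eq_true_eq] at hf
      obtain ⟨-, hd, h0 | h1⟩ := hf
      · exact ⟨fun _ => true, by simp [hits, hd, h0]⟩
      · exact ⟨fun _ => false, by simp [hits, hd, h1]⟩
    obtain ⟨v, hh⟩ := h2
    have := Finset.single_le_sum hnn (Finset.mem_univ v)
    rw [if_pos (by rw [hv, hh]; rfl)] at this
    push_cast
    linarith
  · have := Finset.sum_nonneg hnn
    positivity

end simulated

/-! ### The games of the Katz-Wang scheme and the experiment of the reduction -/

section games

variable {F} {μ : ℕ → ℕ} (A : ∀ n, QCircuit (μ n + 1) (F.domLen n) (μ n) (F.domLen n) (F.pkLen n)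
    (μ n + F.domLen n)) (n : ℕ)

/-- The probability of the event `E` in the forgery game in which the coins of the signer are drawn
once for each message. -/
def kwRepeatProb (E : Bits (F.pkLen n) → (Bits (μ n + 1) → Bits (F.domLen n)) →
    (Bits (μ n) → Bits 1) → List (Bits (μ n)) → Bits (μ n + F.domLen n) → Bool) : ℝ :=
  ∑ κ, (F.keyGen n κ).toReal * 𝔼 O ∈ F.kwOracles n (μ n) κ.2, 𝔼 β : Bits (μ n) → Bits 1,
    (A n).prob O (fun (_ : Bits 0) m => some (F.kwSign n O κ.1 m (β m))) κ.2 (E κ.2 O β)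

theorem kw_advDistinct_eq : (F.katzWang μ).advDistinct A n =
    kwRepeatProb A n fun pk O _ log y => decide log.Nodup && F.kwForgery n O pk log y := by
  refine Finset.sum_congr rfl fun κ _ => congrArg ((F.keyGen n κ).toReal * ·) ?_
  refine Finset.expect_congr rfl fun O _ => ?_
  have h1 := expect_gain_lazy (A n) O κ.2 (fun (ρ : Bits 1) m => F.kwSign n O κ.1 m ρ)
    (fun log y => if (decide log.Nodup && F.kwForgery n O κ.2 log y) = true
      then (1 : ℝ) else 0) (fun l y hl => by simp [hl])
  exact (QCircuit.prob_eq_gain _ _ _ _ _).trans (h1.symm.trans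
    (Finset.expect_congr rfl fun β _ => (QCircuit.prob_eq_gain _ _ _ _ _).symm))

/-- The experiment of the reduction is the forgery game in which the coins of the signer are drawn
once for each message. -/
theorem kw_simProb
    {E : (Bits (μ n) → Bits (F.coinLen n + F.coinLen n + 1)) → Bits (F.pkLen n) →
      List (Bits (μ n)) → Bits (μ n + F.domLen n) → Bool}
    (E' : Bits (F.pkLen n) → (Bits (μ n + 1) → Bits (F.domLen n)) →
      (Bits (μ n) → Bits 1) → List (Bits (μ n)) → Bits (μ n + F.domLen n) → Bool)
    (hE : ∀ κ ∈ (F.keyGen n).support, ∀ Oc log y, E Oc κ.2 log y =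
      E' κ.2 (F.kwRand n Oc κ.2) (fun m => right (Oc m)) log y) :
    (F.kwReduction μ).simProb A n E = kwRepeatProb A n E' := by
  refine (sum_map_toReal (F.keyGen n) Prod.snd fun x =>
    𝔼 Oc : Bits (μ n) → Bits (F.coinLen n + F.coinLen n + 1), (A n).prob
      (F.kwRand n Oc x) (fun (_ : Bits 0) m => some (F.sample n x (left (left (Oc m))))) x
      (E Oc x)).trans ?_
  refine sum_toReal_congr _ fun κ hκ => ?_
  rw [← expect_kw hκ fun O β => (A n).prob O
    (fun (_ : Bits 0) m => some (F.kwSign n O κ.1 m (β m))) κ.2 (E' κ.2 O β)]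
  refine Finset.expect_congr rfl fun Oc _ => ?_
  have h2 : E Oc κ.2 = E' κ.2 (F.kwRand n Oc κ.2) (fun m => right (Oc m)) := by
    funext log y
    exact hE κ hκ Oc log y
  simp only [h2, sample_eq_kwSign Oc _ hκ]

theorem kw_simAdv : (F.kwReduction μ).simAdv A n =
    kwRepeatProb A n fun pk O β _ y => F.hits n O pk β y :=
  kw_simProb A n (fun pk O β _ y => F.hits n O pk β y) fun _ hκ Oc _ y => accept_eq_hits Oc hκ y

theorem kwRepeatProb_mono {E E' : Bits (F.pkLen n) → (Bits (μ n + 1) → Bits (F.domLen n)) →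
    (Bits (μ n) → Bits 1) → List (Bits (μ n)) → Bits (μ n + F.domLen n) → Bool}
    (h : ∀ pk O β l y, E pk O β l y = true → E' pk O β l y = true) :
    kwRepeatProb A n E ≤ kwRepeatProb A n E' := by
  refine sum_toReal_mono _ fun κ _ => Finset.expect_le_expect fun O _ =>
    Finset.expect_le_expect fun β _ => ?_
  rw [QCircuit.prob_eq_gain, QCircuit.prob_eq_gain]
  refine QCircuit.gain_mono _ _ _ _ fun l y _ => ?_
  by_cases hE : E κ.2 O β l y = true
  · simp [hE, h _ _ _ l y hE]
  · rw [if_neg hE]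
    split_ifs <;> norm_num

theorem kwRepeatProb_le_two_mul
    (V : Bits (F.pkLen n) → (Bits (μ n + 1) → Bits (F.domLen n)) → List (Bits (μ n)) →
      Bits (μ n + F.domLen n) → Bool)
    (hV : ∀ pk O log y, V pk O log y = true → F.kwForgery n O pk log y = true) :
    kwRepeatProb A n (fun pk O _ => V pk O) ≤
      2 * kwRepeatProb A n fun pk O β log y => V pk O log y && F.hits n O pk β y := by
  rw [kwRepeatProb, kwRepeatProb, Finset.mul_sum]
  simp only [mul_left_comm (2 : ℝ)]
  refine sum_toReal_mono _ fun κ _ => ?_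
  rw [Finset.mul_expect]
  exact Finset.expect_le_expect fun O _ => expect_prob_le_two_mul (A n) O κ _ fun _ _ => hV _ _ _ _

/-- A forgery on a message for which the forger has no signature solves the claw problem with
probability at least `1/2`. -/
theorem kwRepeatProb_le_simAdv
    (V : Bits (F.pkLen n) → (Bits (μ n + 1) → Bits (F.domLen n)) → List (Bits (μ n)) →
      Bits (μ n + F.domLen n) → Bool)
    (hV : ∀ pk O log y, V pk O log y = true → F.kwForgery n O pk log y = true) :
    kwRepeatProb A n (fun pk O _ => V pk O) ≤ 2 * (F.kwReduction μ).simAdv A n := by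
  refine (kwRepeatProb_le_two_mul A n V hV).trans ?_
  rw [kw_simAdv]
  exact mul_le_mul_of_nonneg_left (kwRepeatProb_mono A n fun _ _ _ _ _ h =>
    (Bool.and_eq_true_iff.1 h).2) two_pos.le

theorem kw_advRepeat_le : (F.katzWang μ).advRepeat A n ≤ 2 * (F.kwReduction μ).simAdv A n :=
  kwRepeatProb_le_simAdv A n (fun pk O => F.kwForgery n O pk) fun _ _ _ _ h => h

theorem kw_advDistinct_le : (F.katzWang μ).advDistinct A n ≤ 2 * (F.kwReduction μ).simAdv A n := by
  rw [kw_advDistinct_eq]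
  exact kwRepeatProb_le_simAdv A n _ fun _ _ _ _ h => (Bool.and_eq_true_iff.1 h).2

end games

/-! ### The reduction is in history-free form -/

section historyFree

variable {F} {μ : ℕ → ℕ}

theorem kw_isEfficient (hμ : PolyBounded μ) : (F.kwReduction μ).IsEfficient :=
  ⟨F.pkLen_poly, hμ, (F.coinLen_poly.add F.coinLen_poly).add (.const 1),
    EfficientRel.pair .id .id, efficient_kw_rand,
    EfficientRel.optBits_some (efficient_kw_sign .left .right),
    EfficientRel.optBits_some (EfficientRel.pair (.comp .right .left)
      (efficient_kw_finish (.comp .left .left) .right)),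
    EfficientRel.id⟩

theorem kw_instanceOK : (F.kwReduction μ).InstanceOK := by
  refine ⟨fun n pk => rfl, ?_⟩
  have h : ∀ n, ∑ x, |((((F.katzWang μ).keyGen n).map
      fun k => (F.kwReduction μ).inst n k.2) x).toReal - (F.clawProblem.gen n x).toReal| = 0 :=
    fun n => Finset.sum_eq_zero fun x _ => abs_eq_zero.2 (sub_self _)
  simp only [h]
  exact negligible_zero

theorem kw_randOK : (F.kwReduction μ).RandOK := by
  intro x hx (D : Distinguisher (fun n => μ n + 1) F.domLen) _
  have h : ∀ n, |(𝔼 Oc : Bits (μ n) → Bits (F.coinLen n + F.coinLen n + 1),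
      D.accProb n (F.kwRand n Oc (x n))) -
        𝔼 O ∈ F.kwOracles n (μ n) (x n), D.accProb n O| = 0 := by
    intro n
    obtain ⟨κ, hκ, hκx⟩ := (PMF.mem_support_map_iff _ _ _).1 (hx n)
    rw [abs_eq_zero, sub_eq_zero, ← hκx, expect_kw (k := μ n) hκ fun O _ => D.accProb n O]
    simp [Finset.expect_const Finset.univ_nonempty]
  exact Eq.mp (congrArg Negligible (funext fun n => (h n).symm)) negligible_zero

theorem kw_signDist {n : ℕ} {κ : Bits (F.skLen n) × Bits (F.pkLen n)}
    (hκ : κ ∈ (F.keyGen n).support) {q : ℕ} {ms : Fin q → Bits (μ n)}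
    (hms : Function.Injective ms) : (F.kwReduction μ).signDist n κ ms = 0 := by
  refine Finset.sum_eq_zero fun O _ => Finset.sum_eq_zero fun σ _ => ?_
  rw [abs_eq_zero, sub_eq_zero]
  have h1 : (𝔼 Oc : Bits (μ n) → Bits (F.coinLen n + F.coinLen n + 1),
      if ∀ j, ((F.kwReduction μ).sign n Oc (ms j) κ.2).isSome then (1 : ℝ) else 0) = 1 := by
    have : ∀ Oc j, ((F.kwReduction μ).sign n Oc (ms j) κ.2).isSome := fun Oc j => rfl
    exact (Finset.expect_congr rfl fun Oc _ => if_pos (this Oc)).trans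
      (Finset.expect_const Finset.univ_nonempty _)
  have h2 : ∀ (O : Bits (μ n + 1) → Bits (F.domLen n)) (σ : Fin q → Bits (F.domLen n)),
      (𝔼 Oc : Bits (μ n) → Bits (F.coinLen n + F.coinLen n + 1),
      if F.kwRand n Oc κ.2 = O ∧ ∀ j, some (F.sample n κ.2 (left (left (Oc (ms j))))) =
        some (σ j) then (1 : ℝ) else 0) =
      𝔼 O₁ ∈ F.kwOracles n (μ n) κ.2, 𝔼 ρ : Fin q → Bits 1,
        if O₁ = O ∧ ∀ j, F.kwSign n O₁ κ.1 (ms j) (ρ j) = σ j then (1 : ℝ) else 0 := by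
    intro O σ
    have h3 := expect_kw (k := μ n) hκ fun O₁ β => if O₁ = O ∧
      ∀ j, F.kwSign n O₁ κ.1 (ms j) (β (ms j)) = σ j then (1 : ℝ) else 0
    refine Eq.trans ?_ (h3.trans ?_)
    · simp only [sample_eq_kwSign _ _ hκ, Option.some.injEq]
    · refine Finset.expect_congr rfl fun O₁ _ => ?_
      exact expect_comp_injective hms fun ρ : Fin q → Bits 1 => if O₁ = O ∧
        ∀ j, F.kwSign n O₁ κ.1 (ms j) (ρ j) = σ j then (1 : ℝ) else 0
  refine (h2 O σ).trans ((one_mul _).symm.trans ?_)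
  exact congrArg (· * _) h1.symm

theorem kw_simProb_true (A : (F.katzWang μ).Forger) (n : ℕ) :
    (F.kwReduction μ).simProb A n (fun _ _ _ _ => true) = 1 := by
  have h : ∀ x Oc, (A n).prob (fun r => (F.kwReduction μ).rand n Oc r
      ((F.kwReduction μ).start n x).2) (fun (_ : Bits 0) m => (F.kwReduction μ).sign n Oc m
      ((F.kwReduction μ).start n x).2) ((F.kwReduction μ).start n x).1 (fun _ _ => true) = 1 :=
    fun x Oc => QCircuit.prob_true _ _ _ fun (_ : Bits 0) m =>
      F.sample n x (left (left (Oc m)))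
  simp only [Reduction.simProb, h, Finset.expect_const Finset.univ_nonempty, mul_one]
  exact sum_toReal_pmf _

theorem kw_signOK : (F.kwReduction μ).SignOK := by
  refine ⟨fun n κ hκ Oc m σ hσ => ?_, fun κ hκ q _ ms hms => ?_, fun A _ => ?_⟩
  · have h := Option.some.inj ((congrArg some (sample_eq_kwSign Oc m hκ)).symm.trans hσ)
    rw [← h]
    exact (F.katzWang μ).correct n κ hκ _ (kwRand_mem Oc hκ) m _
  · exact Eq.mp (congrArg Negligible (funext fun n => (kw_signDist (hκ n) (hms n)).symm))
      negligible_zero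
  · simp only [kw_simProb_true]
    exact not_negligible_const one_ne_zero

theorem kw_finishOK : (F.kwReduction μ).FinishOK fun _ => 1 / 2 := by
  refine ⟨not_negligible_const (by norm_num), fun A _ n => ?_⟩
  have h1 : (F.kwReduction μ).simProb A n ((F.kwReduction μ).forged n) =
      kwRepeatProb A n fun pk O _ => F.kwForgery n O pk :=
    kw_simProb A n (fun pk O _ => F.kwForgery n O pk) fun _ _ _ _ _ => rfl
  have h2 : (F.kwReduction μ).simProb A n (fun Oc x log y =>
      (F.kwReduction μ).forged n Oc x log y && (F.kwReduction μ).solved n Oc x log y) =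
      kwRepeatProb A n fun pk O β log y => F.kwForgery n O pk log y && F.hits n O pk β y :=
    kw_simProb A n (fun pk O β log y => F.kwForgery n O pk log y && F.hits n O pk β y)
      fun κ hκ Oc log y => congrArg (F.kwForgery n (F.kwRand n Oc κ.2) κ.2 log y && ·)
        (accept_eq_hits Oc hκ y)
  have h3 := kwRepeatProb_le_two_mul A n (fun pk O => F.kwForgery n O pk) fun _ _ _ _ h => h
  rw [h1, h2]
  linarith

theorem kw_isHistoryFree (hμ : PolyBounded μ) :
    (F.kwReduction μ).IsHistoryFree fun _ => 1 / 2 :=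
  ⟨kw_isEfficient hμ, kw_instanceOK, kw_randOK, kw_signOK, kw_finishOK⟩

end historyFree

end TrapdoorPair

/-! ### Claw-finding with a pseudorandom private oracle -/

namespace TrapdoorPair

variable {F : TrapdoorPair} {μ : ℕ → ℕ}

theorem kw_exists_solver (hprf : QuantumPRFsExist) (hμ : PolyBounded μ)
    (A : ∀ n, QCircuit (μ n + 1) (F.domLen n) (μ n) (F.domLen n) (F.pkLen n) (μ n + F.domLen n))
    (hA : PolySize A) :
    ∃ B : F.clawProblem.Solver, PolySize B ∧ ∃ ν : ℕ → ℝ, Negligible ν ∧ (∀ n, 0 ≤ ν n) ∧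
      ∀ n, (F.kwReduction μ).simAdv A n ≤ F.clawProblem.adv B n + ν n :=
  exists_solver_of_prf hprf F.clawProblem F.pkLen_poly (F.domLen_poly.add F.domLen_poly)
    (efficient_accept F) (a := μ) (b := fun n => F.coinLen n + F.coinLen n + 1)
    (a' := fun n => μ n + 1) (b' := F.domLen) (μ := μ) (s := F.domLen)
    (o := fun n => μ n + F.domLen n) (c := fun _ => 0) hμ
    ((F.coinLen_poly.add F.coinLen_poly).add (.const 1)) (hμ.add (.const 1)) F.domLen_poly hμ
    F.domLen_poly (hμ.add F.domLen_poly) (.const 0) A hA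
    (rand := fun n Oc r pk => F.kwRand n Oc pk r) efficient_kw_rand
    (sign := fun n Oc _ m pk => F.sample n pk (left (left (Oc m))))
    (efficient_kw_sign (.comp .right .left) .right)
    (fin := fun n Oc y pk => Fin.append (right y) (F.sample n pk (right (left (Oc (left y))))))
    (.pair (.comp .right .left) (efficient_kw_finish (.comp .left .left) .right))

end TrapdoorPair

/-! ### Signatures with fresh coins -/

/-- The event that a random function marks `m` and none of the messages of `l` has probability
at least `p * (1 - p * l.length)`, if `p` is the probability that a single message is marked. -/
theorem le_expect_marked {I X : Type*} [Fintype I] [DecidableEq I] [Fintype X] [Nonempty X]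
    (P : X → Prop) [DecidablePred P] {p : ℝ} (hp : 𝔼 v, (if P v then (1 : ℝ) else 0) = p)
    (l : List I) {m : I} (hm : m ∉ l) :
    p * (1 - p * l.length) ≤
      𝔼 g : I → X, if P (g m) ∧ ∀ m' ∈ l, ¬ P (g m') then (1 : ℝ) else 0 := by
  have hone : ∀ m : I, 𝔼 g : I → X, (if P (g m) then (1 : ℝ) else 0) = p := by
    intro m
    rw [expect_update m]
    simp only [Function.update_self, hp]
    exact Finset.expect_const Finset.univ_nonempty _
  have hp0 : 0 ≤ p := by
    rw [← hp]
    exact Finset.expect_nonneg fun v _ => by split_ifs <;> norm_num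
  have hnone : ∀ l : List I,
      1 - p * l.length ≤ 𝔼 g : I → X, if ∀ m' ∈ l, ¬ P (g m') then (1 : ℝ) else 0 := by
    intro l
    induction l with
    | nil =>
      have : 𝔼 _g : I → X, (1 : ℝ) = 1 := Finset.expect_const Finset.univ_nonempty _
      simp [this]
    | cons a l ih =>
      have h : ∀ g : I → X, (if ∀ m' ∈ l, ¬ P (g m') then (1 : ℝ) else 0) -
          (if P (g a) then (1 : ℝ) else 0) ≤
          if ∀ m' ∈ a :: l, ¬ P (g m') then (1 : ℝ) else 0 := by
        intro g
        by_cases h1 : P (g a) <;> by_cases h2 : ∀ m' ∈ l, ¬ P (g m')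
        all_goals simp [h1, h2]
        all_goals (try split_ifs; all_goals norm_num)
      have := Finset.expect_le_expect (s := Finset.univ) fun g _ => h g
      rw [Finset.expect_sub_distrib, hone] at this
      push_cast [List.length_cons]
      linarith
  rw [expect_update m]
  have h : ∀ g : I → X, 𝔼 v : X, (if P (Function.update g m v m) ∧
      ∀ m' ∈ l, ¬ P (Function.update g m v m') then (1 : ℝ) else 0) =
      p * if ∀ m' ∈ l, ¬ P (g m') then (1 : ℝ) else 0 := by
    intro g
    rw [← hp, Finset.expect_mul]
    refine Finset.expect_congr rfl fun v _ => ?_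
    have h1 : (∀ m' ∈ l, ¬ P (Function.update g m v m')) ↔ ∀ m' ∈ l, ¬ P (g m') := by
      refine forall₂_congr fun m' hm' => ?_
      rw [Function.update_of_ne (ne_of_mem_of_not_mem hm' hm)]
    simp only [Function.update_self, h1]
    by_cases hv : P v <;> simp [hv]
  simp only [h, ← Finset.mul_expect]
  exact mul_le_mul_of_nonneg_left (hnone l) hp0

/-- All bits are set, which happens with probability `2 ^ (-t)`. -/
def allOnes {t : ℕ} (g : Bits t) : Bool := decide (g = fun _ => true)

theorem expect_allOnes (t : ℕ) :
    𝔼 g : Bits t, (if allOnes g = true then (1 : ℝ) else 0) = 1 / 2 ^ t := by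
  rw [Fintype.expect_eq_sum_div_card]
  simp [allOnes]

namespace TrapdoorPair

variable (F : TrapdoorPair)

/-- The element of the domain that the coins supplied by the private oracle determine for the bit
`c`. -/
def coinElem (n : ℕ) {t : ℕ} (pk : Bits (F.pkLen n)) (w : Bits (F.coinLen n + F.coinLen n + t))
    (c : Bool) : Bits (F.domLen n) :=
  if c = false then F.sample n pk (left (left w)) else F.sample n pk (right (left w))

/-- The permutation `f₂` if the message is marked, and `f₁` otherwise. -/
def markedPerm (n : ℕ) {t : ℕ} (pk : Bits (F.pkLen n)) (g : Bits t) (x : Bits (F.domLen n)) :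
    Bits (F.domLen n) :=
  if allOnes g then F.f₂ n pk x else F.f₁ n pk x

/-- The random oracle that is programmed so that both signatures are known for the messages that
are not marked. -/
def markedRand (n : ℕ) {k t : ℕ} (Oc : Bits k → Bits (F.coinLen n + F.coinLen n + t))
    (pk : Bits (F.pkLen n)) : Bits (k + 1) → Bits (F.domLen n) :=
  programmed (F.sample n pk) (F.markedPerm n pk) (F.markedPerm n pk) (fun _ => false) Oc

section marked

variable {F} {n k t : ℕ} {κ : Bits (F.skLen n) × Bits (F.pkLen n)}

theorem markedRand_apply (Oc : Bits k → Bits (F.coinLen n + F.coinLen n + t))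
    (pk : Bits (F.pkLen n)) (r : Bits (k + 1)) :
    F.markedRand n Oc pk r =
      F.markedPerm n pk (right (Oc (Fin.tail r))) (F.coinElem n pk (Oc (Fin.tail r)) (r 0)) := by
  simp only [markedRand, programmed, coinElem]
  split_ifs <;> rfl

theorem coinElem_mem (hκ : κ ∈ (F.keyGen n).support) (w : Bits (F.coinLen n + F.coinLen n + t))
    (c : Bool) : F.coinElem n κ.2 w c ∈ F.dom n κ.2 := by
  rw [coinElem]
  split_ifs <;> exact F.sample_mem n κ hκ _

theorem markedPerm_bijOn (hκ : κ ∈ (F.keyGen n).support) (g : Bits t) :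
    Set.BijOn (F.markedPerm n κ.2 g) (F.dom n κ.2) (F.dom n κ.2) := by
  by_cases hg : allOnes g = true
  · have : F.markedPerm n κ.2 g = F.f₂ n κ.2 := by funext x; simp [markedPerm, hg]
    rw [this]
    exact F.bijOn₂ n κ hκ
  · have : F.markedPerm n κ.2 g = F.f₁ n κ.2 := by funext x; simp [markedPerm, hg]
    rw [this]
    exact F.bijOn₁ n κ hκ

theorem coinElem_eq_kwSign (hκ : κ ∈ (F.keyGen n).support)
    (Oc : Bits k → Bits (F.coinLen n + F.coinLen n + t)) {m : Bits k}
    (hm : ¬ allOnes (right (Oc m)) = true) (ρ : Bits 1) :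
    F.coinElem n κ.2 (Oc m) (ρ 0) = F.kwSign n (F.markedRand n Oc κ.2) κ.1 m ρ := by
  rw [kwSign, markedRand_apply, Fin.tail_cons, Fin.cons_zero, markedPerm, if_neg hm]
  exact ((F.invOn₁ n κ hκ).1 (coinElem_mem hκ _ _)).symm

/-- The forger outputs a valid signature on a new message, this message is marked, and the signed
messages are not marked. -/
def markedForgery (F : TrapdoorPair) (n : ℕ) {k t : ℕ} (O : Bits (k + 1) → Bits (F.domLen n))
    (g : Bits k → Bits t) (pk : Bits (F.pkLen n)) (log : List (Bits k))
    (y : Bits (k + F.domLen n)) : Bool :=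
  F.kwForgery n O pk log y &&
    decide (allOnes (g (left y)) = true ∧ ∀ m ∈ log, ¬ allOnes (g m) = true)

/-- If no signed message is marked, then the simulated signatures are those of the signer, and a
forgery on a marked message completes one of two known elements to a claw. -/
theorem gain_markedForgery_le (hκ : κ ∈ (F.keyGen n).support)
    (A : QCircuit (k + 1) (F.domLen n) k (F.domLen n) (F.pkLen n) (k + F.domLen n))
    (Oc : Bits k → Bits (F.coinLen n + F.coinLen n + t)) :
    A.gain (F.markedRand n Oc κ.2)
        (fun (ρ : Bits 1) m => some (F.kwSign n (F.markedRand n Oc κ.2) κ.1 m ρ)) κ.2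
        (fun l y => if F.markedForgery n (F.markedRand n Oc κ.2) (fun m => right (Oc m)) κ.2 l y
          then 1 else 0) ≤
      ∑ c : Bool, A.prob (F.markedRand n Oc κ.2)
        (fun (ρ : Bits 1) m => some (F.coinElem n κ.2 (Oc m) (ρ 0))) κ.2
        fun _ y => F.clawProblem.accept n κ.2
          (Fin.append (right y) (F.coinElem n κ.2 (Oc (left y)) c)) := by
  rw [A.gain_congr _ _ _ (sgn' := fun (ρ : Bits 1) m => some (F.coinElem n κ.2 (Oc m) (ρ 0)))
    (dead := fun l => ∃ m ∈ l, allOnes (right (Oc m)) = true)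
    (fun l m ⟨m', hm', h⟩ => ⟨m', List.mem_cons_of_mem _ hm', h⟩)]
  · have h := A.gain_sum (F.markedRand n Oc κ.2)
      (fun (ρ : Bits 1) m => some (F.coinElem n κ.2 (Oc m) (ρ 0))) κ.2 Finset.univ
      (fun _ : Bool => 1) fun c _ y => if F.clawProblem.accept n κ.2
          (Fin.append (right y) (F.coinElem n κ.2 (Oc (left y)) c)) = true then 1 else 0
    simp only [one_mul] at h
    simp only [QCircuit.prob_eq_gain, ← h]
    refine A.gain_mono _ _ _ fun l y _ => ?_
    have hnn : ∀ c ∈ (Finset.univ : Finset Bool), (0 : ℝ) ≤ if F.clawProblem.accept n κ.2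
        (Fin.append (right y) (F.coinElem n κ.2 (Oc (left y)) c)) = true then 1 else 0 :=
      fun c _ => by split_ifs <;> norm_num
    split_ifs with hf
    · simp only [markedForgery, kwForgery, Bool.and_eq_true, decide_eq_true_eq] at hf
      obtain ⟨⟨-, hd, hc⟩, hg, -⟩ := hf
      obtain ⟨c, hc⟩ : ∃ c, F.f₁ n κ.2 (right y) =
          F.markedRand n Oc κ.2 (Fin.cons c (left y)) :=
        hc.elim (fun h => ⟨_, h⟩) fun h => ⟨_, h⟩
      rw [markedRand_apply, Fin.tail_cons, Fin.cons_zero, markedPerm, if_pos hg] at hc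
      have hacc : F.clawProblem.accept n κ.2
          (Fin.append (right y) (F.coinElem n κ.2 (Oc (left y)) c)) = true := by
        refine decide_eq_true ?_
        rw [left_append, right_append]
        exact ⟨hd, coinElem_mem hκ _ _, hc⟩
      refine le_trans ?_ (Finset.single_le_sum hnn (Finset.mem_univ c))
      rw [if_pos hacc]
    · exact Finset.sum_nonneg hnn
  · rintro l y ⟨m, hm, h⟩
    rw [if_neg]
    simp only [markedForgery, Bool.and_eq_true, decide_eq_true_eq]
    exact fun h' => h'.2.2 m hm h
  · intro l m ρ hl
    rw [coinElem_eq_kwSign hκ]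
    exact fun h => hl ⟨m, by simp, h⟩

/-- The marks are independent of the random oracle, so a forger is stopped by them only with a
probability that is bounded away from 1 polynomially. -/
theorem le_expect_gain_markedForgery
    (A : QCircuit (k + 1) (F.domLen n) k (F.domLen n) (F.pkLen n) (k + F.domLen n))
    (ht : 2 * A.instrs.length ≤ 2 ^ t) (O : Bits (k + 1) → Bits (F.domLen n)) :
    A.prob O (fun (ρ : Bits 1) m => some (F.kwSign n O κ.1 m ρ)) κ.2 (F.kwForgery n O κ.2) ≤
      2 * 2 ^ t * 𝔼 g : Bits k → Bits t,
        A.gain O (fun (ρ : Bits 1) m => some (F.kwSign n O κ.1 m ρ)) κ.2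
          fun l y => if F.markedForgery n O g κ.2 l y then 1 else 0 := by
  rw [QCircuit.prob_eq_gain, ← A.gain_expect, ← A.gain_const_mul]
  refine A.gain_mono _ _ _ fun l y hl => ?_
  split_ifs with hf
  · have hm : left y ∉ l := by
      simp only [kwForgery, Bool.and_eq_true, decide_eq_true_eq] at hf
      exact hf.1
    have h := le_expect_marked (fun g : Bits t => allOnes g = true) (expect_allOnes t) l hm
    have h2 : ∀ g : Bits k → Bits t, (if F.markedForgery n O g κ.2 l y = true then (1 : ℝ) else 0) =
        if allOnes (g (left y)) = true ∧ ∀ m ∈ l, ¬ allOnes (g m) = true then 1 else 0 := by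
      intro g
      refine if_congr ?_ rfl rfl
      simp only [markedForgery, hf, Bool.true_and, decide_eq_true_eq]
    simp only [h2]
    have hpos : (0 : ℝ) < 2 ^ t := by positivity
    have hl' : 2 * (l.length : ℝ) ≤ 2 ^ t := by
      have : 2 * l.length ≤ 2 ^ t := (Nat.mul_le_mul_left 2 hl).trans ht
      exact_mod_cast this
    have hhalf : 1 / (2 * 2 ^ t) ≤ 1 / (2 : ℝ) ^ t * (1 - 1 / 2 ^ t * l.length) := by
      have h3 : 1 / (2 : ℝ) ^ t * l.length ≤ 1 / 2 := by
        rw [one_div, inv_mul_le_iff₀ hpos]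
        linarith
      calc 1 / (2 * 2 ^ t) = 1 / (2 : ℝ) ^ t * (1 / 2) := by field_simp
        _ ≤ _ := mul_le_mul_of_nonneg_left (by linarith) (by positivity)
    have h4 := hhalf.trans h
    rwa [div_le_iff₀' (by positivity)] at h4
  · exact mul_nonneg (by positivity) (Finset.expect_nonneg fun g _ => by split_ifs <;> norm_num)

/-- The marked variant of the reduction solves the claw problem with a polynomial loss. -/
theorem expect_prob_le_marked (hκ : κ ∈ (F.keyGen n).support)
    (A : QCircuit (k + 1) (F.domLen n) k (F.domLen n) (F.pkLen n) (k + F.domLen n))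
    (ht : 2 * A.instrs.length ≤ 2 ^ t) :
    𝔼 O ∈ F.kwOracles n k κ.2,
        A.prob O (fun (ρ : Bits 1) m => some (F.kwSign n O κ.1 m ρ)) κ.2 (F.kwForgery n O κ.2) ≤
      2 * 2 ^ t * ∑ c : Bool, 𝔼 Oc : Bits k → Bits (F.coinLen n + F.coinLen n + t),
        A.prob (F.markedRand n Oc κ.2)
        (fun (ρ : Bits 1) m => some (F.coinElem n κ.2 (Oc m) (ρ 0))) κ.2
        fun _ y => F.clawProblem.accept n κ.2
          (Fin.append (right y) (F.coinElem n κ.2 (Oc (left y)) c)) := by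
  refine (Finset.expect_le_expect fun O _ =>
    le_expect_gain_markedForgery (t := t) A ht O).trans ?_
  rw [← Finset.mul_expect]
  refine mul_le_mul_of_nonneg_left ?_ (by positivity)
  rw [← Finset.expect_sum_comm]
  refine le_trans (le_of_eq ?_) (Finset.expect_le_expect fun Oc _ => gain_markedForgery_le hκ A Oc)
  exact (expect_programmed (F.uniformOn_sample n hκ) (markedPerm_bijOn hκ) (markedPerm_bijOn hκ)
    (fun _ => false) fun O g => A.gain O
      (fun (ρ : Bits 1) m => some (F.kwSign n O κ.1 m ρ)) κ.2
        fun l y => if F.markedForgery n O g κ.2 l y then 1 else 0).symm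

end marked

section efficient

variable {F} {μ t a b i : ℕ → ℕ}

theorem efficient_coinElem {pk : ∀ n, (Bits (a n) → Bits (b n)) → Bits (i n) → Bits (F.pkLen n)}
    {w : ∀ n, (Bits (a n) → Bits (b n)) → Bits (i n) → Bits (F.coinLen n + F.coinLen n + t n)}
    {c : ∀ n, (Bits (a n) → Bits (b n)) → Bits (i n) → Bool}
    (hpk : EfficientRel a b i F.pkLen pk)
    (hw : EfficientRel a b i (fun n => F.coinLen n + F.coinLen n + t n) w)
    (hc : EfficientRel a b i (fun _ => 1) fun n O x => bit (c n O x)) :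
    EfficientRel a b i F.domLen fun n O x => F.coinElem n (pk n O x) (w n O x) (c n O x) := by
  refine (EfficientRel.ite F.domLen_poly hc
    (efficient_sample hpk (.comp .right (.comp .left hw)))
    (efficient_sample hpk (.comp .left (.comp .left hw)))).congr fun n O x => ?_
  rw [coinElem]
  cases c n O x <;> rfl

theorem efficient_const_true (o : ℕ → ℕ) : EfficientRel a b i o fun _ _ _ _ => true :=
  (EfficientRel.comp (EfficientRel.rewire (i := fun _ => 1) fun _ _ => 0) .const_true).congr
    fun _ _ _ => rfl

theorem efficient_markedRand (ht : PolyBounded t) :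
    EfficientRel μ (fun n => F.coinLen n + F.coinLen n + t n) (fun n => μ n + 1 + F.pkLen n)
      F.domLen fun n Oc w => F.markedRand n Oc (right w) (left w) := by
  have hw : EfficientRel μ (fun n => F.coinLen n + F.coinLen n + t n)
      (fun n => μ n + 1 + F.pkLen n) (fun n => F.coinLen n + F.coinLen n + t n)
      fun n Oc w => Oc (Fin.tail (left w)) :=
    EfficientRel.query (EfficientRel.rewire fun n k => Fin.castAdd (F.pkLen n) k.succ)
  have hc : EfficientRel μ (fun n => F.coinLen n + F.coinLen n + t n)
      (fun n => μ n + 1 + F.pkLen n) (fun _ => 1) fun n Oc w => bit ((left w : Bits (μ n + 1)) 0) :=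
    EfficientRel.rewire fun n _ => Fin.castAdd (F.pkLen n) 0
  have hx := efficient_coinElem (F := F) .right hw hc
  refine (EfficientRel.ite F.domLen_poly
    (EfficientRel.eq ht (EfficientRel.comp .right hw) (efficient_const_true _))
    (efficient_f₂ .right hx) (efficient_f₁ .right hx)).congr fun n O w => ?_
  exact markedRand_apply O (right w) (left w)

end efficient

end TrapdoorPair

/-! ### Security -/

/-- A nonnegative function that exceeds a negligible one by a polynomial factor at most is
negligible. -/
theorem Negligible.of_le_mul {f g : ℕ → ℝ} {h : ℕ → ℕ} (hg : Negligible g) (hh : PolyBounded h)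
    (h0 : ∀ n, 0 ≤ f n) (hle : ∀ n, f n ≤ h n * g n) : Negligible f := by
  obtain ⟨p, hp⟩ := hh
  refine (Asymptotics.SuperpolynomialDecay.polynomial_mul hg
    (p.map (Nat.castRingHom ℝ))).trans_abs_le fun n => ?_
  have h1 : (p.map (Nat.castRingHom ℝ)).eval (n : ℝ) = (p.eval n : ℕ) := by
    simp
  rw [abs_of_nonneg (h0 n), h1, abs_mul, Nat.abs_cast]
  calc f n ≤ h n * g n := hle n
    _ ≤ h n * |g n| := mul_le_mul_of_nonneg_left (le_abs_self _) (Nat.cast_nonneg _)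
    _ ≤ _ := mul_le_mul_of_nonneg_right (by exact_mod_cast hp n) (abs_nonneg _)

theorem QCircuit.prob_nonneg {a b μ s i o c : ℕ} (C : QCircuit a b μ s i o) (O : Bits a → Bits b)
    (sgn : Bits c → Bits μ → Option (Bits s)) (x : Bits i) (E : List (Bits μ) → Bits o → Bool) :
    0 ≤ C.prob O sgn x E := by
  have h := C.gain_const_mul O sgn x 0 fun _ _ => 0
  simp only [zero_mul] at h
  rw [prob_eq_gain]
  refine h.symm.le.trans (C.gain_mono _ _ _ fun l y _ => ?_)
  split_ifs <;> norm_num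

/-- The number of bits that mark a message with probability about `1 / (4 * q)`. -/
theorem exists_markLen {q : ℕ → ℕ} (hq : PolyBounded q) :
    ∃ t : ℕ → ℕ, PolyBounded t ∧ PolyBounded (fun n => 2 ^ t n) ∧ ∀ n, 2 * q n ≤ 2 ^ t n := by
  have h : PolyBounded fun n => 2 ^ Nat.clog 2 (2 * (q n + 1)) := by
    refine (((PolyBounded.const 4).mul (hq.add (.const 1)))).mono fun n => ?_
    have h1 := Nat.pow_pred_clog_lt_self (b := 2) one_lt_two (x := 2 * (q n + 1)) (by omega)
    have h2 : 0 < Nat.clog 2 (2 * (q n + 1)) := Nat.clog_pos one_lt_two (by omega)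
    obtain ⟨s, hs⟩ := Nat.exists_eq_succ_of_ne_zero h2.ne'
    rw [hs] at h1 ⊢
    simp only [Nat.pred_succ] at h1
    rw [pow_succ]
    omega
  refine ⟨fun n => Nat.clog 2 (2 * (q n + 1)), h.mono fun n => Nat.lt_two_pow_self.le, h,
    fun n => le_trans (by omega) (Nat.le_pow_clog one_lt_two (2 * (q n + 1)))⟩

namespace TrapdoorPair

variable {F : TrapdoorPair} {μ : ℕ → ℕ}

theorem kw_secureRepeat (hprf : QuantumPRFsExist) (hμ : PolyBounded μ) (hF : F.ClawFree) :
    (F.katzWang μ).SecureRepeat := by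
  intro A hA
  obtain ⟨B, hB, ν, hν, -, h⟩ := kw_exists_solver hprf hμ A hA
  refine Negligible.of_le_mul ((hF B hB).add hν) (.const 2) (fun n => ?_) fun n => ?_
  · exact Finset.sum_nonneg fun κ _ => mul_nonneg ENNReal.toReal_nonneg
      (Finset.expect_nonneg fun O _ => Finset.expect_nonneg fun β _ =>
        QCircuit.prob_nonneg _ _ _ _ _)
  · have h1 := kw_advRepeat_le A n
    have h2 := h n
    simp only [Pi.add_apply, Nat.cast_ofNat]
    linarith

/-- With fresh coins a forger may obtain both signatures of a message. Therefore the random oracle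
is programmed with `f₁` except for a few messages that are chosen at random. -/
theorem kw_secure (hprf : QuantumPRFsExist) (hμ : PolyBounded μ) (hF : F.ClawFree) :
    (F.katzWang μ).Secure := by
  intro (A : ∀ n, QCircuit (μ n + 1) (F.domLen n) (μ n) (F.domLen n) (F.pkLen n)
    (μ n + F.domLen n)) hA
  obtain ⟨t, ht, ht2, hqt⟩ := exists_markLen (q := fun n => (A n).instrs.length)
    (PolyBounded.mono hA fun n => Nat.le_add_left _ _)
  have hB : ∀ c : Bool, _ := fun c => exists_solver_of_prf hprf F.clawProblem F.pkLen_poly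
    (F.domLen_poly.add F.domLen_poly)
    (efficient_accept F) (a := μ) (b := fun n => F.coinLen n + F.coinLen n + t n)
    (a' := fun n => μ n + 1) (b' := F.domLen) (μ := μ) (s := F.domLen)
    (o := fun n => μ n + F.domLen n) (c := fun _ => 1) hμ
    ((F.coinLen_poly.add F.coinLen_poly).add ht) (hμ.add (.const 1)) F.domLen_poly hμ
    F.domLen_poly (hμ.add F.domLen_poly) (.const 1) A hA
    (rand := fun n Oc r pk => F.markedRand n Oc pk r) (efficient_markedRand ht)
    (sign := fun n Oc ρ m pk => F.coinElem n pk (Oc m) (ρ 0))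
    (efficient_coinElem .right (.query (.comp .right .left))
      ((EfficientRel.comp .left .left).congr fun n O w => by
        funext j; rw [Subsingleton.elim j 0]; rfl))
    (fin := fun n Oc y pk => Fin.append (right y) (F.coinElem n pk (Oc (left y)) c))
    (.pair (.comp .right .left) (efficient_coinElem .right (.query (.comp .left .left)) (by
      cases c
      · exact efficientRel_iff.2 ⟨_, .const 0, fun _ => .const_false⟩
      · exact .const_true)))
  choose B hB ν hν hν0 h using hB
  have hneg : Negligible fun n => ∑ c, (F.clawProblem.adv (B c) n + ν c n) := by
    simp only [Fintype.sum_bool]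
    exact ((hF _ (hB true)).add (hν true)).add ((hF _ (hB false)).add (hν false))
  refine Negligible.of_le_mul hneg ((PolyBounded.const 2).mul ht2) (fun n => ?_) fun n => ?_
  · exact Finset.sum_nonneg fun κ _ => mul_nonneg ENNReal.toReal_nonneg
      (Finset.expect_nonneg fun O _ => QCircuit.prob_nonneg _ _ _ _ _)
  · have h1 := sum_toReal_mono (F.keyGen n) fun κ hκ =>
      expect_prob_le_marked (t := t n) hκ (A n) (hqt n)
    refine h1.trans ?_
    push_cast
    simp only [mul_left_comm _ (2 * (2 : ℝ) ^ t n), ← Finset.mul_sum]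
    refine mul_le_mul_of_nonneg_left ?_ (by positivity)
    simp only [Finset.mul_sum]
    rw [Finset.sum_comm]
    refine Finset.sum_le_sum fun c _ => ?_
    exact (sum_map_toReal (F.keyGen n) Prod.snd fun x =>
      𝔼 Oc : Bits (μ n) → Bits (F.coinLen n + F.coinLen n + t n),
        (A n).prob (F.markedRand n Oc x)
        (fun (ρ : Bits 1) m => some (F.coinElem n x (Oc m) (ρ 0))) x
        fun _ y => F.clawProblem.accept n x
          (Fin.append (right y) (F.coinElem n x (Oc (left y)) c))).symm.trans_le (h c n)

end TrapdoorPair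

end QROM

end

theorem mainTheorem8 (F : QROM.TrapdoorPair) (μ : ℕ → ℕ) (hμ : QROM.PolyBounded μ) :
    (F.kwReduction μ).IsHistoryFree (fun _ => 1 / 2) ∧
    (∀ (A : (F.katzWang μ).Forger) (n : ℕ),
      (F.katzWang μ).advRepeat A n ≤ 2 * (F.kwReduction μ).simAdv A n ∧
      (F.katzWang μ).advDistinct A n ≤ 2 * (F.kwReduction μ).simAdv A n) ∧
    (QROM.QuantumPRFsExist →
      (∀ A : (F.katzWang μ).Forger, QROM.PolySize A →
        ∃ B : F.clawProblem.Solver, QROM.PolySize B ∧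
          ∃ ν : ℕ → ℝ, QROM.Negligible ν ∧ ∀ n,
            (F.katzWang μ).advRepeat A n ≤ 2 * F.clawProblem.adv B n + ν n ∧
            (F.katzWang μ).advDistinct A n ≤ 2 * F.clawProblem.adv B n + ν n) ∧
      (F.ClawFree → (F.katzWang μ).Secure ∧ (F.katzWang μ).SecureRepeat)) := by
  refine ⟨QROM.TrapdoorPair.kw_isHistoryFree hμ, fun A n =>
    ⟨QROM.TrapdoorPair.kw_advRepeat_le A n, QROM.TrapdoorPair.kw_advDistinct_le A n⟩,
    fun hprf => ⟨fun A hA => ?_, fun hF =>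
      ⟨QROM.TrapdoorPair.kw_secure hprf hμ hF, QROM.TrapdoorPair.kw_secureRepeat hprf hμ hF⟩⟩⟩
  obtain ⟨B, hB, ν, hν, -, h⟩ := QROM.TrapdoorPair.kw_exists_solver hprf hμ A hA
  refine ⟨B, hB, fun n => 2 * ν n, hν.const_mul 2, fun n => ?_⟩
  have h1 := QROM.TrapdoorPair.kw_advRepeat_le A n
  have h2 := QROM.TrapdoorPair.kw_advDistinct_le A n
  have h3 := h n
  constructor <;> linarith
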